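/- **Setting.** Let $\mathbb K$ be a field of characteristic zero. A theory consists of a set $F$ of fields, an involution $a\mapsto \bar a$ on $F$ (a propagator joins a half-edge carrying $a$ to one carrying $\bar a$), and a set of interaction monomials, each a multiset of at least three fields. A Feynman graph of the theory is a finite graph (multiple edges and self-loops allowed) whose half-edges carry fields; half-edges are either paired into internal edges, each joining some $a$ to $\bar a$, or are external legs; at every vertex the fields of the attached half-edges form an interaction monomial. Isomorphisms preserve fields and may permute external legs. A graph is 1PI if it is connected, has at least one internal edge, and stays connected after removal of any one internal edge. Its degree $|\Gamma|$ is the rank of $H_1(\Gamma,\mathbb Z)$ of the graph formed by its vertices and internal edges. A subgraph $\gamma\subset\Gamma$ is given by a set of internal edges of $\Gamma$, together with their endpoints; its external legs are all other half-edges of $\Gamma$ at these vertices. The quotient $\Gamma/\gamma$ is obtained by shrinking $\gamma$ to a single vertex carrying the external legs of $\gamma$, except that a $\gamma$ with exactly two external legs (a self-energy graph) is replaced by a single edge. Let $n(\Gamma_1,\Gamma_2;\Gamma)$ be the number of subgraphs $\gamma\subset\Gamma$ with $\gamma\cong\Gamma_2$ and $\Gamma/\gamma\cong\Gamma_1$.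 Let $\mathcal L$ be the $\mathbb K$-vector space with basis the isomorphism classes of 1PI graphs of the theory, with the bilinear product $$\Gamma_1*\Gamma_2=\sum_{\Gamma} n(\Gamma_1,\Gamma_2;\Gamma)\,\Gamma ,$$ the sum being over all (isomorphism classes of) 1PI graphs $\Gamma$ of the theory. **Theorem 2.1.** The degree and the coefficients $n(\Gamma_1,\Gamma_2;\Gamma)$ depend only on isomorphism classes, and the sum above is finite. The operation $*$ is right pre-Lie: for all $x,y,z\in\mathcal L$, $$(x*y)*z-x*(y*z)=(x*z)*y-x*(z*y).$$ Consequently $[x,y]=x*y-y*x$ is a Lie bracket on $\mathcal L$ (bilinear, alternating, satisfying the Jacobi identity). Moreover $\mathcal L=\bigoplus_{n\ge 0}\mathcal L_n$ with $\mathcal L_n$ spanned by the 1PI graphs of degree $n$, $\mathcal L_0=0$, and $\mathcal L_m*\mathcal L_n\subset\mathcal L_{m+n}$, $[\mathcal L_m,\mathcal L_n]\subset\mathcal L_{m+n}$. -/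

import Mathlib

universe u w

/-- The combinatorial data of a quantum field theory. `F` is the set of fields.  A propagator joins
a half-edge carrying a field `a` to one carrying the conjugate field `conj a` (for a real field
`conj a = a`).  `vertices` lists the interaction monomials of the Lagrangian, each one recorded as
the multiset of its fields; interactions are at least cubic, the quadratic monomials being the
propagators. -/
structure FieldTheory (F : Type u) where
  conj : F → F
  conj_conj : ∀ a, conj (conj a) = a
  vertices : Set (Multiset F)
  three_le_card : ∀ m ∈ vertices, 3 ≤ Multiset.card m

/-- A finite graph with internal and external edges, given by half-edges: `V` is the set of
vertices, `H` the set of half-edges, `vert h` the vertex at which `h` is attached, and `inv` the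
gluing involution.  A two-element orbit `{h, inv h}` is an internal edge; a fixed point of `inv` is
an external edge (leg).  Every half-edge carries a field.  Multiple edges and self-loops are
allowed. -/
structure FeynmanGraph (F : Type u) where
  V : Type
  H : Type
  finV : Finite V
  finH : Finite H
  vert : H → V
  inv : H → H
  inv_inv : ∀ h, inv (inv h) = h
  field : H → F

attribute [instance] FeynmanGraph.finV FeynmanGraph.finH

namespace FeynmanGraph

variable {F : Type u}

/-- Isomorphism of graphs: external legs may be permuted, fields are preserved. -/
def Iso (Γ Γ' : FeynmanGraph F) : Prop :=
  ∃ (f : Γ.V ≃ Γ'.V) (g : Γ.H ≃ Γ'.H),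
    (∀ h, Γ'.vert (g h) = f (Γ.vert h)) ∧ (∀ h, Γ'.inv (g h) = g (Γ.inv h)) ∧
      ∀ h, Γ'.field (g h) = Γ.field h

theorem Iso.refl (Γ : FeynmanGraph F) : Γ.Iso Γ :=
  ⟨Equiv.refl _, Equiv.refl _, fun _ => rfl, fun _ => rfl, fun _ => rfl⟩

theorem Iso.symm {Γ Γ' : FeynmanGraph F} : Γ.Iso Γ' → Γ'.Iso Γ := by
  rintro ⟨f, g, h1, h2, h3⟩
  refine ⟨f.symm, g.symm, fun h => ?_, fun h => ?_, fun h => ?_⟩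
  · rw [Equiv.eq_symm_apply, ← h1, Equiv.apply_symm_apply]
  · rw [Equiv.eq_symm_apply, ← h2, Equiv.apply_symm_apply]
  · rw [← h3, Equiv.apply_symm_apply]

theorem Iso.trans {Γ Γ' Γ'' : FeynmanGraph F} : Γ.Iso Γ' → Γ'.Iso Γ'' → Γ.Iso Γ'' := by
  rintro ⟨f, g, h1, h2, h3⟩ ⟨f', g', h1', h2', h3'⟩
  refine ⟨f.trans f', g.trans g', fun h => ?_, fun h => ?_, fun h => ?_⟩
  · simp [h1', h1]
  · simp [h2', h2]
  · simp [h3', h3]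

/-- The multiset of the fields carried by the half-edges in `s`. -/
noncomputable def fieldsOf (Γ : FeynmanGraph F) (s : Set Γ.H) : Multiset F :=
  s.toFinite.toFinset.val.map Γ.field

/-- `Γ` is a graph of the theory `T`: internal edges are propagators of `T`, and all vertices are
interaction monomials of `T`. -/
def IsGraphOf (Γ : FeynmanGraph F) (T : FieldTheory F) : Prop :=
  (∀ h, Γ.inv h ≠ h → Γ.field (Γ.inv h) = T.conj (Γ.field h)) ∧
    ∀ v, Γ.fieldsOf {h | Γ.vert h = v} ∈ T.vertices

/-- The simple graph on the vertices of `Γ` recording which vertices are joined by an internal edge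
made of half-edges in `s`. -/
def skeleton (Γ : FeynmanGraph F) (s : Set Γ.H) : SimpleGraph Γ.V :=
  SimpleGraph.fromRel fun u v =>
    ∃ h, h ∈ s ∧ Γ.inv h ∈ s ∧ Γ.inv h ≠ h ∧ Γ.vert h = u ∧ Γ.vert (Γ.inv h) = v

/-- One-particle irreducible: connected, with at least one internal edge, and still connected after
the removal of any one internal edge. -/
def OnePI (Γ : FeynmanGraph F) : Prop :=
  (Γ.skeleton Set.univ).Connected ∧ (∃ h, Γ.inv h ≠ h) ∧
    ∀ h, Γ.inv h ≠ h → (Γ.skeleton {h, Γ.inv h}ᶜ).Connected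

/-- The first homology group (with integer coefficients) of the graph formed by the vertices and
internal edges of `Γ`.  A one-chain is a function on half-edges that changes sign when an edge is
reversed (hence vanishes on external legs); the cycles are the chains whose boundary, computed at
each vertex, vanishes. -/
noncomputable def homology (Γ : FeynmanGraph F) : Submodule ℤ (Γ.H → ℤ) where
  carrier := {c | (∀ h, c (Γ.inv h) = - c h) ∧
    ∀ v, ∑ h ∈ {h | Γ.vert h = v}.toFinite.toFinset, c h = 0}
  zero_mem' := by simp
  add_mem' := by
    rintro a b ⟨ha, ha'⟩ ⟨hb, hb'⟩
    refine ⟨fun h => ?_, fun v => ?_⟩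
    · simp only [Pi.add_apply, ha h, hb h]; ring
    · simp only [Pi.add_apply, Finset.sum_add_distrib, ha' v, hb' v, add_zero]
  smul_mem' := by
    rintro r a ⟨ha, ha'⟩
    refine ⟨fun h => ?_, fun v => ?_⟩
    · simp only [Pi.smul_apply, smul_eq_mul, ha h]; ring
    · simp only [Pi.smul_apply, smul_eq_mul, ← Finset.mul_sum, ha' v, mul_zero]

/-- The number `|Γ|` of independent loops. -/
noncomputable def loopNumber (Γ : FeynmanGraph F) : ℕ := Module.finrank ℤ Γ.homology

/-- A subgraph of `Γ`, specified by its internal edges (as a set of half-edges). -/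
@[ext]
structure Sub (Γ : FeynmanGraph F) where
  carrier : Set Γ.H
  internal : ∀ h ∈ carrier, Γ.inv h ≠ h
  inv_mem : ∀ h ∈ carrier, Γ.inv h ∈ carrier

namespace Sub

variable {Γ : FeynmanGraph F} (γ : Γ.Sub)

/-- The vertices of a subgraph: the endpoints of its internal edges. -/
def verts : Set Γ.V := Γ.vert '' γ.carrier

/-- The external legs of a subgraph: the half-edges of `Γ` at vertices of `γ` that do not belong to
an internal edge of `γ`. -/
def legs : Set Γ.H := {h | Γ.vert h ∈ γ.verts ∧ h ∉ γ.carrier}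

theorem vert_mem {h : Γ.H} (hh : h ∈ γ.carrier) : Γ.vert h ∈ γ.verts := ⟨h, hh, rfl⟩

theorem not_mem_inv {h : Γ.H} (hh : h ∉ γ.carrier) : Γ.inv h ∉ γ.carrier := fun h' =>
  hh (by simpa [Γ.inv_inv] using γ.inv_mem _ h')

open Classical in
/-- The subgraph as a graph in its own right. -/
noncomputable def toGraph : FeynmanGraph F where
  V := {v : Γ.V // v ∈ γ.verts}
  H := {h : Γ.H // Γ.vert h ∈ γ.verts}
  finV := inferInstance
  finH := inferInstance
  vert h := ⟨Γ.vert h.1, h.2⟩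
  inv h := if hh : h.1 ∈ γ.carrier then ⟨Γ.inv h.1, γ.vert_mem (γ.inv_mem _ hh)⟩ else h
  inv_inv h := by
    by_cases hh : h.1 ∈ γ.carrier
    · simp [hh, γ.inv_mem _ hh, Γ.inv_inv]
    · simp [hh]
  field h := Γ.field h.1

open Classical in
/-- The graph obtained from `Γ` by shrinking all internal edges of `γ` to a point: the vertices of
`γ` are replaced by the single vertex `none`, to which the external legs of `γ` are attached. -/
noncomputable def contractToVertex : FeynmanGraph F where
  V := Option {v : Γ.V // v ∉ γ.verts}
  H := {h : Γ.H // h ∉ γ.carrier}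
  finV := inferInstance
  finH := inferInstance
  vert h := if hh : Γ.vert h.1 ∈ γ.verts then none else some ⟨Γ.vert h.1, hh⟩
  inv h := ⟨Γ.inv h.1, γ.not_mem_inv h.2⟩
  inv_inv h := Subtype.ext (Γ.inv_inv h.1)
  field h := Γ.field h.1

open Classical in
/-- If `γ` has exactly two external legs, the permutation exchanging them. -/
noncomputable def otherLeg (hγ : γ.legs.ncard = 2) : Equiv.Perm Γ.H :=
  Equiv.swap (Set.ncard_eq_two.1 hγ).choose (Set.ncard_eq_two.1 hγ).choose_spec.choose

theorem otherLeg_spec (hγ : γ.legs.ncard = 2) {k : Γ.H} (hk : k ∈ γ.legs) :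
    γ.otherLeg hγ k ∈ γ.legs ∧ γ.otherLeg hγ k ≠ k ∧
      γ.otherLeg hγ (γ.otherLeg hγ k) = k ∧
        ∀ k' ∈ γ.legs, k' ≠ k → k' = γ.otherLeg hγ k := by
  obtain ⟨hne, heq⟩ := (Set.ncard_eq_two.1 hγ).choose_spec.choose_spec
  unfold otherLeg
  generalize (Set.ncard_eq_two.1 hγ).choose_spec.choose = y at *
  generalize (Set.ncard_eq_two.1 hγ).choose = x at *
  rw [heq] at hk ⊢
  simp only [Set.mem_insert_iff, Set.mem_singleton_iff] at hk ⊢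
  rcases hk with rfl | rfl
  · simp [hne.symm]
  · simp [hne]

open Classical in
/-- The gluing outside a subgraph with two external legs, once that subgraph has been replaced by a
single edge: a half-edge that was glued to one leg of `γ` is now glued to the half-edge to which
the other leg of `γ` was glued, and it becomes external if the other leg of `γ` was external. -/
noncomputable def bypass (hγ : γ.legs.ncard = 2) (h : Γ.H) : Γ.H :=
  if Γ.vert (Γ.inv h) ∈ γ.verts then
    if Γ.inv (γ.otherLeg hγ (Γ.inv h)) = γ.otherLeg hγ (Γ.inv h) then h
    else Γ.inv (γ.otherLeg hγ (Γ.inv h))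
  else Γ.inv h

theorem bypass_spec (hγ : γ.legs.ncard = 2) {h : Γ.H} (hh : Γ.vert h ∉ γ.verts) :
    Γ.vert (γ.bypass hγ h) ∉ γ.verts ∧ γ.bypass hγ (γ.bypass hγ h) = h := by
  by_cases h1 : Γ.vert (Γ.inv h) ∈ γ.verts
  · have hleg : Γ.inv h ∈ γ.legs :=
      ⟨h1, γ.not_mem_inv fun hc => hh (γ.vert_mem hc)⟩
    obtain ⟨ho, hne, hoo, huniq⟩ := γ.otherLeg_spec hγ hleg
    by_cases h2 : Γ.inv (γ.otherLeg hγ (Γ.inv h)) = γ.otherLeg hγ (Γ.inv h)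
    · have e : γ.bypass hγ h = h := by simp [bypass, h1, h2]
      rw [e]
      exact ⟨hh, e⟩
    · have e : γ.bypass hγ h = Γ.inv (γ.otherLeg hγ (Γ.inv h)) := by simp [bypass, h1, h2]
      have hhne : Γ.inv (Γ.inv h) ≠ Γ.inv h := by
        rw [Γ.inv_inv]
        intro h3
        exact hh (h3 ▸ h1)
      rw [e]
      constructor
      · intro h3
        have hl : Γ.inv (γ.otherLeg hγ (Γ.inv h)) ∈ γ.legs := ⟨h3, γ.not_mem_inv ho.2⟩
        by_cases h4 : Γ.inv (γ.otherLeg hγ (Γ.inv h)) = Γ.inv h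
        · have := congrArg Γ.inv h4
          rw [Γ.inv_inv, Γ.inv_inv] at this
          exact hh (this ▸ ho.1)
        · exact h2 (huniq _ hl h4)
      · unfold bypass
        rw [Γ.inv_inv, if_pos ho.1, hoo, if_neg hhne, Γ.inv_inv]
  · have e : γ.bypass hγ h = Γ.inv h := by simp [bypass, h1]
    rw [e]
    refine ⟨h1, ?_⟩
    unfold bypass
    rw [Γ.inv_inv, if_neg hh]

/-- The graph obtained from `Γ` by replacing a self-energy subgraph `γ` (one with two external
legs) by a single edge. -/
noncomputable def contractToEdge (hγ : γ.legs.ncard = 2) : FeynmanGraph F where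
  V := {v : Γ.V // v ∉ γ.verts}
  H := {h : Γ.H // Γ.vert h ∉ γ.verts}
  finV := inferInstance
  finH := inferInstance
  vert h := ⟨Γ.vert h.1, h.2⟩
  inv h := ⟨γ.bypass hγ h.1, (γ.bypass_spec hγ h.2).1⟩
  inv_inv h := Subtype.ext (γ.bypass_spec hγ h.2).2
  field h := Γ.field h.1

open Classical in
/-- The quotient `Γ/γ`: the subgraph `γ` is replaced by its residue, which is a single edge if `γ`
is a self-energy graph and a single vertex otherwise. -/
noncomputable def contract : FeynmanGraph F :=
  if hγ : γ.legs.ncard = 2 then γ.contractToEdge hγ else γ.contractToVertex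

end Sub

/-- `n(Γ₁, Γ₂; Γ)`: the number of subgraphs `γ` of `Γ` isomorphic to `Γ₂` whose reduction gives a
graph `Γ/γ` isomorphic to `Γ₁`. -/
noncomputable def sectionCoeff (Γ₁ Γ₂ Γ : FeynmanGraph F) : ℕ :=
  Nat.card {γ : Γ.Sub // γ.toGraph.Iso Γ₂ ∧ γ.contract.Iso Γ₁}

end FeynmanGraph

/-- The 1PI graphs of a theory. -/
def OnePIGraph {F : Type u} (T : FieldTheory F) : Type (max 1 u) :=
  {Γ : FeynmanGraph F // Γ.IsGraphOf T ∧ Γ.OnePI}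

/-- Isomorphism of 1PI graphs. -/
instance OnePIGraph.setoid {F : Type u} (T : FieldTheory F) : Setoid (OnePIGraph T) where
  r Γ Γ' := Γ.1.Iso Γ'.1
  iseqv := ⟨fun Γ => FeynmanGraph.Iso.refl Γ.1, FeynmanGraph.Iso.symm, FeynmanGraph.Iso.trans⟩

/-- Isomorphism classes of 1PI graphs. -/
def OnePIClass {F : Type u} (T : FieldTheory F) : Type (max 1 u) :=
  Quotient (OnePIGraph.setoid T)

namespace OnePIClass

variable {F : Type u} {T : FieldTheory F}

/-- A graph representing the class. -/
noncomputable def graph (Γ : OnePIClass T) : FeynmanGraph F := (Quotient.out Γ).1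

/-- The coefficient `n(Γ₁, Γ₂; Γ)` for isomorphism classes. -/
noncomputable def coeff (Γ₁ Γ₂ Γ : OnePIClass T) : ℕ :=
  FeynmanGraph.sectionCoeff Γ₁.graph Γ₂.graph Γ.graph

/-- The loop number `|Γ|`. -/
noncomputable def loopNumber (Γ : OnePIClass T) : ℕ := Γ.graph.loopNumber

end OnePIClass

/-- The vector space with basis the 1PI graphs of the theory `T` (up to isomorphism). -/
abbrev GraphSpace (K : Type w) [Field K] {F : Type u} (T : FieldTheory F) : Type (max 1 u w) :=
  OnePIClass T →₀ K

namespace GraphSpace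

variable (K : Type w) [Field K] {F : Type u} (T : FieldTheory F)

/-- The insertion product: the bilinear map with `Γ₁ ∗ Γ₂ = ∑ n(Γ₁, Γ₂; Γ) Γ` on 1PI graphs, the
sum being over all 1PI graphs. -/
noncomputable def insertion : GraphSpace K T →ₗ[K] GraphSpace K T →ₗ[K] GraphSpace K T :=
  Finsupp.linearCombination K fun Γ₁ : OnePIClass T =>
    Finsupp.linearCombination K fun Γ₂ : OnePIClass T =>
      ∑ᶠ Γ : OnePIClass T, (Finsupp.single Γ (OnePIClass.coeff Γ₁ Γ₂ Γ : K) : GraphSpace K T)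

/-- The antisymmetrization `[x, y] = x ∗ y - y ∗ x` of the insertion product. -/
noncomputable def bracket : GraphSpace K T →ₗ[K] GraphSpace K T →ₗ[K] GraphSpace K T :=
  LinearMap.mk₂ K (fun x y => insertion K T x y - insertion K T y x)
    (fun x x' y => by simp only [map_add, LinearMap.add_apply]; abel)
    (fun c x y => by simp only [map_smul, LinearMap.smul_apply, smul_sub])
    (fun x y y' => by simp only [map_add, LinearMap.add_apply]; abel)
    (fun c x y => by simp only [map_smul, LinearMap.smul_apply, smul_sub])

/-- The span of the 1PI graphs with `n` loops. -/
noncomputable def degreePart (n : ℕ) : Submodule K (GraphSpace K T) :=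
  Finsupp.supported K K {Γ : OnePIClass T | Γ.loopNumber = n}

end GraphSpace

/-! The associator of `∗` counts pairs of disjoint insertions, and that count is symmetric in the
two inserted graphs.

Fix a 1PI graph G of the theory. Its coefficient in (Γ₁ ∗ Γ₂) ∗ Γ₃ is the number of pairs (c, e)
with c ≅ Γ₃ a subgraph of G, e ≅ Γ₂ a subgraph of G/c, and (G/c)/e ≅ Γ₁. Its coefficient in Γ₁ ∗ (Γ₂
∗ Γ₃) is the number of chains c ⊂ d ⊂ G with c ≅ Γ₃, d/c ≅ Γ₂ and G/d ≅ Γ₁. In both counts the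
intermediate graph, G/c or d, must be a 1PI graph of the theory. A pair (c, e) is of one of two
kinds. If e meets the residue of c (the contracted vertex, or the edge that replaces c), then e =
d/c for a unique d containing c, and (G/c)/(d/c) = G/d; these pairs correspond to the chains.
Otherwise e is a subgraph of G without a common vertex with c. Hence the associator counts the
disjoint pairs (`HalfEdgeGraph.ncard_quotPairs`), and since quotients by disjoint subgraphs commute,
the pairs can be swapped (`HalfEdgeGraph.ncard_disjointPairs`).

The intermediate graphs need care. In terms of cuts, being 1PI passes to quotients that have an
edge, and lifts from c and d/c to d. Whether G/c belongs to the theory depends only on the legs of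
c, and these are the same in G, in d, and in a quotient by a disjoint subgraph.

All graphs derived from G live on one type of half-edges, so the identities between iterated
subgraphs and quotients are equalities rather than isomorphisms; `HalfEdgeGraph.Realizes` links them
to Feynman graphs.

For the grading, restriction to the half-edges that survive in G/c maps the cycles of G onto those
of G/c, with kernel the cycles of c (`HalfEdgeGraph.OnePI.finrank_homology`). A 1PI graph has a
nonzero cycle because the ends of a removed edge stay connected. The sums are finite because every
half-edge of G comes from Γ₁ or from Γ₂. -/

/-! ### Graphs, subgraphs and quotients on a fixed set of half-edges -/

/-- A graph whose half-edges form a subset of an ambient type `X`, so that subgraphs and quotients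
of such a graph live on the same type.  The relation `r` says that two half-edges are attached to
the same vertex; its domain `{x | r x x}` is the set of half-edges.  The gluing involution `i` is
the identity outside that domain. -/
@[ext]
structure HalfEdgeGraph (X : Type w) where
  r : X → X → Prop
  i : X → X
  symm : ∀ {x y}, r x y → r y x
  trans : ∀ {x y z}, r x y → r y z → r x z
  i_i : ∀ x, i (i x) = x
  i_off : ∀ x, ¬ r x x → i x = x

namespace HalfEdgeGraph

variable {X : Type w}

open Classical in
/-- The map exchanging the two elements of a two-element set `K`, and the identity when `K` does
not have exactly two elements. -/
noncomputable def flip (K : Set X) (x : X) : X :=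
  if h : ∃ y, y ≠ x ∧ K = {x, y} then h.choose else x

theorem flip_pair {a b : X} (h : b ≠ a) : flip {a, b} a = b := by
  have h' : ∃ y, y ≠ a ∧ ({a, b} : Set X) = {a, y} := ⟨b, h, rfl⟩
  rw [flip, dif_pos h']
  obtain ⟨h1, h2⟩ := h'.choose_spec
  generalize h'.choose = z at h1 h2
  have h3 : z ∈ ({a, b} : Set X) := by rw [h2]; simp
  rcases h3 with h3 | h3
  · exact absurd h3 h1
  · exact h3

theorem flip_pair' {a b : X} (h : b ≠ a) : flip {a, b} b = a := by
  rw [Set.pair_comm]; exact flip_pair h.symm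

theorem flip_cases (K : Set X) (x : X) : (∃ y, y ≠ x ∧ K = {x, y} ∧ flip K x = y) ∨
    flip K x = x := by
  by_cases h : ∃ y, y ≠ x ∧ K = {x, y}
  · obtain ⟨y, h1, rfl⟩ := h
    exact Or.inl ⟨y, h1, rfl, flip_pair h1⟩
  · exact Or.inr (by rw [flip, dif_neg h])

theorem flip_flip (K : Set X) (x : X) : flip K (flip K x) = x := by
  rcases flip_cases K x with ⟨y, h1, rfl, h2⟩ | h
  · rw [h2, flip_pair' h1]
  · rw [h, h]

theorem flip_mem {K : Set X} {x : X} (hx : x ∈ K) : flip K x ∈ K := by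
  rcases flip_cases K x with ⟨y, h1, rfl, h2⟩ | h
  · rw [h2]; simp
  · rwa [h]

variable (G : HalfEdgeGraph X)

theorem r_left {x y : X} (h : G.r x y) : G.r x x := G.trans h (G.symm h)

theorem r_right {x y : X} (h : G.r x y) : G.r y y := G.trans (G.symm h) h

theorem dom_of_ne {x : X} (h : G.i x ≠ x) : G.r x x := by
  by_contra h'; exact h (G.i_off x h')

theorem dom_i {x : X} (h : G.r x x) : G.r (G.i x) (G.i x) := by
  by_contra h'
  have := G.i_off _ h'
  rw [G.i_i] at this
  rw [← this] at h'
  exact h' h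

/-- The half-edges attached to the vertices that meet `c`. -/
def star (c : Set X) : Set X := {x | ∃ y ∈ c, G.r y x}

/-- The external legs of the subgraph with edges `c`. -/
def legs (c : Set X) : Set X := G.star c \ c

/-- The half-edges outside a subgraph which are glued to its legs. -/
def outer (c : Set X) : Set X := {x | x ∉ G.star c ∧ G.i x ∈ G.star c}

/-- The set `c` of half-edges is a union of internal edges. -/
structure IsEdgeSet (c : Set X) : Prop where
  ne : ∀ x ∈ c, G.i x ≠ x
  mem : ∀ x ∈ c, G.i x ∈ c

variable {G}

theorem IsEdgeSet.subset_star {c : Set X} (hc : G.IsEdgeSet c) {x : X} (hx : x ∈ c) :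
    x ∈ G.star c := ⟨x, hx, G.dom_of_ne (hc.ne x hx)⟩

theorem IsEdgeSet.mem_iff {c : Set X} (hc : G.IsEdgeSet c) {x : X} : G.i x ∈ c ↔ x ∈ c :=
  ⟨fun h => by simpa [G.i_i] using hc.mem _ h, hc.mem x⟩

theorem star_sat {c : Set X} {x y : X} (h : G.r x y) : x ∈ G.star c ↔ y ∈ G.star c :=
  ⟨fun ⟨z, hz, h'⟩ => ⟨z, hz, G.trans h' h⟩, fun ⟨z, hz, h'⟩ => ⟨z, hz, G.trans h' (G.symm h)⟩⟩

theorem dom_of_star {c : Set X} {x : X} (h : x ∈ G.star c) : G.r x x := by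
  obtain ⟨y, _, h⟩ := h
  exact G.r_right h

theorem star_mono {c d : Set X} (h : c ⊆ d) : G.star c ⊆ G.star d :=
  fun _ ⟨y, hy, h'⟩ => ⟨y, h hy, h'⟩

variable (G)

open Classical in
/-- The subgraph with edges `c`. -/
noncomputable def sub (c : Set X) : HalfEdgeGraph X where
  r x y := G.r x y ∧ x ∈ G.star c
  -- Testing both `x` and `G.i x` keeps this an involution for every set `c`; for a union of edges
  -- one test suffices.
  i x := if x ∈ c ∧ G.i x ∈ c then G.i x else x
  symm h := ⟨G.symm h.1, (star_sat h.1).1 h.2⟩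
  trans h h' := ⟨G.trans h.1 h'.1, h.2⟩
  i_i x := by have := G.i_i x; grind
  i_off x h := by
    split_ifs with h'
    · by_contra hne
      exact h ⟨G.dom_of_ne hne, x, h'.1, G.dom_of_ne hne⟩
    · rfl

open Classical in
/-- The quotient that shrinks the edges in `c` to a vertex. -/
noncomputable def vquot (c : Set X) : HalfEdgeGraph X where
  r x y := x ∉ c ∧ y ∉ c ∧ (G.r x y ∨ (x ∈ G.star c ∧ y ∈ G.star c))
  i x := if x ∈ c ∨ G.i x ∈ c then x else G.i x
  symm := by
    rintro x y ⟨h1, h2, h3 | h3⟩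
    · exact ⟨h2, h1, Or.inl (G.symm h3)⟩
    · exact ⟨h2, h1, Or.inr h3.symm⟩
  trans := by
    rintro x y z ⟨h1, h2, h3 | h3⟩ ⟨h4, h5, h6 | h6⟩
    · exact ⟨h1, h5, Or.inl (G.trans h3 h6)⟩
    · exact ⟨h1, h5, Or.inr ⟨(star_sat h3).2 h6.1, h6.2⟩⟩
    · exact ⟨h1, h5, Or.inr ⟨h3.1, (star_sat h6).1 h3.2⟩⟩
    · exact ⟨h1, h5, Or.inr ⟨h3.1, h6.2⟩⟩
  i_i x := by have := G.i_i x; grind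
  i_off x h := by have := G.i_off x; grind

open Classical in
/-- The quotient that replaces the subgraph with edges `c` by an edge. -/
noncomputable def equot (c : Set X) : HalfEdgeGraph X where
  r x y := G.r x y ∧ x ∉ G.star c
  -- If only one leg is glued to the outside, `outer c` is not a pair and `flip` is the identity:
  -- the half-edge glued to that leg becomes external.
  i x := if x ∈ G.star c then x else if G.i x ∈ G.star c then flip (G.outer c) x else G.i x
  symm h := ⟨G.symm h.1, fun h' => h.2 ((star_sat h.1).2 h')⟩
  trans h h' := ⟨G.trans h.1 h'.1, h.2⟩
  i_i x := by
    have := G.i_i x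
    have h1 := @flip_mem _ (G.outer c) x
    have h2 := flip_flip (G.outer c) x
    simp only [outer, Set.mem_ofPred_eq] at *
    grind
  i_off x h := by
    by_cases h' : x ∈ G.star c
    · simp [h']
    · have h1 : ¬ G.r x x := fun h2 => h ⟨h2, h'⟩
      have h2 := G.i_off x h1
      simp [h', h2]

open Classical in
/-- The quotient by the subgraph with edges `c`. -/
noncomputable def quot (c : Set X) : HalfEdgeGraph X :=
  if (G.legs c).ncard = 2 then G.equot c else G.vquot c

/-- One-particle irreducibility in terms of cuts: there is an internal edge, and no cut consists of
at most one edge. -/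
structure OnePI : Prop where
  exists_edge : ∃ x, G.i x ≠ x
  cut : ∀ A : Set X, (∀ x y, G.r x y → (x ∈ A ↔ y ∈ A)) → {x | x ∈ A ∧ G.i x ∉ A}.Subsingleton →
    (∀ x, G.r x x → x ∉ A) ∨ (∀ x, G.r x x → x ∈ A)

variable {G}

theorem quot_eq_equot {c : Set X} (h : (G.legs c).ncard = 2) : G.quot c = G.equot c := if_pos h

theorem quot_eq_vquot {c : Set X} (h : (G.legs c).ncard ≠ 2) : G.quot c = G.vquot c := if_neg h

open Classical in
theorem IsEdgeSet.sub_i {c : Set X} (hc : G.IsEdgeSet c) (x : X) :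
    (G.sub c).i x = if x ∈ c then G.i x else x := by
  have := @IsEdgeSet.mem_iff _ _ _ hc x
  simp [sub, this]

open Classical in
theorem IsEdgeSet.vquot_i {c : Set X} (hc : G.IsEdgeSet c) (x : X) :
    (G.vquot c).i x = if x ∈ c then x else G.i x := by
  have := @IsEdgeSet.mem_iff _ _ _ hc x
  simp [vquot, this]

theorem sub_r {c : Set X} {x y : X} : (G.sub c).r x y ↔ G.r x y ∧ x ∈ G.star c := Iff.rfl

theorem vquot_r {c : Set X} {x y : X} : (G.vquot c).r x y ↔
    x ∉ c ∧ y ∉ c ∧ (G.r x y ∨ (x ∈ G.star c ∧ y ∈ G.star c)) := Iff.rfl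

theorem equot_r {c : Set X} {x y : X} : (G.equot c).r x y ↔ G.r x y ∧ x ∉ G.star c := Iff.rfl

open Classical in
theorem equot_i {c : Set X} (x : X) : (G.equot c).i x =
    if x ∈ G.star c then x else if G.i x ∈ G.star c then flip (G.outer c) x else G.i x := rfl

/-- Every vertex of a 1PI graph meets an internal edge. -/
theorem OnePI.exists_internal (hG : G.OnePI) {x : X} (hx : G.r x x) :
    ∃ y, G.r x y ∧ G.i y ≠ y := by
  by_contra hne
  push Not at hne
  obtain ⟨z, hz⟩ := hG.exists_edge
  -- If every half-edge at the vertex of `x` were external, that vertex would be cut off by an empty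
  -- cut, so it would be the whole graph, which does have an edge.
  have hcut := hG.cut {y | G.r x y} (fun a b hab =>
      ⟨fun h => G.trans h hab, fun h => G.trans h (G.symm hab)⟩) (by
    rintro a ⟨ha, ha'⟩
    exact absurd (by rw [hne a ha]; exact ha) ha')
  rcases hcut with h | h
  · exact h x hx hx
  · exact hz (hne z (h z (G.dom_of_ne hz)))

/-- In a 1PI graph, a subgraph that is glued to its complement by at most one edge contains all
vertices. -/
theorem OnePI.star_eq (hG : G.OnePI) {c : Set X} (hc : G.IsEdgeSet c) (hne : c.Nonempty)
    (h : (G.outer c).Subsingleton) {x : X} (hx : G.r x x) : x ∈ G.star c := by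
  rcases hG.cut (G.star c) (fun a b => star_sat) (by
    rintro a ⟨ha, ha'⟩ b ⟨hb, hb'⟩
    have := @h (G.i a) ⟨ha', by rwa [G.i_i]⟩ (G.i b) ⟨hb', by rwa [G.i_i]⟩
    rw [← G.i_i a, this, G.i_i]) with h | h
  · obtain ⟨y, hy⟩ := hne
    exact absurd (hc.subset_star hy) (h y (dom_of_star (hc.subset_star hy)))
  · exact h x hx

/-- The two legs of a self-energy subgraph of a 1PI graph, and the half-edges glued to them. -/
theorem OnePI.exists_legs (hG : G.OnePI) {c : Set X} (hc : G.IsEdgeSet c) (hne : c.Nonempty)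
    (h2 : (G.legs c).ncard = 2) (hout : ∃ x, G.r x x ∧ x ∉ G.star c) :
    ∃ p q, p ≠ q ∧ G.legs c = {p, q} ∧ G.i p ∉ G.star c ∧ G.i q ∉ G.star c ∧
      G.outer c = {G.i p, G.i q} := by
  obtain ⟨p, q, hpq, hl⟩ := Set.ncard_eq_two.1 h2
  have hsub : ∀ x ∈ G.outer c, x = G.i p ∨ x = G.i q := by
    rintro x ⟨hx, hx'⟩
    have : G.i x ∈ G.legs c := ⟨hx', fun h => hx (hc.subset_star (hc.mem_iff.1 h))⟩
    rw [hl] at this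
    rcases this with h | h
    · left; rw [← h, G.i_i]
    · right; rw [← h, G.i_i]
  -- At most one edge leaving `c` would force `c` to contain every vertex. So both legs lead
  -- outside: a leg glued back to a vertex of `c` would leave at most one outgoing edge.
  have hns : ¬ (G.outer c).Subsingleton := by
    intro h
    obtain ⟨x, hx, hx'⟩ := hout
    exact hx' (hG.star_eq hc hne h hx)
  have hp : p ∈ G.star c := (show p ∈ G.legs c by rw [hl]; simp).1
  have hq : q ∈ G.star c := (show q ∈ G.legs c by rw [hl]; simp).1
  have h1 : G.i p ∉ G.star c := by
    intro h
    apply hns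
    have : ∀ x ∈ G.outer c, x = G.i q := fun x hx => by
      rcases hsub x hx with rfl | h'
      · exact absurd h hx.1
      · exact h'
    intro a ha b hb
    rw [this a ha, this b hb]
  have h2 : G.i q ∉ G.star c := by
    intro h
    apply hns
    have : ∀ x ∈ G.outer c, x = G.i p := fun x hx => by
      rcases hsub x hx with h' | rfl
      · exact h'
      · exact absurd h hx.1
    intro a ha b hb
    rw [this a ha, this b hb]
  refine ⟨p, q, hpq, hl, h1, h2, ?_⟩
  ext x
  refine ⟨fun h => hsub x h, ?_⟩
  rintro (rfl | rfl)
  · exact ⟨h1, by rwa [G.i_i]⟩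
  · exact ⟨h2, by rwa [G.i_i]⟩

-- Once both legs are known to be glued outside, `flip` is just the exchange of their two partners;
-- this explicit form reduces later arguments to case distinctions.
open Classical in
theorem equot_i_of_legs {c : Set X} {p q : X} (hpq : p ≠ q)
    (ho : G.outer c = {G.i p, G.i q}) (x : X) : (G.equot c).i x =
      if x ∈ G.star c then x else if x = G.i p then G.i q else if x = G.i q then G.i p
        else G.i x := by
  have hne : G.i q ≠ G.i p := fun h => hpq (by rw [← G.i_i p, ← h, G.i_i])
  have hm : G.i x ∈ G.star c → x ∉ G.star c → x = G.i p ∨ x = G.i q := fun h1 h2 => by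
    have : x ∈ G.outer c := ⟨h2, h1⟩
    rwa [ho] at this
  have hp : G.i p ∈ G.outer c := by rw [ho]; simp
  have hq : G.i q ∈ G.outer c := by rw [ho]; simp
  have f1 := flip_pair hne
  have f2 := flip_pair' hne
  rw [← ho] at f1 f2
  have h3 := hp.2
  have h4 := hq.2
  rw [equot_i]
  grind

end HalfEdgeGraph

/-! ### Nested subgraphs and their quotients -/

namespace HalfEdgeGraph

variable {X : Type w} {G : HalfEdgeGraph X} {c d : Set X}

/-- A subgraph keeps all half-edges at its vertices, turning some into legs. Hence `c` has the same
legs in `d` as in `G`, and its residue is of the same type in both. -/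
theorem star_sub (h : c ⊆ d) : (G.sub d).star c = G.star c := by
  ext x
  exact ⟨fun ⟨y, hy, h'⟩ => ⟨y, hy, h'.1⟩,
    fun ⟨y, hy, h'⟩ => ⟨y, hy, h', y, h hy, G.r_left h'⟩⟩

theorem legs_sub (h : c ⊆ d) : (G.sub d).legs c = G.legs c := by
  rw [legs, star_sub h, legs]

theorem IsEdgeSet.sub_iff (hd : G.IsEdgeSet d) (h : c ⊆ d) :
    (G.sub d).IsEdgeSet c ↔ G.IsEdgeSet c := by
  have hi : ∀ x ∈ c, (G.sub d).i x = G.i x := fun x hx => by rw [hd.sub_i, if_pos (h hx)]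
  constructor
  · intro hc
    exact ⟨fun x hx => hi x hx ▸ hc.ne x hx, fun x hx => hi x hx ▸ hc.mem x hx⟩
  · intro hc
    exact ⟨fun x hx => (hi x hx).symm ▸ hc.ne x hx, fun x hx => (hi x hx).symm ▸ hc.mem x hx⟩

theorem IsEdgeSet.subset_of_sub (hd : G.IsEdgeSet d) (hc : (G.sub d).IsEdgeSet c) : c ⊆ d := by
  intro x hx
  by_contra h
  have := hc.ne x hx
  rw [hd.sub_i, if_neg h] at this
  exact this rfl

theorem sub_sub (hd : G.IsEdgeSet d) (hc : G.IsEdgeSet c) (h : c ⊆ d) :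
    (G.sub d).sub c = G.sub c := by
  ext x y
  · rw [sub_r, sub_r, sub_r, star_sub h]
    have := @star_mono _ G _ _ h x
    tauto
  · rw [((hd.sub_iff h).2 hc).sub_i, hc.sub_i, hd.sub_i]
    have := @h x
    grind

/-- When the legs of `c` are internal in `d`, their partners are the same in `d` and in `G`. -/
theorem outer_sub (hd : G.IsEdgeSet d) (h : G.star c ⊆ d) (hcd : c ⊆ d) :
    (G.sub d).outer c = G.outer c := by
  ext x
  simp only [outer, Set.mem_ofPred_eq, star_sub hcd, hd.sub_i]
  have h1 := @hd.mem_iff _ _ _ x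
  have h2 := @h (G.i x)
  grind

/-! Quotients by nested subgraphs, shrinking the smaller one to a vertex. -/

/-- The leg of `c` that lies in `d` is what makes the contracted vertex a vertex of `d \ c`; without
it the remaining legs of `c` would be missed. -/
theorem star_vquot_diff (h : c ⊆ d) (hl : (G.legs c ∩ d).Nonempty) :
    (G.vquot c).star (d \ c) = G.star d \ c := by
  obtain ⟨z, ⟨hz1, hz2⟩, hz3⟩ := hl
  ext x
  constructor
  · rintro ⟨y, ⟨hy, hy'⟩, h1, h2, h3 | h3⟩
    · exact ⟨⟨y, hy, h3⟩, h2⟩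
    · exact ⟨star_mono h h3.2, h2⟩
  · rintro ⟨⟨y, hy, hyx⟩, hx⟩
    by_cases h' : x ∈ G.star c
    · exact ⟨z, ⟨hz3, hz2⟩, hz2, hx, Or.inr ⟨hz1, h'⟩⟩
    · have hy' : y ∉ c := fun hy' => h' ⟨y, hy', hyx⟩
      exact ⟨y, ⟨hy, hy'⟩, hy', hx, Or.inl hyx⟩

theorem IsEdgeSet.vquot_iff (hc : G.IsEdgeSet c) {c' : Set X} :
    (G.vquot c).IsEdgeSet c' ↔ Disjoint c c' ∧ G.IsEdgeSet c' := by
  rw [Set.disjoint_left]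
  constructor
  · intro h
    have h0 : ∀ x ∈ c', x ∉ c := fun x hx hx' => h.ne x hx (by rw [hc.vquot_i, if_pos hx'])
    have hi : ∀ x ∈ c', (G.vquot c).i x = G.i x := fun x hx => by
      rw [hc.vquot_i, if_neg (h0 x hx)]
    exact ⟨fun x hx hx' => h0 x hx' hx, fun x hx => hi x hx ▸ h.ne x hx,
      fun x hx => hi x hx ▸ h.mem x hx⟩
  · rintro ⟨h0, h⟩
    have hi : ∀ x ∈ c', (G.vquot c).i x = G.i x := fun x hx => by
      rw [hc.vquot_i, if_neg (fun hx' => h0 hx' hx)]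
    exact ⟨fun x hx => (hi x hx).symm ▸ h.ne x hx, fun x hx => (hi x hx).symm ▸ h.mem x hx⟩

theorem IsEdgeSet.diff (hc : G.IsEdgeSet c) (hd : G.IsEdgeSet d) : G.IsEdgeSet (d \ c) :=
  ⟨fun x hx => hd.ne x hx.1, fun x hx => ⟨hd.mem x hx.1, fun h => hx.2 (hc.mem_iff.1 h)⟩⟩

theorem sub_vquot (hc : G.IsEdgeSet c) (hd : G.IsEdgeSet d) (h : c ⊆ d)
    (hl : (G.legs c ∩ d).Nonempty) : (G.vquot c).sub (d \ c) = (G.sub d).vquot c := by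
  have he : (G.vquot c).IsEdgeSet (d \ c) := hc.vquot_iff.2 ⟨Set.disjoint_sdiff_right, hc.diff hd⟩
  ext x y
  · rw [sub_r, vquot_r, vquot_r, sub_r, star_vquot_diff h hl, star_sub h]
    have := @star_mono _ G _ _ h x
    grind
  · rw [he.sub_i, hc.vquot_i, ((hd.sub_iff h).2 hc).vquot_i, hd.sub_i]
    grind

theorem legs_vquot_diff (h : c ⊆ d) (hl : (G.legs c ∩ d).Nonempty) :
    (G.vquot c).legs (d \ c) = G.legs d := by
  rw [legs, star_vquot_diff h hl, legs]
  ext x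
  have := @h x
  grind

theorem outer_vquot_diff (hc : G.IsEdgeSet c) (h : c ⊆ d) (hd : G.IsEdgeSet d)
    (hl : (G.legs c ∩ d).Nonempty) : (G.vquot c).outer (d \ c) = G.outer d := by
  ext x
  simp only [outer, Set.mem_ofPred_eq, star_vquot_diff h hl, hc.vquot_i]
  have := @hc.mem_iff _ _ _ x
  have := @hd.subset_star _ _ _ x
  have := @h x
  have := @h (G.i x)
  grind

/-- The analogue of (G/c)/(d/c) = G/d. Both sides make the same choice between edge and vertex
because `d \ c` has in `G/c` the legs that `d` has in `G`. -/
theorem quot_vquot (hc : G.IsEdgeSet c) (hd : G.IsEdgeSet d) (h : c ⊆ d)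
    (hl : (G.legs c ∩ d).Nonempty) : (G.vquot c).quot (d \ c) = G.quot d := by
  have he : (G.vquot c).IsEdgeSet (d \ c) := hc.vquot_iff.2 ⟨Set.disjoint_sdiff_right, hc.diff hd⟩
  have hm := @star_mono _ G _ _ h
  by_cases h2 : (G.legs d).ncard = 2
  · rw [quot_eq_equot h2, quot_eq_equot (by rwa [legs_vquot_diff h hl])]
    ext x y
    · rw [equot_r, vquot_r, equot_r, star_vquot_diff h hl]
      have h1 := @hd.subset_star _ _ _ x
      have h2 := @hd.subset_star _ _ _ y
      have h3 := @h x
      have h4 := @h y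
      have h5 := @hm x
      have h6 := fun h => @star_sat _ G d x y h
      grind
    · rw [equot_i, equot_i, star_vquot_diff h hl, outer_vquot_diff hc h hd hl, hc.vquot_i]
      have := @hc.mem_iff _ _ _ x
      have := @hd.subset_star _ _ _ x
      have := @h x
      have := @h (G.i x)
      grind
  · rw [quot_eq_vquot h2, quot_eq_vquot (by rwa [legs_vquot_diff h hl])]
    ext x y
    · rw [vquot_r, vquot_r, vquot_r, star_vquot_diff h hl]
      have h3 := @h x
      have h4 := @h y
      have h5 := @hm x
      have h6 := @hm y
      grind
    · rw [he.vquot_i, hc.vquot_i, hd.vquot_i]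
      have := @h x
      grind

/-! Quotients by nested subgraphs, replacing the smaller one by an edge. -/

theorem star_equot (e : Set X) (he : Disjoint (G.star c) e) :
    (G.equot c).star e = G.star e \ G.star c := by
  rw [Set.disjoint_right] at he
  ext x
  constructor
  · rintro ⟨y, hy, h1, h2⟩
    exact ⟨⟨y, hy, h1⟩, fun h => h2 ((star_sat h1).2 h)⟩
  · rintro ⟨⟨y, hy, hyx⟩, hx⟩
    exact ⟨y, hy, hyx, he hy⟩

theorem star_equot_diff : (G.equot c).star (d \ G.star c) = G.star d \ G.star c := by
  rw [star_equot _ Set.disjoint_sdiff_right]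
  ext x
  constructor
  · rintro ⟨⟨y, hy, hyx⟩, hx⟩
    exact ⟨⟨y, hy.1, hyx⟩, hx⟩
  · rintro ⟨⟨y, hy, hyx⟩, hx⟩
    exact ⟨⟨y, ⟨hy, fun h => hx ((star_sat hyx).1 h)⟩, hyx⟩, hx⟩

/-- The legs of `c` lie in `d`, hence so do their partners, and the edge that replaces `c` joins two
half-edges of `d`. -/
theorem isEdgeSet_equot_diff {p q : X} (hpq : p ≠ q)
    (ho : G.outer c = {G.i p, G.i q}) (hd : G.IsEdgeSet d) (hl : G.star c ⊆ d) :
    (G.equot c).IsEdgeSet (d \ G.star c) := by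
  have hp : G.i p ∈ G.outer c := by rw [ho]; simp
  have hq : G.i q ∈ G.outer c := by rw [ho]; simp
  have hip := G.i_i p
  have hiq := G.i_i q
  have h1 := hp.2
  have h2 := hq.2
  have h3 := hp.1
  have h4 := hq.1
  have h5 := hd.mem p (hl (hip ▸ h1))
  have h6 := hd.mem q (hl (hiq ▸ h2))
  constructor
  · rintro x ⟨hx, hx'⟩
    rw [equot_i_of_legs hpq ho]
    have := hd.ne x hx
    grind
  · rintro x ⟨hx, hx'⟩
    rw [equot_i_of_legs hpq ho]
    have := hd.mem x hx
    by_cases hs : G.i x ∈ G.star c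
    · have : x ∈ G.outer c := ⟨hx', hs⟩
      rw [ho] at this
      grind
    · grind

theorem sub_equot {p q : X} (hpq : p ≠ q)
    (ho : G.outer c = {G.i p, G.i q}) (hd : G.IsEdgeSet d) (h : c ⊆ d) (hl : G.star c ⊆ d) :
    (G.equot c).sub (d \ G.star c) = (G.sub d).equot c := by
  have he := isEdgeSet_equot_diff hpq ho hd hl
  have hp : G.i p ∈ G.outer c := by rw [ho]; simp
  have hq : G.i q ∈ G.outer c := by rw [ho]; simp
  ext x y
  · rw [sub_r, equot_r, equot_r, sub_r, star_equot_diff, star_sub h]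
    grind
  · rw [he.sub_i, equot_i, equot_i, outer_sub hd hl h, star_sub h, hd.sub_i]
    have := @hl x
    have := @hl (G.i x)
    have := @hd.mem_iff _ _ _ x
    grind

theorem legs_equot_diff (hl : G.star c ⊆ d) :
    (G.equot c).legs (d \ G.star c) = G.legs d := by
  rw [legs, star_equot_diff, legs]
  ext x
  have := @hl x
  grind

theorem quot_equot {p q : X} (hpq : p ≠ q)
    (ho : G.outer c = {G.i p, G.i q}) (hd : G.IsEdgeSet d) (h : c ⊆ d) (hl : G.star c ⊆ d) :
    (G.equot c).quot (d \ G.star c) = G.quot d := by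
  have he := isEdgeSet_equot_diff hpq ho hd hl
  have hm := @star_mono _ G _ _ h
  -- Half-edges glued to `star c` belong to `d`, so replacing `c` by an edge changes no gluing
  -- outside `d`.
  have hi : ∀ x, x ∉ d → (G.equot c).i x = G.i x := fun x hx => by
    have := @hl x
    have := @hl (G.i x)
    have := @hd.mem_iff _ _ _ x
    rw [equot_i]
    grind
  have hii : ∀ x, x ∈ d → (G.equot c).i x ∈ d := fun x hx => by
    by_contra h
    have h1 := hi _ h
    rw [i_i] at h1
    exact h (hd.mem_iff.1 (h1 ▸ hx))
  by_cases h2 : (G.legs d).ncard = 2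
  · rw [quot_eq_equot h2, quot_eq_equot (by rwa [legs_equot_diff hl])]
    have hout : (G.equot c).outer (d \ G.star c) = G.outer d := by
      ext x
      simp only [outer, Set.mem_ofPred_eq, star_equot_diff]
      by_cases hx : x ∈ d
      · have := @hd.subset_star _ _ _ x hx
        have h3 : x ∈ G.star c → (G.equot c).i x = x := fun h => by rw [equot_i, if_pos h]
        grind
      · rw [hi x hx]
        have := @hl x
        have := @hl (G.i x)
        have := @hd.mem_iff _ _ _ x
        grind
    ext x y
    · rw [equot_r, equot_r, equot_r, star_equot_diff]
      have h5 := @hm x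
      grind
    · rw [equot_i, equot_i (c := d), star_equot_diff, hout]
      by_cases hx : x ∈ d
      · have := @hd.subset_star _ _ _ x hx
        have h3 : x ∈ G.star c → (G.equot c).i x = x := fun h => by rw [equot_i, if_pos h]
        grind
      · rw [hi x hx]
        have := @hl x
        have := @hl (G.i x)
        have := @hd.mem_iff _ _ _ x
        have := @hm x
        grind
  · rw [quot_eq_vquot h2, quot_eq_vquot (by rwa [legs_equot_diff hl])]
    ext x y
    · rw [vquot_r, equot_r, vquot_r, star_equot_diff]
      have h1 := @hd.subset_star _ _ _ x
      have h2 := @hd.subset_star _ _ _ y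
      have h3 := @hl x
      have h4 := @hl y
      have h5 := @hm x
      have h6 := fun h => @star_sat _ G c x y h
      grind
    · rw [he.vquot_i, hd.vquot_i]
      by_cases hx : x ∈ d
      · have h3 : x ∈ G.star c → (G.equot c).i x = x := fun h => by rw [equot_i, if_pos h]
        grind
      · rw [hi x hx]
        grind

end HalfEdgeGraph

namespace HalfEdgeGraph

variable {X : Type w} {G : HalfEdgeGraph X} {c e : Set X}

/-! Quotients by two disjoint subgraphs. -/

theorem disjoint_star_star (h : Disjoint (G.star c) e) : Disjoint (G.star c) (G.star e) := by
  rw [Set.disjoint_left] at *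
  rintro x hx ⟨y, hy, hyx⟩
  exact h ((star_sat hyx).2 hx) hy

theorem star_vquot (hc : G.IsEdgeSet c) (h : Disjoint (G.star c) e) :
    (G.vquot c).star e = G.star e := by
  have h' := disjoint_star_star h
  rw [Set.disjoint_left] at h h'
  ext x
  constructor
  · rintro ⟨y, hy, h1, h2, h3 | h3⟩
    · exact ⟨y, hy, h3⟩
    · exact absurd hy (h h3.1)
  · rintro hx
    have h2 : x ∉ c := fun hxc => h' (hc.subset_star hxc) hx
    obtain ⟨y, hy, hyx⟩ := hx
    exact ⟨y, hy, fun hyc => h (hc.subset_star hyc) hy, h2, Or.inl hyx⟩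

theorem star_quot (hc : G.IsEdgeSet c) (h : Disjoint (G.star c) e) :
    (G.quot c).star e = G.star e := by
  by_cases h2 : (G.legs c).ncard = 2
  · rw [quot_eq_equot h2, star_equot _ h, (disjoint_star_star h).sdiff_eq_right]
  · rw [quot_eq_vquot h2, star_vquot hc h]

theorem legs_quot (hc : G.IsEdgeSet c) (h : Disjoint (G.star c) e) :
    (G.quot c).legs e = G.legs e := by
  rw [legs, star_quot hc h, legs]

theorem quot_i_of_mem (hc : G.IsEdgeSet c) (he : G.IsEdgeSet e) (h : Disjoint (G.star c) e) {x : X}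
    (hx : x ∈ e) : (G.quot c).i x = G.i x := by
  rw [Set.disjoint_left] at h
  have h1 := he.mem x hx
  by_cases h2 : (G.legs c).ncard = 2
  · rw [quot_eq_equot h2, equot_i, if_neg fun h' => h h' hx, if_neg fun h' => h h' h1]
  · rw [quot_eq_vquot h2, hc.vquot_i, if_neg fun h' => h (hc.subset_star h') hx]

theorem isEdgeSet_quot (hc : G.IsEdgeSet c) (he : G.IsEdgeSet e) (h : Disjoint (G.star c) e) :
    (G.quot c).IsEdgeSet e := by
  have hi := @quot_i_of_mem _ _ _ _ hc he h
  exact ⟨fun x hx => (hi hx).symm ▸ he.ne x hx, fun x hx => (hi hx).symm ▸ he.mem x hx⟩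

theorem sub_quot (hc : G.IsEdgeSet c) (he : G.IsEdgeSet e) (h : Disjoint (G.star c) e) :
    (G.quot c).sub e = G.sub e := by
  have h' := disjoint_star_star h
  rw [Set.disjoint_right] at h h'
  ext x y
  · rw [sub_r, sub_r, star_quot hc (Set.disjoint_right.2 h)]
    by_cases h2 : (G.legs c).ncard = 2
    · rw [quot_eq_equot h2, equot_r]
      have := @h' x
      tauto
    · rw [quot_eq_vquot h2, vquot_r]
      have h3 := @h' x
      have h4 := @h' y
      have h5 := @hc.subset_star _ _ _ x
      have h6 := @hc.subset_star _ _ _ y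
      have h7 := fun h => @star_sat _ G e x y h
      grind
  · rw [(isEdgeSet_quot hc he (Set.disjoint_right.2 h)).sub_i, he.sub_i]
    by_cases hx : x ∈ e
    · rw [if_pos hx, if_pos hx, quot_i_of_mem hc he (Set.disjoint_right.2 h) hx]
    · rw [if_neg hx, if_neg hx]

theorem vquot_vquot_comm (hc : G.IsEdgeSet c) (he : G.IsEdgeSet e) (h : Disjoint (G.star c) e)
    (h' : Disjoint (G.star e) c) : (G.vquot c).vquot e = (G.vquot e).vquot c := by
  have hce : Disjoint c e := h.mono_left fun x => hc.subset_star
  ext x y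
  · rw [vquot_r, vquot_r, vquot_r, vquot_r, star_vquot hc h, star_vquot he h']
    have h0 := disjoint_star_star h
    rw [Set.disjoint_left] at h0
    have h1 := @h0 x
    have h2 := @h0 y
    have h3 := @hc.subset_star _ _ _ x
    have h4 := @hc.subset_star _ _ _ y
    have h5 := @he.subset_star _ _ _ x
    have h6 := @he.subset_star _ _ _ y
    grind
  · rw [(hc.vquot_iff.2 ⟨hce, he⟩).vquot_i, (he.vquot_iff.2 ⟨hce.symm, hc⟩).vquot_i, hc.vquot_i,
      he.vquot_i]
    grind

theorem outer_vquot (hc : G.IsEdgeSet c) (h : Disjoint (G.star c) e) :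
    (G.vquot c).outer e = G.outer e := by
  ext x
  simp only [outer, Set.mem_ofPred_eq, star_vquot hc h, hc.vquot_i]
  have h' := disjoint_star_star h
  rw [Set.disjoint_left] at h h'
  have h1 := @hc.subset_star _ _ _ x
  have h2 := @h' (G.i x)
  have h3 := @hc.subset_star _ _ _ (G.i x)
  have h4 := @hc.mem_iff _ _ _ x
  grind

theorem vquot_equot_comm (hc : G.IsEdgeSet c) (h : Disjoint (G.star c) e)
    (h' : Disjoint (G.star e) c) (hce : (G.equot e).IsEdgeSet c) :
    (G.vquot c).equot e = (G.equot e).vquot c := by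
  have h0 := disjoint_star_star h
  rw [Set.disjoint_left] at h0
  ext x y
  · rw [vquot_r, equot_r, equot_r, vquot_r, star_vquot hc h, star_equot _ h',
      (disjoint_star_star h').sdiff_eq_right]
    have h1 := @h0 x
    have h2 := @h0 y
    have h3 := fun h => @star_sat _ G e x y h
    grind
  · rw [hce.vquot_i, equot_i, equot_i, hc.vquot_i, star_vquot hc h, outer_vquot hc h]
    have h1 := @hc.subset_star _ _ _ x
    have h2 := @h0 x
    grind

/-- The delicate case is that of two self-energies in succession on one line, where a leg of `c` is
glued to a leg of `e`. The hypotheses on the `outer` sets in the two quotients exclude that `c` and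
`e` are glued to each other by both legs and close up into a loop. -/
theorem equot_equot_comm (h : Disjoint (G.star c) e)
    (h' : Disjoint (G.star e) c) {p q s t : X} (hpq : p ≠ q) (hst : s ≠ t)
    (hoc : G.outer c = {G.i p, G.i q}) (hoe : G.outer e = {G.i s, G.i t})
    (hoc' : (G.equot e).outer c = {(G.equot e).i p, (G.equot e).i q})
    (hoe' : (G.equot c).outer e = {(G.equot c).i s, (G.equot c).i t}) :
    (G.equot c).equot e = (G.equot e).equot c := by
  have hs := (disjoint_star_star h').sdiff_eq_right
  have hs' := (disjoint_star_star h).sdiff_eq_right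
  ext x y
  · rw [equot_r, equot_r, equot_r, equot_r, star_equot _ h, star_equot _ h', hs, hs']
    tauto
  · have h0 := disjoint_star_star h
    rw [Set.disjoint_left] at h0
    have m1 : (G.equot e).i p ∈ (G.equot e).outer c := by rw [hoc']; simp
    have m2 : (G.equot e).i q ∈ (G.equot e).outer c := by rw [hoc']; simp
    have m3 : (G.equot c).i s ∈ (G.equot c).outer e := by rw [hoe']; simp
    have m4 : (G.equot c).i t ∈ (G.equot c).outer e := by rw [hoe']; simp
    have n1 : G.i p ∈ G.outer c := by rw [hoc]; simp
    have n2 : G.i q ∈ G.outer c := by rw [hoc]; simp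
    have n3 : G.i s ∈ G.outer e := by rw [hoe]; simp
    have n4 : G.i t ∈ G.outer e := by rw [hoe]; simp
    have k1 := m1.1
    have k2 := m2.1
    have k3 := m3.1
    have k4 := m4.1
    simp only [star_equot _ h, star_equot _ h', hs, hs'] at k1 k2 k3 k4
    rw [equot_i_of_legs hst hoe', equot_i_of_legs hpq hoc', star_equot _ h, star_equot _ h', hs,
      hs']
    have f := equot_i_of_legs hpq hoc
    have g := equot_i_of_legs hst hoe
    have n1' := n1.2
    have n2' := n2.2
    have n3' := n3.2
    have n4' := n4.2
    have n1'' := n1.1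
    have n2'' := n2.1
    have n3'' := n3.1
    have n4'' := n4.1
    have ip := G.i_i p
    have iq := G.i_i q
    have is := G.i_i s
    have it := G.i_i t
    have ix := G.i_i x
    have u1 : ∀ y, y ∉ G.star c → G.i y ∈ G.star c → y = G.i p ∨ y = G.i q := fun y h1 h2 => by
      have : y ∈ G.outer c := ⟨h1, h2⟩
      rwa [hoc] at this
    have u2 : ∀ y, y ∉ G.star e → G.i y ∈ G.star e → y = G.i s ∨ y = G.i t := fun y h1 h2 => by
      have : y ∈ G.outer e := ⟨h1, h2⟩
      rwa [hoe] at this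
    -- These instances decide which leg of one subgraph, if any, is glued to a leg of the other.
    have u3 := u1 s
    have u4 := u1 t
    have u5 := u2 p
    have u6 := u2 q
    clear u1 u2 m1 m2 m3 m4 n1 n2 n3 n4 hoc hoe hoc' hoe' h h' hs hs'
    have fs := f s
    have ft := f t
    have fx := f x
    have gp := g p
    have gq := g q
    have gx := g x
    clear f g
    have a1 := @h0 p
    have a2 := @h0 q
    have a3 := @h0 s
    have a4 := @h0 t
    have a5 := @h0 x
    grind (splits := 30)

end HalfEdgeGraph

/-! ### One-particle irreducibility of quotients and of extensions -/

namespace HalfEdgeGraph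

variable {X : Type w} {G : HalfEdgeGraph X} {c e : Set X}

/-- A cut of the quotient lifts to `G` by placing all vertices of `c` on the side of the contracted
vertex; no edge of `c` crosses the lifted cut `B`. -/
theorem OnePI.vquot (hG : G.OnePI) (hc : G.IsEdgeSet c) (hx : ∃ x, (G.vquot c).i x ≠ x) :
    (G.vquot c).OnePI := by
  refine ⟨hx, fun A hA hcut => ?_⟩
  let B : Set X := {x | (x ∉ G.star c ∧ x ∈ A) ∨ (x ∈ G.star c ∧ ∃ z ∈ A, z ∈ G.legs c)}
  have hB : ∀ x, x ∉ c → (x ∈ B ↔ x ∈ A) := by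
    intro x hx
    by_cases hs : x ∈ G.star c
    · have h1 : x ∈ B ↔ ∃ z ∈ A, z ∈ G.legs c := by simp [B, hs]
      rw [h1]
      exact ⟨fun ⟨z, hz, hz'⟩ => (hA z x ⟨hz'.2, hx, Or.inr ⟨hz'.1, hs⟩⟩).1 hz,
        fun h => ⟨x, h, hs, hx⟩⟩
    · simp [B, hs]
  have key := hG.cut B (by
    intro x y hxy
    have h1 := @star_sat _ G c _ _ hxy
    by_cases hs : x ∈ G.star c
    · have hs' := h1.1 hs
      simp [B, hs, hs']
    · have hs' : y ∉ G.star c := fun h => hs (h1.2 h)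
      have := hA x y ⟨fun h => hs (hc.subset_star h), fun h => hs' (hc.subset_star h), Or.inl hxy⟩
      simp [B, hs, hs', this]) (by
    have hsub : ∀ x, x ∈ B → G.i x ∉ B → x ∈ A ∧ (G.vquot c).i x ∉ A := by
      intro x h1 h2
      have hxc : x ∉ c := by
        intro h
        have h3 := hc.subset_star h
        have h4 := hc.subset_star (hc.mem x h)
        simp only [B, Set.mem_ofPred_eq, h3, h4] at h1 h2
        simp at h1 h2
        obtain ⟨z, hz, hz'⟩ := h1
        exact h2 z hz hz'
      have hixc : G.i x ∉ c := fun h => hxc (hc.mem_iff.1 h)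
      rw [hc.vquot_i, if_neg hxc, ← hB x hxc, ← hB _ hixc]
      exact ⟨h1, h2⟩
    exact fun x hx y hy => hcut (hsub x hx.1 hx.2) (hsub y hy.1 hy.2))
  have hdom : ∀ x, (G.vquot c).r x x → x ∉ c ∧ G.r x x := by
    rintro x ⟨h1, -, h2 | h2⟩
    · exact ⟨h1, h2⟩
    · exact ⟨h1, dom_of_star h2.1⟩
  rcases key with h | h
  · exact Or.inl fun x hx h' => h x (hdom x hx).2 ((hB x (hdom x hx).1).2 h')
  · exact Or.inr fun x hx => (hB x (hdom x hx).1).1 (h x (hdom x hx).2)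

/-- A cut of the quotient lifts to `G` by placing `c` on the side of `G.i p`. The edge at `p` then
does not cross, and the edge at `q` crosses exactly when the new edge does, so the cut does not
grow. -/
theorem OnePI.equot (hG : G.OnePI) {p q : X} (hpq : p ≠ q) (ho : G.outer c = {G.i p, G.i q})
    (hx : ∃ x, (G.equot c).i x ≠ x) : (G.equot c).OnePI := by
  refine ⟨hx, fun A hA hcut => ?_⟩
  let B : Set X := {x | (x ∉ G.star c ∧ x ∈ A) ∨ (x ∈ G.star c ∧ G.i p ∈ A)}
  have f := equot_i_of_legs hpq ho
  have n1 : G.i p ∈ G.outer c := by rw [ho]; simp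
  have n2 : G.i q ∈ G.outer c := by rw [ho]; simp
  have n1' := n1.2
  have n2' := n2.2
  have n1'' := n1.1
  have n2'' := n2.1
  have ip := G.i_i p
  have iq := G.i_i q
  have hout : ∀ y, y ∉ G.star c → G.i y ∈ G.star c → y = G.i p ∨ y = G.i q := fun y h1 h2 => by
    have : y ∈ G.outer c := ⟨h1, h2⟩
    rwa [ho] at this
  have key := hG.cut B (by
    intro x y hxy
    have h1 := @star_sat _ G c _ _ hxy
    by_cases hs : x ∈ G.star c
    · have hs' := h1.1 hs
      simp [B, hs, hs']
    · have hs' : y ∉ G.star c := fun h => hs (h1.2 h)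
      have := hA x y ⟨hxy, hs⟩
      simp [B, hs, hs', this]) (by
    -- A half-edge crossing the lifted cut is either an old crossing away from `c` or one of the two
    -- halves of the edge at `q`, depending on the direction.
    have hsub : ∀ x, x ∈ B → G.i x ∉ B → (x ∈ A ∧ x ∉ G.star c ∧ G.i x ∉ G.star c ∧ G.i x ∉ A) ∨
        (x = q ∧ G.i p ∈ A ∧ G.i q ∉ A) ∨ (x = G.i q ∧ G.i p ∉ A ∧ G.i q ∈ A) := by
      intro x h1 h2
      simp only [B, Set.mem_ofPred_eq] at h1 h2
      have h3 := hout x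
      have h4 := hout (G.i x)
      rw [G.i_i] at h4
      have h5 := G.i_i x
      grind
    have fp := f (G.i p)
    have fq := f (G.i q)
    have hne : G.i q ≠ G.i p := fun h => hpq (by rw [← G.i_i p, ← h, G.i_i])
    rw [if_neg n1'', if_pos rfl] at fp
    rw [if_neg n2'', if_neg hne, if_pos rfl] at fq
    have hin : ∀ x, x ∉ G.star c → G.i x ∉ G.star c → (G.equot c).i x = G.i x := by
      intro x h1 h2
      rw [equot_i, if_neg h1, if_neg h2]
    intro x hx y hy
    have hx' := hsub x hx.1 hx.2
    have hy' := hsub y hy.1 hy.2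
    have hcut' : ∀ x y, x ∈ A → (G.equot c).i x ∉ A → y ∈ A → (G.equot c).i y ∉ A → x = y :=
      fun x y h1 h2 h3 h4 => hcut ⟨h1, h2⟩ ⟨h3, h4⟩
    have h3 := hcut' x y
    have h4 := hcut' x (G.i p)
    have h5 := hcut' x (G.i q)
    have h6 := hcut' y (G.i p)
    have h7 := hcut' y (G.i q)
    have h8 := hin x
    have h9 := hin y
    clear f hout hsub hA hcut hcut'
    grind)
  rcases key with h | h
  · exact Or.inl fun x hx h' => h x hx.1 (Or.inl ⟨hx.2, h'⟩)
  · refine Or.inr fun x hx => ?_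
    rcases h x hx.1 with h' | h'
    · exact h'.2
    · exact absurd h'.1 hx.2

/-- If the quotient by a self-energy subgraph has an internal edge, both legs of the subgraph are
glued to half-edges outside. -/
theorem OnePI.exists_legs_of_quot (hG : G.OnePI) (hc : G.IsEdgeSet c) (hne : c.Nonempty)
    (h2 : (G.legs c).ncard = 2) (hx : ∃ x, (G.quot c).i x ≠ x) :
    ∃ p q, p ≠ q ∧ G.legs c = {p, q} ∧ G.i p ∉ G.star c ∧ G.i q ∉ G.star c ∧
      G.outer c = {G.i p, G.i q} := by
  obtain ⟨x, hx⟩ := hx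
  have hr := (G.quot c).dom_of_ne hx
  rw [quot_eq_equot h2] at hr
  exact hG.exists_legs hc hne h2 ⟨x, hr⟩

/-- Quotients of 1PI graphs are 1PI as soon as they have an internal edge. -/
theorem OnePI.quot (hG : G.OnePI) (hc : G.IsEdgeSet c) (hne : c.Nonempty)
    (hx : ∃ x, (G.quot c).i x ≠ x) : (G.quot c).OnePI := by
  by_cases h2 : (G.legs c).ncard = 2
  · obtain ⟨p, q, hpq, -, -, -, ho⟩ := hG.exists_legs_of_quot hc hne h2 hx
    rw [quot_eq_equot h2] at hx ⊢
    exact hG.equot hpq ho hx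
  · rw [quot_eq_vquot h2] at hx ⊢
    exact hG.vquot hc hx

/-- Without legs `c` would be a connected component, hence all of `G`, and no edge would be left in
the quotient. -/
theorem OnePI.legs_nonempty (hG : G.OnePI) (hc : G.IsEdgeSet c) (hne : c.Nonempty)
    (hx : ∃ x, (G.quot c).i x ≠ x) : (G.legs c).Nonempty := by
  rw [Set.nonempty_iff_ne_empty]
  intro h
  obtain ⟨x, hx⟩ := hx
  rw [quot_eq_vquot (by simp [h])] at hx
  have hs : G.star c = c := by
    apply Set.Subset.antisymm
    · rwa [legs, Set.sdiff_eq_empty] at h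
    · exact fun x => hc.subset_star
  have ho : (G.outer c).Subsingleton := by
    rintro y ⟨hy, hy'⟩
    rw [hs] at hy hy'
    exact absurd (hc.mem_iff.1 hy') hy
  have hr : G.r x x ∧ x ∉ c := by
    obtain ⟨h1, -, h2 | h2⟩ := (G.vquot c).dom_of_ne hx
    · exact ⟨h2, h1⟩
    · exact ⟨dom_of_star h2.1, h1⟩
  have := hG.star_eq hc hne ho hr.1
  rw [hs] at this
  exact hr.2 this

theorem OnePI.nonempty_of_sub (hs : (G.sub c).OnePI) (hc : G.IsEdgeSet c) : c.Nonempty := by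
  obtain ⟨x, hx⟩ := hs.exists_edge
  refine ⟨x, ?_⟩
  by_contra h
  rw [hc.sub_i, if_neg h] at hx
  exact hx rfl

/-- A cut of `G` with at most one edge restricts to such a cut of the 1PI subgraph, so it cannot
separate the vertices of `c`. -/
theorem OnePI.star_cut (hs : (G.sub c).OnePI) (hc : G.IsEdgeSet c) {A : Set X}
    (hA : ∀ x y, G.r x y → (x ∈ A ↔ y ∈ A)) (hcut : {x | x ∈ A ∧ G.i x ∉ A}.Subsingleton) :
    (∀ x ∈ G.star c, x ∉ A) ∨ (∀ x ∈ G.star c, x ∈ A) := by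
  have h1 := hs.cut A (fun x y h => hA x y h.1) (fun x hx y hy => hcut
    (by
      refine ⟨hx.1, ?_⟩
      have := hx.2
      rw [hc.sub_i] at this
      split_ifs at this
      · exact this
      · exact absurd hx.1 this)
    (by
      refine ⟨hy.1, ?_⟩
      have := hy.2
      rw [hc.sub_i] at this
      split_ifs at this
      · exact this
      · exact absurd hy.1 this))
  exact h1.imp (fun h x hx => h x ⟨dom_of_star hx, hx⟩) (fun h x hx => h x ⟨dom_of_star hx, hx⟩)

/-- A small cut does not separate `c`, hence descends to the quotient and is trivial there. A leg,
present both at `c` and at the contracted vertex, forces the two trivial sides to agree. -/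
theorem OnePI.of_vquot (hc : G.IsEdgeSet c) (hs : (G.sub c).OnePI) (hq : (G.vquot c).OnePI)
    (hl : (G.legs c).Nonempty) : G.OnePI := by
  obtain ⟨x₀, hx₀c⟩ := hs.nonempty_of_sub hc
  refine ⟨⟨x₀, hc.ne _ hx₀c⟩, fun A hA hcut => ?_⟩
  have hstar := hs.star_cut hc hA hcut
  have h2 := hq.cut A (by
      rintro x y ⟨h1, h2, h3 | h3⟩
      · exact hA x y h3
      · rcases hstar with h | h
        · simp [h x h3.1, h y h3.2]
        · simp [h x h3.1, h y h3.2]) (fun x hx y hy => hcut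
    (by
      refine ⟨hx.1, ?_⟩
      have := hx.2
      rw [hc.vquot_i] at this
      split_ifs at this
      · exact absurd hx.1 this
      · exact this)
    (by
      refine ⟨hy.1, ?_⟩
      have := hy.2
      rw [hc.vquot_i] at this
      split_ifs at this
      · exact absurd hy.1 this
      · exact this))
  obtain ⟨z, hz, hz'⟩ := hl
  have hzr : (G.vquot c).r z z := ⟨hz', hz', Or.inr ⟨hz, hz⟩⟩
  have hdom : ∀ x, G.r x x → x ∈ G.star c ∨ (G.vquot c).r x x := fun x hx => by
    by_cases h : x ∈ c
    · exact Or.inl (hc.subset_star h)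
    · exact Or.inr ⟨h, h, Or.inl hx⟩
  rcases hstar with h | h <;> rcases h2 with h' | h'
  · exact Or.inl fun x hx => (hdom x hx).elim (h x) (h' x)
  · exact absurd (h' z hzr) (h z hz)
  · exact absurd (h z hz) (h' z hzr)
  · exact Or.inr fun x hx => (hdom x hx).elim (h x) (h' x)

/-- A small cut has `c` on one side, so if the new edge crosses it, exactly one of the edges at `p`
and `q` crosses: the cut stays small in the quotient. If `c` and everything else lay on opposite
sides, both of these edges would cross. -/
theorem OnePI.of_equot (hc : G.IsEdgeSet c) (hs : (G.sub c).OnePI) (hq : (G.equot c).OnePI)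
    {p q : X} (hpq : p ≠ q) (ho : G.outer c = {G.i p, G.i q}) : G.OnePI := by
  obtain ⟨x₀, hx₀c⟩ := hs.nonempty_of_sub hc
  refine ⟨⟨x₀, hc.ne _ hx₀c⟩, fun A hA hcut => ?_⟩
  have hstar := hs.star_cut hc hA hcut
  have n1 : G.i p ∈ G.outer c := by rw [ho]; simp
  have n2 : G.i q ∈ G.outer c := by rw [ho]; simp
  have n1' := n1.2
  have n2' := n2.2
  have n1'' := n1.1
  have n2'' := n2.1
  have ip := G.i_i p
  have iq := G.i_i q
  have hne : G.i q ≠ G.i p := fun h => hpq (by rw [← G.i_i p, ← h, G.i_i])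
  have hcut' : ∀ x y, x ∈ A → G.i x ∉ A → y ∈ A → G.i y ∉ A → x = y :=
    fun x y h1 h2 h3 h4 => hcut ⟨h1, h2⟩ ⟨h3, h4⟩
  have hp := hcut' p q
  have hq' := hcut' (G.i p) (G.i q)
  have sp := fun h : ∀ x ∈ G.star c, x ∉ A => h (G.i (G.i p)) n1'
  have sq := fun h : ∀ x ∈ G.star c, x ∉ A => h (G.i (G.i q)) n2'
  have sp' := fun h : ∀ x ∈ G.star c, x ∈ A => h (G.i (G.i p)) n1'
  have sq' := fun h : ∀ x ∈ G.star c, x ∈ A => h (G.i (G.i q)) n2'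
  have h2 := hq.cut A (fun x y h => hA x y h.1) (by
    have f := equot_i_of_legs hpq ho
    rintro x ⟨hx, hx'⟩ y ⟨hy, hy'⟩
    rw [f] at hx' hy'
    have e1 := hcut' x y
    have e2 := hcut' x p
    have e3 := hcut' x q
    have e4 := hcut' y p
    have e5 := hcut' y q
    have e6 := G.i_i x
    have e7 := G.i_i y
    clear f hA hcut hcut'
    rcases hstar with h | h
    · have := sp h
      have := sq h
      clear h sp sq sp' sq' ho
      grind
    · have := sp' h
      have := sq' h
      clear h sp sq sp' sq' ho
      grind)
  have hdp : (G.equot c).r (G.i p) (G.i p) :=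
    ⟨G.dom_of_ne (fun h => n1'' (by rw [h] at n1'; exact n1')), n1''⟩
  have hdq : (G.equot c).r (G.i q) (G.i q) :=
    ⟨G.dom_of_ne (fun h => n2'' (by rw [h] at n2'; exact n2')), n2''⟩
  have hdom : ∀ x, G.r x x → x ∈ G.star c ∨ (G.equot c).r x x := fun x hx => by
    by_cases h : x ∈ G.star c
    · exact Or.inl h
    · exact Or.inr ⟨hx, h⟩
  rcases hstar with h | h <;> rcases h2 with h' | h'
  · exact Or.inl fun x hx => (hdom x hx).elim (h x) (h' x)
  · have := sp h
    have := sq h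
    have := h' _ hdp
    have := h' _ hdq
    grind
  · have := sp' h
    have := sq' h
    have := h' _ hdp
    have := h' _ hdq
    grind
  · exact Or.inr fun x hx => (hdom x hx).elim (h x) (h' x)

end HalfEdgeGraph

namespace HalfEdgeGraph

variable {X : Type w} {G : HalfEdgeGraph X} {c d e : Set X}

/-! The correspondence between subgraphs `d` containing `c` and subgraphs of the quotient by `c`
that contain the residue of `c`. -/

open Classical in
/-- The half-edges that disappear in the quotient by `c`. -/
noncomputable def block (G : HalfEdgeGraph X) (c : Set X) : Set X :=
  if (G.legs c).ncard = 2 then G.star c else c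

/-- The subgraph `d` contains `c` in such a way that the residue of `c` meets an edge of the
quotient of `d` by `c`. -/
structure IsNested (G : HalfEdgeGraph X) (c d : Set X) : Prop where
  subset : c ⊆ d
  vertex : (G.legs c).ncard ≠ 2 → (G.legs c ∩ d).Nonempty
  edge : (G.legs c).ncard = 2 →
    G.star c ⊆ d ∧ ∃ p q, p ≠ q ∧ G.outer c = {G.i p, G.i q}

/-- Puts the vertex and edge cases together: `d \ block c` is the subgraph d/c of G/c, and
(G/c)/(d/c) = G/d. -/
theorem IsNested.spec (h : G.IsNested c d) (hc : G.IsEdgeSet c) (hd : G.IsEdgeSet d) :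
    (G.quot c).IsEdgeSet (d \ G.block c) ∧ (G.quot c).sub (d \ G.block c) = (G.sub d).quot c ∧
      (G.quot c).quot (d \ G.block c) = G.quot d := by
  by_cases h2 : (G.legs c).ncard = 2
  · obtain ⟨hs, p, q, hpq, ho⟩ := h.edge h2
    rw [quot_eq_equot h2, block, if_pos h2, quot_eq_equot (G := G.sub d) (by rwa [legs_sub h.subset])]
    exact ⟨isEdgeSet_equot_diff hpq ho hd hs, sub_equot hpq ho hd h.subset hs,
      quot_equot hpq ho hd h.subset hs⟩
  · have hl := h.vertex h2
    rw [quot_eq_vquot h2, block, if_neg h2, quot_eq_vquot (G := G.sub d) (by rwa [legs_sub h.subset])]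
    exact ⟨hc.vquot_iff.2 ⟨Set.disjoint_sdiff_right, hc.diff hd⟩, sub_vquot hc hd h.subset hl,
      quot_vquot hc hd h.subset hl⟩

theorem IsNested.block_subset (h : G.IsNested c d) : G.block c ⊆ d := by
  rw [block]
  split_ifs with h2
  · exact (h.edge h2).1
  · exact h.subset

/-- Nested and disjoint pairs exclude each other. In the self-energy case `d \ block c` contains a
half of the new edge, whose partner in `G` is a leg of `c`; otherwise it contains a leg of `c`
itself. -/
theorem IsNested.not_disjoint (h : G.IsNested c d) (hd : G.IsEdgeSet d) :
    ¬ (G.IsEdgeSet (d \ G.block c) ∧ Disjoint (G.star c) (d \ G.block c)) := by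
  rintro ⟨h1, h3⟩
  by_cases h2 : (G.legs c).ncard = 2
  · obtain ⟨hs, p, q, hpq, ho⟩ := h.edge h2
    have h4 : G.i p ∈ G.outer c := by rw [ho]; simp
    have h5 := hs h4.2
    rw [block, if_pos h2] at h1
    exact (h1.mem _ ⟨hd.mem_iff.1 h5, h4.1⟩).2 h4.2
  · obtain ⟨z, hz, hz'⟩ := h.vertex h2
    rw [block, if_neg h2] at h3
    exact Set.disjoint_left.1 h3 hz.1 ⟨hz', hz.2⟩

/-- In the 1PI graph d/c the contracted vertex meets an internal edge, which gives a leg of `c`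
inside `d`. For a self-energy, an edge remaining in d/c forces both legs to be glued within `d`. -/
theorem OnePI.isNested (hd : G.IsEdgeSet d) (hc : (G.sub d).IsEdgeSet c) (hne : c.Nonempty)
    (hs : (G.sub d).OnePI) (hq : ((G.sub d).quot c).OnePI) : G.IsNested c d := by
  have hcd := hd.subset_of_sub hc
  refine ⟨hcd, fun h2 => ?_, fun h2 => ?_⟩
  · obtain ⟨x, hx⟩ := hs.legs_nonempty hc hne hq.exists_edge
    rw [quot_eq_vquot (by rwa [legs_sub hcd])] at hq
    obtain ⟨y, ⟨h1, h3, h4⟩, h5⟩ := hq.exists_internal (x := x) ⟨hx.2, hx.2, Or.inr ⟨hx.1, hx.1⟩⟩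
    have hy : y ∈ (G.sub d).star c := by
      rcases h4 with h4 | h4
      · exact (star_sat h4).1 hx.1
      · exact h4.2
    rw [star_sub hcd] at hy
    refine ⟨y, ⟨hy, h3⟩, ?_⟩
    by_contra h6
    rw [hc.vquot_i, if_neg h3, hd.sub_i, if_neg h6] at h5
    exact h5 rfl
  · have h2' : ((G.sub d).legs c).ncard = 2 := by rwa [legs_sub hcd]
    obtain ⟨p, q, hpq, hl, hp, hq', ho⟩ := hs.exists_legs_of_quot hc hne h2' hq.exists_edge
    have hmem : ∀ x, x ∈ (G.sub d).legs c → (G.sub d).i x ∉ (G.sub d).star c → x ∈ d := by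
      intro x hx h
      by_contra h'
      rw [hd.sub_i, if_neg h'] at h
      exact h hx.1
    have hpd : p ∈ d := hmem p (by rw [hl]; simp) hp
    have hqd : q ∈ d := hmem q (by rw [hl]; simp) hq'
    have hstar : G.star c ⊆ d := by
      intro x hx
      by_cases hxc : x ∈ c
      · exact hcd hxc
      · have : x ∈ (G.sub d).legs c := by rw [legs_sub hcd]; exact ⟨hx, hxc⟩
        rw [hl] at this
        rcases this with rfl | rfl
        · exact hpd
        · exact hqd
    refine ⟨hstar, p, q, hpq, ?_⟩
    rw [outer_sub hd hstar hcd, hd.sub_i, hd.sub_i, if_pos hpd, if_pos hqd] at ho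
    exact ho

/-- Inserting a 1PI graph into a 1PI graph gives a 1PI graph: the lifting results for cuts are
applied inside `d`. -/
theorem IsNested.onePI (h : G.IsNested c d) (hc : G.IsEdgeSet c) (hd : G.IsEdgeSet d)
    (hs : (G.sub c).OnePI) (hq : ((G.sub d).quot c).OnePI) : (G.sub d).OnePI := by
  rw [← sub_sub hd hc h.subset] at hs
  have hc' := (hd.sub_iff h.subset).2 hc
  by_cases h2 : (G.legs c).ncard = 2
  · obtain ⟨hst, p, q, hpq, ho⟩ := h.edge h2
    rw [quot_eq_equot (by rwa [legs_sub h.subset])] at hq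
    have hp : G.i p ∈ G.outer c := by rw [ho]; simp
    have hq' : G.i q ∈ G.outer c := by rw [ho]; simp
    have hpd : p ∈ d := by have := hst hp.2; rwa [G.i_i] at this
    have hqd : q ∈ d := by have := hst hq'.2; rwa [G.i_i] at this
    refine OnePI.of_equot hc' hs hq hpq ?_
    rw [outer_sub hd hst h.subset, hd.sub_i, hd.sub_i, if_pos hpd, if_pos hqd, ho]
  · rw [quot_eq_vquot (by rwa [legs_sub h.subset])] at hq
    refine OnePI.of_vquot hc' hs hq ?_
    rw [legs_sub h.subset]
    exact (h.vertex h2).mono Set.inter_subset_left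

/-- A subgraph of the quotient by `c` that contains the residue of `c` comes from a subgraph
containing `c`. -/
theorem OnePI.isNested_union (hG : G.OnePI) (hc : G.IsEdgeSet c) (hne : c.Nonempty)
    (hq : (G.quot c).OnePI) (he : (G.quot c).IsEdgeSet e)
    (hn : ¬ (G.IsEdgeSet e ∧ Disjoint (G.star c) e)) :
    G.IsEdgeSet (G.block c ∪ e) ∧ G.IsNested c (G.block c ∪ e) ∧ (G.block c ∪ e) \ G.block c = e := by
  by_cases h2 : (G.legs c).ncard = 2
  · obtain ⟨p, q, hpq, hl, hp, hq', ho⟩ := hG.exists_legs_of_quot hc hne h2 hq.exists_edge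
    rw [quot_eq_equot h2] at he
    have hb : G.block c = G.star c := if_pos h2
    rw [hb]
    have f := equot_i_of_legs hpq ho
    have hdis : ∀ x ∈ e, x ∉ G.star c := fun x hx h => he.ne x hx (by rw [equot_i, if_pos h])
    have hip : (G.equot c).i (G.i p) = G.i q := by rw [f, if_neg hp, if_pos rfl]
    have hiq : (G.equot c).i (G.i q) = G.i p := by rw [← hip, i_i]
    -- If `e` avoided the new edge, all its edges would be edges of `G` away from `c`, the case
    -- excluded by `hn`.
    have hpe : G.i p ∈ e ∧ G.i q ∈ e := by
      by_contra hcon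
      have hcon1 : G.i p ∉ e := fun h => hcon ⟨h, hip ▸ he.mem _ h⟩
      have hcon2 : G.i q ∉ e := fun h => hcon ⟨hiq ▸ he.mem _ h, h⟩
      have hi : ∀ x ∈ e, (G.equot c).i x = G.i x := fun x hx => by
        rw [f, if_neg (hdis x hx), if_neg (fun h : x = G.i p => hcon1 (h ▸ hx)),
          if_neg (fun h : x = G.i q => hcon2 (h ▸ hx))]
      exact hn ⟨⟨fun x hx => hi x hx ▸ he.ne x hx, fun x hx => hi x hx ▸ he.mem x hx⟩,
        Set.disjoint_right.2 fun x hx => hdis x hx⟩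
    have hps : p ∈ G.legs c := by rw [hl]; simp
    have hqs : q ∈ G.legs c := by rw [hl]; simp
    have hleg : ∀ x ∈ G.star c, x ∈ c ∨ x = p ∨ x = q := by
      intro x hx
      by_cases hxc : x ∈ c
      · exact Or.inl hxc
      · have : x ∈ G.legs c := ⟨hx, hxc⟩
        rw [hl] at this
        exact Or.inr this
    refine ⟨⟨?_, ?_⟩, ⟨?_, fun h => absurd h2 h, fun _ => ⟨Set.subset_union_left, p, q, hpq, ho⟩⟩, ?_⟩
    · rintro x (hx | hx)
      · rcases hleg x hx with h | rfl | rfl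
        · exact hc.ne x h
        · exact fun h => hp (h.symm ▸ hx)
        · exact fun h => hq' (h.symm ▸ hx)
      · have h1 := he.ne x hx
        rw [equot_i, if_neg (hdis x hx)] at h1
        split_ifs at h1 with h3
        · exact fun h => hdis x hx (h ▸ h3)
        · exact h1
    · rintro x (hx | hx)
      · rcases hleg x hx with h | rfl | rfl
        · exact Or.inl (hc.subset_star (hc.mem x h))
        · exact Or.inr hpe.1
        · exact Or.inr hpe.2
      · by_cases h3 : G.i x ∈ G.star c
        · exact Or.inl h3
        · have h1 := he.mem x hx
          rw [equot_i, if_neg (hdis x hx), if_neg h3] at h1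
          exact Or.inr h1
    · exact fun x hx => Or.inl (hc.subset_star hx)
    · ext x
      have := hdis x
      grind
  · rw [quot_eq_vquot h2] at he
    have hb : G.block c = c := if_neg h2
    rw [hb]
    obtain ⟨h0, he'⟩ := hc.vquot_iff.1 he
    have h3 : ¬ Disjoint (G.star c) e := fun h => hn ⟨he', h⟩
    rw [Set.not_disjoint_iff] at h3
    obtain ⟨x, hx, hxe⟩ := h3
    refine ⟨⟨?_, ?_⟩, ⟨Set.subset_union_left, fun _ => ⟨x, ⟨hx, fun h => Set.disjoint_left.1 h0 h hxe⟩,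
      Or.inr hxe⟩, fun h => absurd h h2⟩, ?_⟩
    · rintro x (h | h)
      · exact hc.ne x h
      · exact he'.ne x h
    · rintro x (h | h)
      · exact Or.inl (hc.mem x h)
      · exact Or.inr (he'.mem x h)
    · rw [Set.union_sdiff_left, h0.symm.sdiff_eq_left]

/-- The quotients by two disjoint subgraphs commute. -/
theorem OnePI.quot_quot_comm (hG : G.OnePI) (hc : G.IsEdgeSet c) (hcn : c.Nonempty)
    (he : G.IsEdgeSet e) (hen : e.Nonempty) (h : Disjoint (G.star c) e)
    (hqc : (G.quot c).OnePI) (hqe : (G.quot e).OnePI)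
    (hx : ∃ x, ((G.quot c).quot e).i x ≠ x) : (G.quot c).quot e = (G.quot e).quot c := by
  have h' : Disjoint (G.star e) c :=
    (disjoint_star_star h).symm.mono_right fun x => hc.subset_star
  have hce := isEdgeSet_quot hc he h
  have hec := isEdgeSet_quot he hc h'
  have hlc := legs_quot hc h
  have hle := legs_quot he h'
  by_cases h2 : (G.legs c).ncard = 2 <;> by_cases h3 : (G.legs e).ncard = 2
  -- An edge left in the double quotient provides a half-edge outside both stars. It shows that the
  -- legs of both self-energies lead outside, in `G` and after the other one has been replaced.
  · obtain ⟨x, hx⟩ := hx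
    have hr := ((G.quot c).quot e).dom_of_ne hx
    rw [quot_eq_equot (G := G.quot c) (by rwa [hlc]), equot_r, star_quot hc h, quot_eq_equot h2,
      equot_r] at hr
    obtain ⟨⟨hr1, hr2⟩, hr3⟩ := hr
    obtain ⟨p, q, hpq, hl, -, -, ho⟩ := hG.exists_legs hc hcn h2 ⟨x, hr1, hr2⟩
    obtain ⟨s, t, hst, hm, -, -, hoe⟩ := hG.exists_legs he hen h3 ⟨x, hr1, hr3⟩
    rw [quot_eq_equot (G := G.quot c) (by rwa [hlc]), quot_eq_equot (G := G.quot e) (by rwa [hle])]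
    rw [quot_eq_equot h2] at hqc hce hlc ⊢
    rw [quot_eq_equot h3] at hqe hec hle ⊢
    have h4 := star_equot _ h
    have h5 := star_equot _ h'
    rw [(disjoint_star_star h).sdiff_eq_right] at h4
    rw [(disjoint_star_star h').sdiff_eq_right] at h5
    obtain ⟨p', q', hpq', hl', -, -, ho'⟩ := hqe.exists_legs hec hcn (by rwa [hle])
      ⟨x, ⟨hr1, hr3⟩, by rwa [h5]⟩
    obtain ⟨s', t', hst', hm', -, -, hoe'⟩ := hqc.exists_legs hce hen (by rwa [hlc])
      ⟨x, ⟨hr1, hr2⟩, by rwa [h4]⟩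
    have hpair : ∀ {a b a' b' : X} (f : X → X), ({a, b} : Set X) = {a', b'} →
        ({f a, f b} : Set X) = {f a', f b'} := fun f h => by
      rw [← Set.image_pair, ← Set.image_pair, h]
    refine equot_equot_comm h h' hpq hst ho hoe ?_ ?_
    · rw [ho']
      exact hpair _ (by rw [← hl', hle, hl])
    · rw [hoe']
      exact hpair _ (by rw [← hm', hlc, hm])
  · rw [quot_eq_vquot (G := G.quot c) (by rwa [hlc]), quot_eq_equot (G := G.quot e) (by rwa [hle])]
    rw [quot_eq_equot h2] at hce ⊢
    rw [quot_eq_vquot h3]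
    exact (vquot_equot_comm he h' h hce).symm
  · rw [quot_eq_equot (G := G.quot c) (by rwa [hlc]), quot_eq_vquot (G := G.quot e) (by rwa [hle])]
    rw [quot_eq_equot h3] at hec ⊢
    rw [quot_eq_vquot h2]
    exact vquot_equot_comm hc h h' hec
  · rw [quot_eq_vquot (G := G.quot c) (by rwa [hlc]), quot_eq_vquot (G := G.quot e) (by rwa [hle]),
      quot_eq_vquot h2, quot_eq_vquot h3]
    exact vquot_vquot_comm hc he h h'

end HalfEdgeGraph

/-! ### Graphs of the theory and the counting form of the pre-Lie identity -/

namespace HalfEdgeGraph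

variable {X : Type w} [Finite X] {F : Type u} {fld : X → F} {T : FieldTheory F}
  {G : HalfEdgeGraph X} {c d e : Set X}

/-- The multiset of the fields carried by the half-edges in `s`. -/
noncomputable def fieldsOf (fld : X → F) (s : Set X) : Multiset F :=
  s.toFinite.toFinset.val.map fld

/-- Internal edges are propagators, and vertices are interaction monomials. -/
structure IsGraphOf (fld : X → F) (T : FieldTheory F) (G : HalfEdgeGraph X) : Prop where
  edge : ∀ x, G.i x ≠ x → fld (G.i x) = T.conj (fld x)
  vertex : ∀ x, G.r x x → fieldsOf fld {y | G.r x y} ∈ T.vertices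

/-- A set of external legs is the set of legs of a propagator or of an interaction monomial. -/
def IsResidue (fld : X → F) (T : FieldTheory F) (L : Set X) : Prop :=
  (L.ncard = 2 → ∀ x ∈ L, ∀ y ∈ L, x ≠ y → fld y = T.conj (fld x)) ∧
    (L.ncard ≠ 2 → fieldsOf fld L ∈ T.vertices)

theorem IsGraphOf.sub (hG : G.IsGraphOf fld T) (hd : G.IsEdgeSet d) :
    (G.sub d).IsGraphOf fld T := by
  constructor
  · intro x hx
    rw [hd.sub_i] at hx ⊢
    split_ifs at hx ⊢ with h
    · exact hG.edge x hx
    · exact absurd rfl hx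
  · rintro x ⟨hx, hx'⟩
    have : {y | (G.sub d).r x y} = {y | G.r x y} := by
      ext y
      exact ⟨fun h => h.1, fun h => ⟨h, hx'⟩⟩
    rw [this]
    exact hG.vertex x hx

/-- The quotient of a 1PI graph of the theory is a graph of the theory if and only if the residue
of the subgraph belongs to the theory. -/
theorem IsGraphOf.quot_iff (hG : G.IsGraphOf fld T) (hG1 : G.OnePI) (hc : G.IsEdgeSet c)
    (hne : c.Nonempty) (hx : ∃ x, (G.quot c).i x ≠ x) :
    (G.quot c).IsGraphOf fld T ↔ IsResidue fld T (G.legs c) := by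
  by_cases h2 : (G.legs c).ncard = 2
  · obtain ⟨p, q, hpq, hl, hp, hq, ho⟩ := hG1.exists_legs_of_quot hc hne h2 hx
    have f := equot_i_of_legs hpq ho
    have hps : p ∈ G.legs c := by rw [hl]; simp
    have hqs : q ∈ G.legs c := by rw [hl]; simp
    have hip : (G.equot c).i (G.i p) = G.i q := by rw [f, if_neg hp, if_pos rfl]
    have hfp : fld (G.i p) = T.conj (fld p) := hG.edge p fun h => hp (h.symm ▸ hps.1)
    have hfq : fld (G.i q) = T.conj (fld q) := hG.edge q fun h => hq (h.symm ▸ hqs.1)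
    have hiff : IsResidue fld T (G.legs c) ↔ fld q = T.conj (fld p) := by
      constructor
      · exact fun h => h.1 h2 p hps q hqs hpq
      · refine fun h => ⟨fun _ => ?_, fun h' => absurd h2 h'⟩
        rw [hl]
        rintro x (rfl | rfl) y (rfl | rfl) hxy
        · exact absurd rfl hxy
        · exact h
        · rw [h, T.conj_conj]
        · exact absurd rfl hxy
    -- The partners of the legs carry the conjugate fields, so the new edge is a propagator exactly
    -- when the fields of the two legs are conjugate to each other.
    rw [hiff, quot_eq_equot h2]
    constructor
    · intro h
      have h1 := h.edge (G.i p) (by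
        rw [hip]
        exact fun h => hpq (by rw [← G.i_i p, ← h, G.i_i]))
      rw [hip, hfp, hfq, T.conj_conj] at h1
      rw [← h1, T.conj_conj]
    · intro h
      constructor
      · intro x hx
        rw [f] at hx ⊢
        split_ifs at hx ⊢ with h1 h2 h3
        · exact absurd rfl hx
        · rw [h2, hfp, hfq, h]
        · rw [h3, hfp, hfq, h, T.conj_conj]
        · exact hG.edge x hx
      · rintro x ⟨hx, hx'⟩
        have : {y | (G.equot c).r x y} = {y | G.r x y} := by
          ext y
          exact ⟨fun h => h.1, fun h => ⟨h, hx'⟩⟩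
        rw [this]
        exact hG.vertex x hx
  · obtain ⟨z, hz⟩ := hG1.legs_nonempty hc hne hx
    have hclass : ∀ x ∈ G.legs c, {y | (G.vquot c).r x y} = G.legs c := by
      rintro x ⟨h1, h3⟩
      ext y
      constructor
      · rintro ⟨_, h4, h5 | h5⟩
        · exact ⟨(star_sat h5).1 h1, h4⟩
        · exact ⟨h5.2, h4⟩
      · rintro ⟨h4, h5⟩
        exact ⟨h3, h5, Or.inr ⟨h1, h4⟩⟩
    have hiff : IsResidue fld T (G.legs c) ↔ fieldsOf fld (G.legs c) ∈ T.vertices :=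
      ⟨fun h => h.2 h2, fun h => ⟨fun h' => absurd h' h2, fun _ => h⟩⟩
    rw [hiff, quot_eq_vquot h2]
    constructor
    · intro h
      have := h.vertex z ⟨hz.2, hz.2, Or.inr ⟨hz.1, hz.1⟩⟩
      rwa [hclass z hz] at this
    · intro h
      constructor
      · intro x hx
        rw [hc.vquot_i] at hx ⊢
        split_ifs at hx ⊢ with h1
        · exact absurd rfl hx
        · exact hG.edge x hx
      · rintro x ⟨hx, -, hr⟩
        by_cases hs : x ∈ G.star c
        · rwa [hclass x ⟨hs, hx⟩]
        · have hxx : G.r x x := hr.elim id fun h => absurd h.1 hs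
          have : {y | (G.vquot c).r x y} = {y | G.r x y} := by
            ext y
            constructor
            · rintro ⟨_, _, h5 | h5⟩
              · exact h5
              · exact absurd h5.1 hs
            · intro h5
              exact ⟨hx, fun h6 => hs ((star_sat h5).2 (hc.subset_star h6)), Or.inl h5⟩
          rw [this]
          exact hG.vertex x hxx

/-- The 1PI graphs of the theory `T`. -/
structure IsOnePIOf (fld : X → F) (T : FieldTheory F) (G : HalfEdgeGraph X) : Prop where
  onePI : G.OnePI
  isGraphOf : G.IsGraphOf fld T

/-- Pairs of a subgraph of `G` and a subgraph of the quotient. -/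
def quotPairs (fld : X → F) (T : FieldTheory F) (G : HalfEdgeGraph X)
    (P₁ P₂ P₃ : HalfEdgeGraph X → Prop) : Set (Set X × Set X) :=
  {x | G.IsEdgeSet x.1 ∧ P₃ (G.sub x.1) ∧ (G.quot x.1).IsOnePIOf fld T ∧
    (G.quot x.1).IsEdgeSet x.2 ∧ P₂ ((G.quot x.1).sub x.2) ∧ P₁ ((G.quot x.1).quot x.2)}

/-- Pairs of a subgraph of `G` and a subgraph of this subgraph. -/
def subPairs (fld : X → F) (T : FieldTheory F) (G : HalfEdgeGraph X)
    (P₁ P₂ P₃ : HalfEdgeGraph X → Prop) : Set (Set X × Set X) :=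
  {x | G.IsEdgeSet x.1 ∧ (G.sub x.1).IsOnePIOf fld T ∧ P₁ (G.quot x.1) ∧
    (G.sub x.1).IsEdgeSet x.2 ∧ P₃ ((G.sub x.1).sub x.2) ∧ P₂ ((G.sub x.1).quot x.2)}

/-- Pairs of subgraphs of `G` without common vertices. -/
def disjointPairs (fld : X → F) (T : FieldTheory F) (G : HalfEdgeGraph X)
    (P₁ P₂ P₃ : HalfEdgeGraph X → Prop) : Set (Set X × Set X) :=
  {x ∈ quotPairs fld T G P₁ P₂ P₃ | G.IsEdgeSet x.2 ∧ Disjoint (G.star x.1) x.2}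

variable {P₁ P₂ P₃ : HalfEdgeGraph X → Prop}

/-- A subgraph `e` of G/c either meets the residue of `c`, and then comes from a unique `d`
containing `c`, or is a subgraph of `G` disjoint from `c`. -/
theorem ncard_quotPairs (hG : G.IsOnePIOf fld T) (h₂ : ∀ H, P₂ H → H.IsOnePIOf fld T)
    (h₃ : ∀ H, P₃ H → H.IsOnePIOf fld T) : (quotPairs fld T G P₁ P₂ P₃).ncard =
      (subPairs fld T G P₁ P₂ P₃).ncard + (disjointPairs fld T G P₁ P₂ P₃).ncard := by
  have hsub : disjointPairs fld T G P₁ P₂ P₃ ⊆ quotPairs fld T G P₁ P₂ P₃ := fun x hx => hx.1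
  rw [← Set.ncard_sdiff_add_ncard_of_subset hsub]
  congr 1
  symm
  -- The bijection sends a chain c ⊂ d to c together with the image of d in G/c; `block` is what
  -- disappears there.
  refine Set.ncard_congr (fun x _ => (x.2, x.1 \ G.block x.2)) ?_ ?_ ?_
  · rintro ⟨d, c⟩ ⟨hd, hd', h1, hc, h3, h2⟩
    have hcd := hd.subset_of_sub hc
    have hn : G.IsNested c d := OnePI.isNested hd hc ((h₃ _ h3).onePI.nonempty_of_sub hc)
      hd'.onePI (h₂ _ h2).onePI
    have hc' := (hd.sub_iff hcd).1 hc
    simp only at h1 h2 h3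
    obtain ⟨k1, k2, k3⟩ := hn.spec hc' hd
    rw [sub_sub hd hc' hcd] at h3
    rw [← k2] at h2
    rw [← k3] at h1
    have hne := (h₃ _ h3).onePI.nonempty_of_sub hc'
    have hne' := (h₂ _ h2).onePI.nonempty_of_sub k1
    have hx : ∃ x, (G.quot c).i x ≠ x := hne'.imp fun x hx => k1.ne x hx
    refine ⟨⟨hc', h3, ⟨hG.onePI.quot hc' hne hx, ?_⟩, k1, h2, h1⟩, fun h => hn.not_disjoint hd h.2⟩
    -- G/c belongs to the theory because d/c does: both statements concern the same legs of `c`.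
    rw [hG.isGraphOf.quot_iff hG.onePI hc' hne hx, ← legs_sub hcd,
      ← (hG.isGraphOf.sub hd).quot_iff hd'.onePI hc hne]
    · rw [← k2]
      exact (h₂ _ h2).isGraphOf
    · rw [← k2]
      exact (h₂ _ h2).onePI.exists_edge
  · rintro ⟨d, c⟩ ⟨d', c'⟩ ⟨hd, hd', -, hc, h3, h2⟩ ⟨ed, ed', -, ec, e3, e2⟩ heq
    simp only [Prod.mk.injEq] at heq
    obtain ⟨rfl, heq⟩ := heq
    have hn : G.IsNested c d := OnePI.isNested hd hc ((h₃ _ h3).onePI.nonempty_of_sub hc)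
      hd'.onePI (h₂ _ h2).onePI
    have en : G.IsNested c d' := OnePI.isNested ed ec ((h₃ _ e3).onePI.nonempty_of_sub ec)
      ed'.onePI (h₂ _ e2).onePI
    congr 1
    -- `d` is recovered from its image in G/c by adding `block c` back.
    rw [← Set.sdiff_union_of_subset hn.block_subset, heq, Set.sdiff_union_of_subset en.block_subset]
  · rintro ⟨c, e⟩ ⟨⟨hc, h3, hq, he, h2, h1⟩, hnd⟩
    have hn : ¬ (G.IsEdgeSet e ∧ Disjoint (G.star c) e) := fun h =>
      hnd ⟨⟨hc, h3, hq, he, h2, h1⟩, h⟩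
    simp only at h1 h2 h3
    obtain ⟨hd, hnest, hdiff⟩ := hG.onePI.isNested_union hc ((h₃ _ h3).onePI.nonempty_of_sub hc)
      hq.onePI he hn
    obtain ⟨k1, k2, k3⟩ := hnest.spec hc hd
    rw [hdiff] at k1 k2 k3
    refine ⟨(G.block c ∪ e, c), ⟨hd, ⟨?_, hG.isGraphOf.sub hd⟩, ?_, ?_, ?_, ?_⟩, ?_⟩
    · exact hnest.onePI hc hd (h₃ _ h3).onePI (k2 ▸ (h₂ _ h2).onePI)
    · exact k3 ▸ h1
    · exact (hd.sub_iff hnest.subset).2 hc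
    · rw [sub_sub hd hc hnest.subset]
      exact h3
    · exact k2 ▸ h2
    · rw [hdiff]

/-- The new requirement is that G/e be a 1PI graph of the theory. It keeps the edges of `c`, hence
is 1PI. -/
theorem swap_mem_disjointPairs (hG : G.IsOnePIOf fld T) (h₁ : ∀ H, P₁ H → H.IsOnePIOf fld T)
    (h₂ : ∀ H, P₂ H → H.IsOnePIOf fld T) (h₃ : ∀ H, P₃ H → H.IsOnePIOf fld T)
    (h : (c, e) ∈ disjointPairs fld T G P₁ P₂ P₃) : (e, c) ∈ disjointPairs fld T G P₁ P₃ P₂ := by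
  obtain ⟨⟨hc, h3, hq, he', h2, h1⟩, he, hdis⟩ := h
  simp only at hc h3 hq he' h2 h1 he hdis
  have hdis' : Disjoint (G.star e) c :=
    (disjoint_star_star hdis).symm.mono_right fun x => hc.subset_star
  rw [sub_quot hc he hdis] at h2
  have hcn := (h₃ _ h3).onePI.nonempty_of_sub hc
  have hen := (h₂ _ h2).onePI.nonempty_of_sub he
  have hce := isEdgeSet_quot he hc hdis'
  have hx : ∃ x, (G.quot e).i x ≠ x := hcn.imp fun x hx => hce.ne x hx
  have hqe := hG.onePI.quot he hen hx
  have hqq := (h₁ _ h1).onePI.exists_edge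
  have hcomm := hG.onePI.quot_quot_comm hc hcn he hen hdis hq.onePI hqe hqq
  refine ⟨⟨he, h2, ⟨hqe, ?_⟩, hce, ?_, ?_⟩, hc, hdis'⟩
  -- The residue of `e` can be tested in G/c, where `e` has the same legs; there it is admissible
  -- because (G/c)/e is a graph of the theory.
  · rw [hG.isGraphOf.quot_iff hG.onePI he hen hx, ← legs_quot hc hdis,
      ← hq.isGraphOf.quot_iff hq.onePI he' hen hqq]
    exact (h₁ _ h1).isGraphOf
  · simp only
    rwa [sub_quot he hc hdis']
  · simp only
    rwa [← hcomm]

theorem ncard_disjointPairs (hG : G.IsOnePIOf fld T) (h₁ : ∀ H, P₁ H → H.IsOnePIOf fld T)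
    (h₂ : ∀ H, P₂ H → H.IsOnePIOf fld T) (h₃ : ∀ H, P₃ H → H.IsOnePIOf fld T) :
    (disjointPairs fld T G P₁ P₂ P₃).ncard = (disjointPairs fld T G P₁ P₃ P₂).ncard := by
  refine Set.ncard_congr (fun x _ => x.swap) ?_ ?_ ?_
  · rintro ⟨c, e⟩ h
    exact swap_mem_disjointPairs hG h₁ h₂ h₃ h
  · rintro x y _ _ h
    exact Prod.swap_injective h
  · rintro ⟨c, e⟩ h
    exact ⟨(e, c), swap_mem_disjointPairs hG h₁ h₃ h₂ h, rfl⟩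

/-- The combinatorial form of the pre-Lie identity. -/
theorem ncard_pre_lie (hG : G.IsOnePIOf fld T) (h₁ : ∀ H, P₁ H → H.IsOnePIOf fld T)
    (h₂ : ∀ H, P₂ H → H.IsOnePIOf fld T) (h₃ : ∀ H, P₃ H → H.IsOnePIOf fld T) :
    (quotPairs fld T G P₁ P₂ P₃).ncard + (subPairs fld T G P₁ P₃ P₂).ncard =
      (quotPairs fld T G P₁ P₃ P₂).ncard + (subPairs fld T G P₁ P₂ P₃).ncard := by
  rw [ncard_quotPairs hG h₂ h₃, ncard_quotPairs hG h₃ h₂, ncard_disjointPairs hG h₁ h₂ h₃]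
  omega

end HalfEdgeGraph

/-! ### Feynman graphs: irreducibility by cuts, isomorphism by half-edges -/

namespace FeynmanGraph

variable {F : Type u} {Γ Γ' : FeynmanGraph F}

theorem skeleton_closed {s : Set Γ.H} (hs : (Γ.skeleton s).Connected) {A : Set Γ.V}
    (hA : ∀ h ∈ s, Γ.inv h ∈ s → Γ.vert h ∈ A → Γ.vert (Γ.inv h) ∈ A) : A = ∅ ∨ A = Set.univ := by
  by_cases h : A = ∅
  · exact Or.inl h
  · obtain ⟨a, ha⟩ := Set.nonempty_iff_ne_empty.2 h
    refine Or.inr (Set.eq_univ_of_forall fun b => ?_)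
    obtain ⟨p⟩ := hs.preconnected a b
    induction p with
    | nil => exact ha
    | cons hadj p ih =>
      refine ih ?_
      obtain ⟨-, ⟨h, h1, h2, -, rfl, rfl⟩ | ⟨h, h1, h2, -, rfl, rfl⟩⟩ := hadj
      · exact hA h h1 h2 ha
      · have := hA (Γ.inv h) h2 (by rwa [Γ.inv_inv]) ha
        rwa [Γ.inv_inv] at this

theorem skeleton_connected [Nonempty Γ.V] {s : Set Γ.H} (h : ∀ A : Set Γ.V,
    (∀ h ∈ s, Γ.inv h ∈ s → (Γ.vert h ∈ A ↔ Γ.vert (Γ.inv h) ∈ A)) → A = ∅ ∨ A = Set.univ) :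
    (Γ.skeleton s).Connected := by
  refine SimpleGraph.Connected.mk fun a b => ?_
  have hadj : ∀ h ∈ s, Γ.inv h ∈ s →
      (Γ.skeleton s).Reachable (Γ.vert h) (Γ.vert (Γ.inv h)) := by
    intro h h1 h2
    by_cases h3 : Γ.vert h = Γ.vert (Γ.inv h)
    · rw [h3]
    · refine SimpleGraph.Adj.reachable ⟨h3, Or.inl ⟨h, h1, h2, fun h4 => h3 ?_, rfl, rfl⟩⟩
      rw [h4]
  rcases h {b | (Γ.skeleton s).Reachable a b} (fun h h1 h2 =>
    ⟨fun h3 => h3.trans (hadj h h1 h2), fun h3 => h3.trans (hadj h h1 h2).symm⟩) with h | h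
  · have : a ∈ {b | (Γ.skeleton s).Reachable a b} := SimpleGraph.Reachable.refl a
    rw [h] at this
    exact absurd this (Set.notMem_empty _)
  · have : b ∈ {b | (Γ.skeleton s).Reachable a b} := by rw [h]; trivial
    exact this

/-- A graph is 1PI if and only if it has an internal edge and no cut with at most one edge. -/
theorem onePI_iff : Γ.OnePI ↔ (∃ h, Γ.inv h ≠ h) ∧ ∀ A : Set Γ.V,
    {h | Γ.vert h ∈ A ∧ Γ.vert (Γ.inv h) ∉ A}.Subsingleton → A = ∅ ∨ A = Set.univ := by
  constructor
  · rintro ⟨h1, h2, h3⟩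
    refine ⟨h2, fun A hA => ?_⟩
    by_cases hne : ∃ h, Γ.vert h ∈ A ∧ Γ.vert (Γ.inv h) ∉ A
    · obtain ⟨h, hh⟩ := hne
      -- The cut set contains, for each crossing edge, only the half attached in `A`. Deleting the
      -- single crossing edge makes `A` closed in a graph that is still connected.
      refine skeleton_closed (h3 h fun h' => hh.2 (by rw [h']; exact hh.1)) ?_
      intro k hk _ hkA
      by_contra hcon
      exact hk (Or.inl (hA ⟨hkA, hcon⟩ hh))
    · push Not at hne
      exact skeleton_closed h1 fun h _ _ hh => hne h hh
  · rintro ⟨⟨h₀, h1⟩, h2⟩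
    have : Nonempty Γ.V := ⟨Γ.vert h₀⟩
    refine ⟨skeleton_connected fun A hA => h2 A ?_, ⟨h₀, h1⟩,
      fun h hh => skeleton_connected fun A hA => h2 A ?_⟩
    · rintro h ⟨h3, h4⟩
      exact absurd ((hA h trivial trivial).1 h3) h4
    · have key : ∀ k, Γ.vert k ∈ A → Γ.vert (Γ.inv k) ∉ A → k = h ∨ k = Γ.inv h := by
        intro k hk hk'
        by_contra hcon
        have h3 : k ∈ ({h, Γ.inv h}ᶜ : Set Γ.H) := hcon
        refine hk' ((hA k h3 ?_).1 hk)
        rintro (h4 | h4)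
        · exact hcon (Or.inr (by rw [← h4, Γ.inv_inv]))
        · exact hcon (Or.inl (by rw [← Γ.inv_inv k, h4, Γ.inv_inv]))
      -- Of the two halves of the deleted edge, at most one leads out of `A`.
      rintro k ⟨hk, hk'⟩ l ⟨hl, hl'⟩
      rcases key k hk hk' with rfl | rfl <;> rcases key l hl hl' with rfl | rfl
      · rfl
      · exact absurd hl hk'
      · exact absurd hk hl'
      · rfl

/-- A vertex without half-edges would be an empty cut. This allows vertices to be treated as classes
of half-edges. -/
theorem OnePI.vert_surjective (h : Γ.OnePI) : Function.Surjective Γ.vert := by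
  obtain ⟨⟨h₀, h1⟩, h2⟩ := onePI_iff.1 h
  intro v
  by_contra hv
  push Not at hv
  rcases h2 {v} (by
    rintro h ⟨h3, -⟩
    exact absurd h3 (hv h)) with h3 | h3
  · exact Set.singleton_ne_empty v h3
  · exact hv h₀ (by
      have : Γ.vert h₀ ∈ ({v} : Set Γ.V) := by rw [h3]; trivial
      exact this)

theorem Iso.vert_surjective (h : Γ.Iso Γ') (hs : Function.Surjective Γ.vert) :
    Function.Surjective Γ'.vert := by
  obtain ⟨f, g, h1, -, -⟩ := h
  intro v
  obtain ⟨k, hk⟩ := hs (f.symm v)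
  exact ⟨g k, by rw [h1, hk, f.apply_symm_apply]⟩

/-- When every vertex carries a half-edge, the bijection of vertices is determined by that of
half-edges. -/
theorem Iso.of_equiv (hs : Function.Surjective Γ.vert) (hs' : Function.Surjective Γ'.vert)
    (g : Γ.H ≃ Γ'.H) (h1 : ∀ h k, Γ'.vert (g h) = Γ'.vert (g k) ↔ Γ.vert h = Γ.vert k)
    (h2 : ∀ h, Γ'.inv (g h) = g (Γ.inv h)) (h3 : ∀ h, Γ'.field (g h) = Γ.field h) :
    Γ.Iso Γ' := by
  have hf : ∀ h, Γ'.vert (g (Function.surjInv hs (Γ.vert h))) = Γ'.vert (g h) := fun h =>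
    (h1 _ _).2 (Function.surjInv_eq hs _)
  refine ⟨Equiv.ofBijective (fun v => Γ'.vert (g (Function.surjInv hs v))) ⟨?_, ?_⟩, g,
    fun h => (hf h).symm, h2, h3⟩
  · intro v w hvw
    have := (h1 _ _).1 hvw
    rwa [Function.surjInv_eq hs, Function.surjInv_eq hs] at this
  · intro v
    obtain ⟨k, rfl⟩ := hs' v
    exact ⟨Γ.vert (g.symm k), (hf _).trans (by rw [g.apply_symm_apply])⟩

end FeynmanGraph

/-! ### Realizations of Feynman graphs on a set of half-edges -/

namespace HalfEdgeGraph

variable {X : Type w} {F : Type u} {fld : X → F} {T : FieldTheory F}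
  {G : HalfEdgeGraph X} {Γ Γ' : FeynmanGraph F}

/-- An identification of the half-edges of `Γ` with those of `G`. -/
structure Realization (fld : X → F) (Γ : FeynmanGraph F) (G : HalfEdgeGraph X) where
  toFun : Γ.H → X
  inj : Function.Injective toFun
  exists_eq : ∀ x, G.r x x → ∃ h, toFun h = x
  r_iff : ∀ h k, G.r (toFun h) (toFun k) ↔ Γ.vert h = Γ.vert k
  i_eq : ∀ h, G.i (toFun h) = toFun (Γ.inv h)
  fld_eq : ∀ h, fld (toFun h) = Γ.field h
  surj : Function.Surjective Γ.vert

/-- The graph `Γ` is isomorphic to `G`. -/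
def Realizes (fld : X → F) (Γ : FeynmanGraph F) (G : HalfEdgeGraph X) : Prop :=
  Nonempty (Realization fld Γ G)

theorem Realizes.iso (h : Realizes fld Γ G) (h' : Realizes fld Γ' G) : Γ.Iso Γ' := by
  obtain ⟨R⟩ := h
  obtain ⟨R'⟩ := h'
  have h1 : ∀ h, ∃ k, R'.toFun k = R.toFun h := fun h => R'.exists_eq _ ((R.r_iff h h).2 rfl)
  choose g hg using h1
  have hb : Function.Bijective g := by
    refine ⟨fun a b hab => R.inj (by rw [← hg, ← hg, hab]), fun k => ?_⟩
    obtain ⟨h, hh⟩ := R.exists_eq _ ((R'.r_iff k k).2 rfl)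
    exact ⟨h, R'.inj (by rw [hg, hh])⟩
  refine FeynmanGraph.Iso.of_equiv R.surj R'.surj (Equiv.ofBijective g hb) ?_ ?_ ?_
  · intro h k
    rw [← R'.r_iff, ← R.r_iff]
    simp only [Equiv.ofBijective_apply, hg]
  · intro h
    apply R'.inj
    rw [← R'.i_eq]
    simp only [Equiv.ofBijective_apply, hg, R.i_eq]
  · intro h
    rw [← R'.fld_eq, ← R.fld_eq]
    simp only [Equiv.ofBijective_apply, hg]

theorem Realizes.of_iso (h : Realizes fld Γ G) (h' : Γ.Iso Γ') : Realizes fld Γ' G := by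
  obtain ⟨R⟩ := h
  have hs := h'.vert_surjective R.surj
  obtain ⟨f, g, h1, h2, h3⟩ := h'.symm
  refine ⟨⟨fun h => R.toFun (g h), R.inj.comp g.injective, fun x hx => ?_, fun h k => ?_,
    fun h => ?_, fun h => ?_, hs⟩⟩
  · obtain ⟨h, rfl⟩ := R.exists_eq x hx
    exact ⟨g.symm h, by rw [g.apply_symm_apply]⟩
  · rw [R.r_iff, h1, h1, f.injective.eq_iff]
  · rw [R.i_eq, h2]
  · rw [R.fld_eq, h3]

/-- A Feynman graph as a graph on its own set of half-edges. -/
def ofGraph (Γ : FeynmanGraph F) : HalfEdgeGraph Γ.H where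
  r h k := Γ.vert h = Γ.vert k
  i := Γ.inv
  symm h := h.symm
  trans h h' := h.trans h'
  i_i := Γ.inv_inv
  i_off _ hh := absurd rfl hh

theorem realizes_ofGraph (hs : Function.Surjective Γ.vert) : Realizes Γ.field Γ (ofGraph Γ) :=
  ⟨⟨id, Function.injective_id, fun x _ => ⟨x, rfl⟩, fun _ _ => Iff.rfl, fun _ => rfl, fun _ => rfl,
    hs⟩⟩

/-- The Feynman graph defined by a graph on a finite type. -/
def toGraph {X : Type} [Finite X] (fld : X → F) (G : HalfEdgeGraph X) : FeynmanGraph F where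
  H := {x // G.r x x}
  V := Quotient (⟨fun x y : {x // G.r x x} => G.r x y, fun x => x.2, G.symm, G.trans⟩ :
    Setoid {x // G.r x x})
  finV := inferInstance
  finH := inferInstance
  vert h := Quotient.mk _ h
  inv h := ⟨G.i h, G.dom_i h.2⟩
  inv_inv h := Subtype.ext (G.i_i h)
  field h := fld h

theorem realizes_toGraph {X : Type} [Finite X] (fld : X → F) (G : HalfEdgeGraph X) :
    Realizes fld (G.toGraph fld) G :=
  ⟨⟨Subtype.val, Subtype.val_injective, fun x hx => ⟨⟨x, hx⟩, rfl⟩,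
    fun _ _ => ⟨fun h => Quotient.sound h, fun h => Quotient.exact h⟩, fun _ => rfl, fun _ => rfl, Quotient.mk_surjective⟩⟩

theorem Realizes.onePI_iff (h : Realizes fld Γ G) : G.OnePI ↔ Γ.OnePI := by
  obtain ⟨R⟩ := h
  rw [FeynmanGraph.onePI_iff]
  have hedge : (∃ x, G.i x ≠ x) ↔ ∃ h, Γ.inv h ≠ h := by
    constructor
    · rintro ⟨x, hx⟩
      obtain ⟨h, rfl⟩ := R.exists_eq x (G.dom_of_ne hx)
      exact ⟨h, fun h' => hx (by rw [R.i_eq, h'])⟩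
    · rintro ⟨h, hh⟩
      exact ⟨R.toFun h, fun h' => hh (R.inj (by rw [← R.i_eq, h']))⟩
  constructor
  · rintro ⟨h1, h2⟩
    refine ⟨hedge.1 h1, fun A hA => ?_⟩
    have hm : ∀ h, R.toFun h ∈ {x | ∃ h, R.toFun h = x ∧ Γ.vert h ∈ A} ↔ Γ.vert h ∈ A := fun h =>
      ⟨fun ⟨k, hk, hk'⟩ => R.inj hk ▸ hk', fun h' => ⟨h, rfl, h'⟩⟩
    rcases h2 {x | ∃ h, R.toFun h = x ∧ Γ.vert h ∈ A} (by
      intro x y hxy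
      obtain ⟨h, rfl⟩ := R.exists_eq x (G.r_left hxy)
      obtain ⟨k, rfl⟩ := R.exists_eq y (G.r_right hxy)
      rw [hm, hm, (R.r_iff h k).1 hxy]) (by
      rintro x ⟨⟨h, rfl, hx⟩, hx'⟩ y ⟨⟨k, rfl, hy⟩, hy'⟩
      rw [R.i_eq, hm] at hx' hy'
      rw [hA ⟨hx, hx'⟩ ⟨hy, hy'⟩]) with h | h
    · left
      ext v
      obtain ⟨k, rfl⟩ := R.surj v
      exact ⟨fun hk => h _ ((R.r_iff k k).2 rfl) ((hm k).2 hk), fun hk => hk.elim⟩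
    · right
      ext v
      obtain ⟨k, rfl⟩ := R.surj v
      exact ⟨fun _ => trivial, fun _ => (hm k).1 (h _ ((R.r_iff k k).2 rfl))⟩
  · rintro ⟨h1, h2⟩
    refine ⟨hedge.2 h1, fun A hA hcut => ?_⟩
    have hm : ∀ h, Γ.vert h ∈ {v | ∃ h, Γ.vert h = v ∧ R.toFun h ∈ A} ↔ R.toFun h ∈ A := fun h =>
      ⟨fun ⟨k, hk, hk'⟩ => (hA _ _ ((R.r_iff k h).2 hk)).1 hk', fun h' => ⟨h, rfl, h'⟩⟩
    rcases h2 {v | ∃ h, Γ.vert h = v ∧ R.toFun h ∈ A} (by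
      rintro h ⟨h3, h4⟩ k ⟨h5, h6⟩
      rw [hm] at h3 h4 h5 h6
      exact R.inj (hcut ⟨h3, by rwa [R.i_eq]⟩ ⟨h5, by rwa [R.i_eq]⟩)) with h | h
    · left
      intro x hx hxA
      obtain ⟨k, rfl⟩ := R.exists_eq x hx
      have := (hm k).2 hxA
      rw [h] at this
      exact this
    · right
      intro x hx
      obtain ⟨k, rfl⟩ := R.exists_eq x hx
      rw [← hm, h]
      trivial

theorem Realization.fieldsOf_eq [Finite X] (R : Realization fld Γ G) (h : Γ.H) :
    fieldsOf fld {y | G.r (R.toFun h) y} = Γ.fieldsOf {k | Γ.vert k = Γ.vert h} := by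
  have : {y | G.r (R.toFun h) y}.toFinite.toFinset =
      {k | Γ.vert k = Γ.vert h}.toFinite.toFinset.map ⟨R.toFun, R.inj⟩ := by
    ext y
    simp only [Set.Finite.mem_toFinset, Set.mem_ofPred_eq, Finset.mem_map,
      Function.Embedding.coeFn_mk]
    constructor
    · intro hy
      obtain ⟨k, rfl⟩ := R.exists_eq y (G.r_right hy)
      exact ⟨k, ((R.r_iff _ _).1 hy).symm, rfl⟩
    · rintro ⟨k, hk, rfl⟩
      exact (R.r_iff _ _).2 hk.symm
  rw [fieldsOf, this, FeynmanGraph.fieldsOf, Finset.map_val, Multiset.map_map]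
  exact Multiset.map_congr rfl fun k _ => R.fld_eq k

theorem Realizes.isGraphOf_iff [Finite X] (h : Realizes fld Γ G) :
    G.IsGraphOf fld T ↔ Γ.IsGraphOf T := by
  obtain ⟨R⟩ := h
  constructor
  · rintro ⟨h1, h2⟩
    constructor
    · intro h hh
      have := h1 (R.toFun h) (fun h' => hh (R.inj (by rw [← R.i_eq, h'])))
      rwa [R.i_eq, R.fld_eq, R.fld_eq] at this
    · intro v
      obtain ⟨h, rfl⟩ := R.surj v
      rw [← R.fieldsOf_eq]
      exact h2 _ ((R.r_iff h h).2 rfl)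
  · rintro ⟨h1, h2⟩
    constructor
    · intro x hx
      obtain ⟨h, rfl⟩ := R.exists_eq x (G.dom_of_ne hx)
      rw [R.i_eq, R.fld_eq, R.fld_eq]
      exact h1 h fun h' => hx (by rw [R.i_eq, h'])
    · intro x hx
      obtain ⟨h, rfl⟩ := R.exists_eq x hx
      rw [R.fieldsOf_eq]
      exact h2 _

theorem Realizes.isOnePIOf_iff [Finite X] (h : Realizes fld Γ G) :
    G.IsOnePIOf fld T ↔ Γ.IsGraphOf T ∧ Γ.OnePI := by
  rw [← h.isGraphOf_iff, ← h.onePI_iff]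
  exact ⟨fun h => ⟨h.2, h.1⟩, fun h => ⟨h.2, h.1⟩⟩

end HalfEdgeGraph

/-! ### Subgraphs, quotients and coefficients under a realization -/

namespace HalfEdgeGraph

variable {X : Type w} {F : Type u} {fld : X → F} {T : FieldTheory F}
  {G : HalfEdgeGraph X} {Γ Γ' : FeynmanGraph F}

namespace Realization

variable (R : Realization fld Γ G) (γ : Γ.Sub)

theorem mem_image {h : Γ.H} : R.toFun h ∈ R.toFun '' γ.carrier ↔ h ∈ γ.carrier :=
  R.inj.mem_set_image

theorem mem_star {h : Γ.H} : R.toFun h ∈ G.star (R.toFun '' γ.carrier) ↔ Γ.vert h ∈ γ.verts := by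
  constructor
  · rintro ⟨_, ⟨k, hk, rfl⟩, hkh⟩
    exact ⟨k, hk, (R.r_iff _ _).1 hkh⟩
  · rintro ⟨k, hk, hkh⟩
    exact ⟨_, ⟨k, hk, rfl⟩, (R.r_iff _ _).2 hkh⟩

theorem mem_legs {h : Γ.H} : R.toFun h ∈ G.legs (R.toFun '' γ.carrier) ↔ h ∈ γ.legs := by
  rw [legs, Set.mem_sdiff, R.mem_star, R.mem_image]
  rfl

theorem legs_eq : G.legs (R.toFun '' γ.carrier) = R.toFun '' γ.legs := by
  ext x
  constructor
  · intro hx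
    obtain ⟨h, rfl⟩ := R.exists_eq x (dom_of_star hx.1)
    exact ⟨h, (R.mem_legs γ).1 hx, rfl⟩
  · rintro ⟨h, hh, rfl⟩
    exact (R.mem_legs γ).2 hh

theorem ncard_legs : (G.legs (R.toFun '' γ.carrier)).ncard = γ.legs.ncard := by
  rw [R.legs_eq, Set.ncard_image_of_injective _ R.inj]

theorem isEdgeSet : G.IsEdgeSet (R.toFun '' γ.carrier) := by
  constructor
  · rintro _ ⟨h, hh, rfl⟩
    rw [R.i_eq]
    exact fun h' => γ.internal h hh (R.inj h')
  · rintro _ ⟨h, hh, rfl⟩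
    rw [R.i_eq]
    exact ⟨_, γ.inv_mem h hh, rfl⟩

theorem sub_realizes : Realizes fld γ.toGraph (G.sub (R.toFun '' γ.carrier)) := by
  refine ⟨⟨fun h => R.toFun h.1, R.inj.comp Subtype.val_injective, ?_, ?_, ?_,
    fun h => R.fld_eq h.1, ?_⟩⟩
  · rintro x ⟨hx, hx'⟩
    obtain ⟨h, rfl⟩ := R.exists_eq x hx
    exact ⟨⟨h, (R.mem_star γ).1 hx'⟩, rfl⟩
  · intro h k
    rw [sub_r, R.r_iff, R.mem_star]
    exact ⟨fun h' => Subtype.ext h'.1, fun h' => ⟨congrArg Subtype.val h', h.2⟩⟩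
  · intro h
    rw [(R.isEdgeSet γ).sub_i, R.mem_image, R.i_eq]
    by_cases hh : h.1 ∈ γ.carrier
    · simp [FeynmanGraph.Sub.toGraph, hh]
    · simp [FeynmanGraph.Sub.toGraph, hh]
  · rintro ⟨v, hv⟩
    obtain ⟨h, hh, rfl⟩ := hv
    exact ⟨⟨h, γ.vert_mem hh⟩, rfl⟩

/-- A leg is needed because the vertex `none` would otherwise carry no half-edge and be invisible in
the quotient on half-edges. -/
theorem contractToVertex_realizes (hl : γ.legs.Nonempty) :
    Realizes fld γ.contractToVertex (G.vquot (R.toFun '' γ.carrier)) := by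
  refine ⟨⟨fun h => R.toFun h.1, R.inj.comp Subtype.val_injective, ?_, ?_, ?_,
    fun h => R.fld_eq h.1, ?_⟩⟩
  · rintro x ⟨hx, -, hx'⟩
    obtain ⟨h, rfl⟩ := R.exists_eq x (hx'.elim id fun h => dom_of_star h.1)
    exact ⟨⟨h, fun h' => hx ((R.mem_image γ).2 h')⟩, rfl⟩
  · rintro ⟨h, hh⟩ ⟨k, hk⟩
    rw [vquot_r, R.mem_image, R.mem_image, R.mem_star, R.mem_star, R.r_iff]
    by_cases h1 : Γ.vert h ∈ γ.verts
    · by_cases h2 : Γ.vert k ∈ γ.verts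
      · simp [FeynmanGraph.Sub.contractToVertex, h1, h2, hh, hk]
      · simp only [FeynmanGraph.Sub.contractToVertex, h1, h2, hh, hk]
        simp
        exact fun h3 => h2 (h3 ▸ h1)
    · by_cases h2 : Γ.vert k ∈ γ.verts
      · simp only [FeynmanGraph.Sub.contractToVertex, h1, h2, hh, hk]
        simp
        exact fun h3 => h1 (h3 ▸ h2)
      · simp [FeynmanGraph.Sub.contractToVertex, h1, h2, hh, hk]
  · rintro ⟨h, hh⟩
    rw [(R.isEdgeSet γ).vquot_i, R.mem_image, if_neg hh, R.i_eq]
    rfl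
  · rintro (_ | ⟨v, hv⟩)
    · obtain ⟨h, h1, h2⟩ := hl
      exact ⟨⟨h, h2⟩, by simp [FeynmanGraph.Sub.contractToVertex, h1]⟩
    · obtain ⟨h, rfl⟩ := R.surj v
      exact ⟨⟨h, fun h' => hv (γ.vert_mem h')⟩, by simp [FeynmanGraph.Sub.contractToVertex, hv]⟩

/-- `bypass` follows the other leg, whereas `flip` exchanges the elements of `outer`. They agree
also when the other leg is external: `outer` is then a singleton and both fix the half-edge. -/
theorem equot_i_eq_bypass (hγ : γ.legs.ncard = 2) {h : Γ.H} (hh : Γ.vert h ∉ γ.verts) :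
    (G.equot (R.toFun '' γ.carrier)).i (R.toFun h) = R.toFun (γ.bypass hγ h) := by
  rw [equot_i, R.mem_star, if_neg hh, R.i_eq, R.mem_star, FeynmanGraph.Sub.bypass]
  by_cases h1 : Γ.vert (Γ.inv h) ∈ γ.verts
  · have hleg : Γ.inv h ∈ γ.legs := ⟨h1, γ.not_mem_inv fun hc => hh (γ.vert_mem hc)⟩
    obtain ⟨ho, hne, -, huniq⟩ := γ.otherLeg_spec hγ hleg
    generalize γ.otherLeg hγ (Γ.inv h) = l at *
    rw [if_pos h1, if_pos h1]
    have hmem : ∀ k, R.toFun k ∈ G.outer (R.toFun '' γ.carrier) ↔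
        Γ.vert k ∉ γ.verts ∧ (k = h ∨ k = Γ.inv l) := by
      intro k
      rw [outer, Set.mem_ofPred_eq, R.mem_star, R.i_eq, R.mem_star]
      refine and_congr_right fun hk => ⟨fun h2 => ?_, ?_⟩
      · have h3 : Γ.inv k ∈ γ.legs := ⟨h2, γ.not_mem_inv fun hc => hk (γ.vert_mem hc)⟩
        by_cases h4 : Γ.inv k = Γ.inv h
        · left; rw [← Γ.inv_inv k, h4, Γ.inv_inv]
        · right; rw [← huniq _ h3 h4, Γ.inv_inv]
      · rintro (rfl | rfl)
        · exact h1
        · rw [Γ.inv_inv]; exact ho.1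
    have hout : ∀ x, x ∈ G.outer (R.toFun '' γ.carrier) → ∃ k, R.toFun k = x := by
      rintro x ⟨-, hx⟩
      obtain ⟨k, hk⟩ := R.exists_eq _ (dom_of_star hx)
      exact ⟨Γ.inv k, by rw [← R.i_eq, hk, G.i_i]⟩
    by_cases h2 : Γ.inv l = l
    · rw [if_pos h2]
      rcases flip_cases (G.outer (R.toFun '' γ.carrier)) (R.toFun h) with ⟨y, hy, hK, -⟩ | h3
      · exfalso
        have hyK : y ∈ G.outer (R.toFun '' γ.carrier) := by rw [hK]; simp
        obtain ⟨k, rfl⟩ := hout y hyK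
        obtain ⟨h4, rfl | rfl⟩ := (hmem k).1 hyK
        · exact hy rfl
        · rw [h2] at h4
          exact h4 ho.1
      · exact h3
    · rw [if_neg h2]
      have h3 : Γ.vert (Γ.inv l) ∉ γ.verts := by
        intro h3
        have h4 : Γ.inv l ∈ γ.legs := ⟨h3, γ.not_mem_inv ho.2⟩
        by_cases h5 : Γ.inv l = Γ.inv h
        · have := congrArg Γ.inv h5
          rw [Γ.inv_inv, Γ.inv_inv] at this
          exact hh (this ▸ ho.1)
        · exact h2 (huniq _ h4 h5)
      have h4 : G.outer (R.toFun '' γ.carrier) = {R.toFun h, R.toFun (Γ.inv l)} := by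
        ext x
        constructor
        · intro hx
          obtain ⟨k, rfl⟩ := hout x hx
          obtain ⟨_, rfl | rfl⟩ := (hmem k).1 hx
          · left; rfl
          · right; rfl
        · rintro (rfl | rfl)
          · exact (hmem _).2 ⟨hh, Or.inl rfl⟩
          · exact (hmem _).2 ⟨h3, Or.inr rfl⟩
      rw [h4]
      refine flip_pair fun h5 => hne ?_
      rw [← R.inj h5, Γ.inv_inv]
  · rw [if_neg h1, if_neg h1]

theorem contractToEdge_realizes (hγ : γ.legs.ncard = 2) :
    Realizes fld (γ.contractToEdge hγ) (G.equot (R.toFun '' γ.carrier)) := by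
  refine ⟨⟨fun h => R.toFun h.1, R.inj.comp Subtype.val_injective, ?_, ?_, ?_,
    fun h => R.fld_eq h.1, ?_⟩⟩
  · rintro x ⟨hx, hx'⟩
    obtain ⟨h, rfl⟩ := R.exists_eq x hx
    exact ⟨⟨h, fun h' => hx' ((R.mem_star γ).2 h')⟩, rfl⟩
  · intro h k
    rw [equot_r, R.r_iff, R.mem_star]
    exact ⟨fun h' => Subtype.ext h'.1, fun h' => ⟨congrArg Subtype.val h', h.2⟩⟩
  · intro h
    exact R.equot_i_eq_bypass γ hγ h.2
  · rintro ⟨v, hv⟩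
    obtain ⟨h, rfl⟩ := R.surj v
    exact ⟨⟨h, hv⟩, rfl⟩

theorem contract_realizes (hl : γ.legs.Nonempty) :
    Realizes fld γ.contract (G.quot (R.toFun '' γ.carrier)) := by
  by_cases h2 : γ.legs.ncard = 2
  · rw [quot_eq_equot (by rwa [R.ncard_legs]), FeynmanGraph.Sub.contract, dif_pos h2]
    exact R.contractToEdge_realizes γ h2
  · rw [quot_eq_vquot (by rwa [R.ncard_legs]), FeynmanGraph.Sub.contract, dif_neg h2]
    exact R.contractToVertex_realizes γ hl

end Realization

/-- The half-edges at the contracted vertex are exactly the legs. -/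
theorem legs_nonempty_of_contract {γ : Γ.Sub} (hs : Function.Surjective γ.contract.vert) :
    γ.legs.Nonempty := by
  by_cases h2 : γ.legs.ncard = 2
  · exact Set.nonempty_of_ncard_ne_zero (by omega)
  · rw [FeynmanGraph.Sub.contract, dif_neg h2] at hs
    obtain ⟨⟨h, hh⟩, hv⟩ := hs (none : Option {v : Γ.V // v ∉ γ.verts})
    refine ⟨h, ?_, hh⟩
    by_contra h3
    simp [FeynmanGraph.Sub.contractToVertex, h3] at hv

/-- The coefficients of the insertion product as numbers of edge sets. -/
theorem Realizes.sectionCoeff_eq {Γ₁ Γ₂ : FeynmanGraph F} (h : Realizes fld Γ G) (hΓ : Γ.OnePI)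
    (h₁ : Γ₁.OnePI) (h₂ : Γ₂.OnePI) : FeynmanGraph.sectionCoeff Γ₁ Γ₂ Γ =
      {c | G.IsEdgeSet c ∧ Realizes fld Γ₂ (G.sub c) ∧ Realizes fld Γ₁ (G.quot c)}.ncard := by
  have hG := h.onePI_iff.2 hΓ
  obtain ⟨R⟩ := h
  have key : ∀ γ : Γ.Sub, (γ.toGraph.Iso Γ₂ ∧ γ.contract.Iso Γ₁) ↔
      (Realizes fld Γ₂ (G.sub (R.toFun '' γ.carrier)) ∧
        Realizes fld Γ₁ (G.quot (R.toFun '' γ.carrier))) := by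
    intro γ
    constructor
    · rintro ⟨h2, h1⟩
      have hl := legs_nonempty_of_contract (h1.symm.vert_surjective h₁.vert_surjective)
      exact ⟨(R.sub_realizes γ).of_iso h2, (R.contract_realizes γ hl).of_iso h1⟩
    · rintro ⟨h2, h1⟩
      have hne := (h2.onePI_iff.2 h₂).nonempty_of_sub (R.isEdgeSet γ)
      have hl := hG.legs_nonempty (R.isEdgeSet γ) hne (h1.onePI_iff.2 h₁).exists_edge
      rw [R.legs_eq, Set.image_nonempty] at hl
      exact ⟨(R.sub_realizes γ).iso h2, (R.contract_realizes γ hl).iso h1⟩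
  rw [FeynmanGraph.sectionCoeff, ← Nat.card_coe_set_eq]
  refine Nat.card_congr (Equiv.ofBijective
    (fun γ => ⟨R.toFun '' γ.1.carrier, R.isEdgeSet γ.1, (key γ.1).1 γ.2⟩) ⟨?_, ?_⟩)
  · rintro ⟨γ, hγ⟩ ⟨γ', hγ'⟩ heq
    have := R.inj.image_injective (congrArg Subtype.val heq)
    exact Subtype.ext (FeynmanGraph.Sub.ext this)
  · rintro ⟨c, hc, hc'⟩
    have himg : R.toFun '' (R.toFun ⁻¹' c) = c := by
      rw [Set.image_preimage_eq_iff]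
      intro x hx
      exact R.exists_eq x (G.dom_of_ne (hc.ne x hx))
    let γ : Γ.Sub := ⟨R.toFun ⁻¹' c, fun h hh h' => hc.ne _ hh (by rw [R.i_eq, h']),
      fun h hh => by
        have := hc.mem _ hh
        rwa [R.i_eq] at this⟩
    have hγ : R.toFun '' γ.carrier = c := himg
    exact ⟨⟨γ, (key γ).2 (by rwa [hγ])⟩, Subtype.ext hγ⟩

end HalfEdgeGraph

/-! ### Cycles and boundaries -/

namespace HalfEdgeGraph

variable {X : Type w} (G : HalfEdgeGraph X)

variable {G} in
theorem eq_zero_of_fixed {f : X → ℤ} (h : ∀ x, f (G.i x) = - f x) {x : X} (hx : G.i x = x) :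
    f x = 0 := by
  have := h x
  rw [hx] at this
  omega

variable {G} in
theorem OnePI.connected (hG : G.OnePI) (A : Set X) (hA : ∀ x y, G.r x y → (x ∈ A ↔ y ∈ A))
    (hA' : ∀ x ∈ A, G.i x ∈ A) : (∀ x, G.r x x → x ∉ A) ∨ (∀ x, G.r x x → x ∈ A) :=
  hG.cut A hA fun x hx => absurd (hA' x hx.1) hx.2

variable [Finite X]

/-- The half-edges at the vertex of `x`. -/
noncomputable def cls (x : X) : Finset X := {y | G.r x y}.toFinite.toFinset

theorem mem_cls {x y : X} : y ∈ G.cls x ↔ G.r x y := by simp [cls]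

/-- The first homology group: antisymmetric functions whose sum at every vertex vanishes. -/
noncomputable def homology : Submodule ℤ (X → ℤ) where
  carrier := {f | (∀ x, f (G.i x) = - f x) ∧ ∀ x, G.r x x → ∑ y ∈ G.cls x, f y = 0}
  zero_mem' := by simp
  add_mem' := by
    rintro a b ⟨ha, ha'⟩ ⟨hb, hb'⟩
    refine ⟨fun h => ?_, fun v hv => ?_⟩
    · simp only [Pi.add_apply, ha h, hb h]; ring
    · simp only [Pi.add_apply, Finset.sum_add_distrib, ha' v hv, hb' v hv, add_zero]
  smul_mem' := by
    rintro r a ⟨ha, ha'⟩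
    refine ⟨fun h => ?_, fun v hv => ?_⟩
    · simp only [Pi.smul_apply, smul_eq_mul, ha h]; ring
    · simp only [Pi.smul_apply, smul_eq_mul, ← Finset.mul_sum, ha' v hv, mul_zero]

variable {G}

/-- In a connected graph every distribution of charges of total charge zero is the boundary of a
one-chain. -/
theorem exists_boundary (hconn : ∀ A : Set X, (∀ x y, G.r x y → (x ∈ A ↔ y ∈ A)) →
      (∀ x ∈ A, G.i x ∈ A) → (∀ x, G.r x x → x ∉ A) ∨ (∀ x, G.r x x → x ∈ A))
    (s : Finset X) (hs : ∀ x ∈ s, G.r x x) (b : X → ℤ) (hb : ∑ x ∈ s, b x = 0)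
    (hb' : ∀ x ∉ s, b x = 0) :
    ∃ k : X → ℤ, (∀ x, k (G.i x) = - k x) ∧
      ∀ x, G.r x x → ∑ y ∈ G.cls x, k y = ∑ y ∈ G.cls x, b y := by
  classical
  rcases s.eq_empty_or_nonempty with rfl | ⟨x₀, hx₀⟩
  · exact ⟨0, by simp, fun x _ => by simp [hb']⟩
  have hpath : ∀ y, G.r y y → ∃ k : X → ℤ, (∀ x, k (G.i x) = - k x) ∧
      ∀ x, G.r x x → ∑ z ∈ G.cls x, k z =
        ∑ z ∈ G.cls x, ((Pi.single y 1 : X → ℤ) z - (Pi.single x₀ 1 : X → ℤ) z) := by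
    have hsingle : ∀ x y, ∑ z ∈ G.cls x, (Pi.single y 1 : X → ℤ) z = if G.r x y then 1 else 0 := by
      intro x y
      rw [Finset.sum_congr rfl fun z _ => Pi.single_apply y (1 : ℤ) z, Finset.sum_ite_eq']
      simp only [mem_cls]
    simp only [Finset.sum_sub_distrib, hsingle]
    -- The set of y for which [y] − [x₀] is a boundary is closed under staying at a vertex and under
    -- crossing an edge, so connectedness makes it everything.
    have := hconn {y | ∃ k : X → ℤ, (∀ x, k (G.i x) = - k x) ∧ ∀ x, G.r x x → ∑ z ∈ G.cls x, k z =
        (if G.r x y then 1 else 0) - (if G.r x x₀ then 1 else 0)} ?_ ?_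
    · rcases this with h | h
      · exact absurd ⟨0, by simp, by simp⟩ (h x₀ (hs x₀ hx₀))
      · exact h
    · intro x y hxy
      have : ∀ z, G.r z x ↔ G.r z y := fun z =>
        ⟨fun h => G.trans h hxy, fun h => G.trans h (G.symm hxy)⟩
      simp only [Set.mem_ofPred_eq, this]
    · rintro y ⟨k, hk, hk'⟩
      refine ⟨k + Pi.single (G.i y) 1 - Pi.single y 1, fun x => ?_, fun x hx => ?_⟩
      · have h1 : (Pi.single (G.i y) 1 : X → ℤ) (G.i x) = (Pi.single y 1 : X → ℤ) x := by
          simp only [Pi.single_apply]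
          congr 1
          exact propext ⟨fun h => by rw [← G.i_i x, h, G.i_i], fun h => by rw [h]⟩
        have h2 : (Pi.single y 1 : X → ℤ) (G.i x) = (Pi.single (G.i y) 1 : X → ℤ) x := by
          simp only [Pi.single_apply]
          congr 1
          exact propext ⟨fun h => by rw [← G.i_i x, h], fun h => by rw [h, G.i_i]⟩
        simp only [Pi.add_apply, Pi.sub_apply, hk, h1, h2]
        ring
      · simp only [Pi.add_apply, Pi.sub_apply, Finset.sum_add_distrib, Finset.sum_sub_distrib,
          hsingle, hk' x hx]
        ring
  choose! k hk hk' using hpath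
  -- Superpose the paths from x₀ to y with weight `b y`; the contributions at x₀ cancel because the
  -- total charge is zero.
  refine ⟨∑ y ∈ s, b y • k y, fun x => ?_, fun x hx => ?_⟩
  · simp only [Finset.sum_apply, Pi.smul_apply, smul_eq_mul, ← Finset.sum_neg_distrib]
    exact Finset.sum_congr rfl fun y hy => by rw [hk y (hs y hy)]; ring
  · simp only [Finset.sum_apply, Pi.smul_apply, smul_eq_mul]
    rw [Finset.sum_comm]
    have h1 : ∀ y ∈ s, ∑ z ∈ G.cls x, b y * k y z = ∑ z ∈ G.cls x,
        (b y * (Pi.single y 1 : X → ℤ) z - b y * (Pi.single x₀ 1 : X → ℤ) z) := by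
      intro y hy
      rw [← Finset.mul_sum, hk' y (hs y hy) x hx, Finset.mul_sum]
      exact Finset.sum_congr rfl fun z _ => by ring
    rw [Finset.sum_congr rfl h1, Finset.sum_comm]
    refine Finset.sum_congr rfl fun z _ => ?_
    rw [Finset.sum_sub_distrib, ← Finset.sum_mul, hb, zero_mul, sub_zero]
    simp only [Pi.single_apply, mul_ite, mul_one, mul_zero]
    rw [Finset.sum_ite_eq]
    split_ifs with h
    · rfl
    · exact (hb' z h).symm

open Classical in
/-- Cutting the internal edge of `a` into two external legs. -/
noncomputable def cutEdge (G : HalfEdgeGraph X) (a : X) : HalfEdgeGraph X where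
  r := G.r
  i x := if x = a ∨ x = G.i a then x else G.i x
  symm := G.symm
  trans := G.trans
  i_i x := by
    have := G.i_i x
    have := G.i_i a
    grind
  i_off x hx := by
    have := G.i_off x hx
    grind

/-- Cutting the edge of `a` leaves a connected graph, so its ends are joined by a chain `k` that
vanishes on that edge. The edge minus `k` is a cycle with value 1 at `a`. -/
theorem OnePI.homology_ne_bot (hG : G.OnePI) : G.homology ≠ ⊥ := by
  classical
  obtain ⟨a, ha⟩ := hG.exists_edge
  have hda := G.dom_of_ne ha
  have hib : ∀ x, (G.cutEdge a).i x = if x = a ∨ x = G.i a then x else G.i x := fun x => rfl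
  have hconn : ∀ A : Set X, (∀ x y, (G.cutEdge a).r x y → (x ∈ A ↔ y ∈ A)) →
      (∀ x ∈ A, (G.cutEdge a).i x ∈ A) →
      (∀ x, (G.cutEdge a).r x x → x ∉ A) ∨ (∀ x, (G.cutEdge a).r x x → x ∈ A) := by
    intro A hA hA'
    refine hG.cut A hA ?_
    have key : ∀ x, x ∈ A → G.i x ∉ A → x = a ∨ x = G.i a := by
      intro x hx hx'
      by_contra hcon
      have := hA' x hx
      rw [hib, if_neg hcon] at this
      exact hx' this
    rintro x ⟨hx, hx'⟩ y ⟨hy, hy'⟩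
    have h1 := key x hx hx'
    have h2 := key y hy hy'
    have h3 := G.i_i a
    grind
  let b : X → ℤ := Pi.single a 1 - Pi.single (G.i a) 1
  obtain ⟨k, hk, hk'⟩ := exists_boundary hconn {a, G.i a} (by
      intro x hx
      rcases Finset.mem_insert.1 hx with rfl | hx
      · exact hda
      · rw [Finset.mem_singleton.1 hx]
        exact G.dom_i hda) b (by
      rw [Finset.sum_pair ha.symm]
      simp [b, ha, ha.symm]) (by
      intro x hx
      simp only [Finset.mem_insert, Finset.mem_singleton, not_or] at hx
      simp [b, hx.1, hx.2])
  have hka : k a = 0 := eq_zero_of_fixed hk (by simp [hib])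
  have hka' : k (G.i a) = 0 := eq_zero_of_fixed hk (by simp [hib])
  intro hbot
  have hmem : b - k ∈ G.homology := by
    refine ⟨fun x => ?_, fun x hx => ?_⟩
    · by_cases hx : x = a
      · subst hx
        simp [b, ha, ha.symm, hka, hka']
      · by_cases hx' : x = G.i a
        · subst hx'
          simp [b, ha, ha.symm, hka, hka', G.i_i]
        · have h1 := hk x
          rw [hib, if_neg (by tauto)] at h1
          have h2 : G.i x ≠ a := fun h => hx' (by rw [← h, G.i_i])
          have h3 : G.i x ≠ G.i a := fun h => hx (by rw [← G.i_i x, h, G.i_i])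
          simp [b, h1, h2, h3, hx, hx']
    · have := hk' x hx
      simp only [Pi.sub_apply, Finset.sum_sub_distrib] at this ⊢
      change ∑ y ∈ G.cls x, b y - ∑ y ∈ (G.cutEdge a).cls x, k y = 0
      rw [this]
      exact sub_self _
  rw [hbot, Submodule.mem_bot] at hmem
  have := congrFun hmem a
  simp [b, hka, ha.symm] at this

variable {c : Set X}

/-- The sum of a function over a union of vertices vanishes if its sum at every vertex does. -/
theorem sum_star_eq_zero {f : X → ℤ} (hf : ∀ x ∈ G.star c, ∑ y ∈ G.cls x, f y = 0) :
    ∑ y ∈ (G.star c).toFinite.toFinset, f y = 0 := by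
  classical
  -- `r` is reflexive only on its domain, so equality is adjoined to get an equivalence relation on
  -- `X`; on the star its classes are the vertices.
  let S : Setoid X := ⟨fun x y => G.r x y ∨ x = y, fun x => Or.inr rfl,
    fun h => h.elim (fun h => Or.inl (G.symm h)) (fun h => Or.inr h.symm), by
      rintro x y z (h | rfl) (h' | rfl)
      · exact Or.inl (G.trans h h')
      · exact Or.inl h
      · exact Or.inl h'
      · exact Or.inr rfl⟩
  rw [Finset.sum_partition S]
  refine Finset.sum_eq_zero fun q hq => ?_
  obtain ⟨x, hx, rfl⟩ := Finset.mem_image.1 hq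
  rw [Set.Finite.mem_toFinset] at hx
  rw [← hf x hx]
  refine Finset.sum_congr ?_ fun _ _ => rfl
  ext y
  rw [Finset.mem_filter, Set.Finite.mem_toFinset, mem_cls]
  constructor
  · rintro ⟨hy, h⟩
    rcases Quotient.exact h with h | rfl
    · exact G.symm h
    · exact dom_of_star hy
  · intro h
    exact ⟨(star_sat h).1 hx, Quotient.sound (Or.inl (G.symm h))⟩

theorem IsEdgeSet.sum_eq_zero (hc : G.IsEdgeSet c) {f : X → ℤ} (hf : ∀ x, f (G.i x) = - f x) :
    ∑ y ∈ c.toFinite.toFinset, f y = 0 :=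
  Finset.sum_involution (fun x _ => G.i x) (fun x _ => by rw [hf]; ring)
    (fun x hx _ => hc.ne x (by simpa using hx)) (fun x hx => by simpa using hc.mem x (by simpa using hx))
    (fun x _ => G.i_i x)

theorem IsEdgeSet.sum_legs (hc : G.IsEdgeSet c) {f : X → ℤ} (hf : ∀ x, f (G.i x) = - f x) :
    ∑ y ∈ (G.legs c).toFinite.toFinset, f y = ∑ y ∈ (G.star c).toFinite.toFinset, f y := by
  classical
  have h : (G.star c).toFinite.toFinset =
      (G.legs c).toFinite.toFinset ∪ c.toFinite.toFinset := by
    ext x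
    have := @hc.subset_star _ _ _ x
    simp only [legs, Finset.mem_union, Set.Finite.mem_toFinset, Set.mem_sdiff]
    tauto
  rw [h, Finset.sum_union, hc.sum_eq_zero hf, add_zero]
  rw [Finset.disjoint_left]
  intro x hx
  simp only [legs, Set.Finite.mem_toFinset, Set.mem_sdiff] at hx ⊢
  exact hx.2

end HalfEdgeGraph

/-! ### Additivity of the loop number -/

namespace HalfEdgeGraph

variable {X : Type w}

open Classical in
/-- Restriction of chains to the complement of the set `b`. -/
noncomputable def restrictCompl (b : Set X) : (X → ℤ) →ₗ[ℤ] (X → ℤ) where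
  toFun f x := if x ∈ b then 0 else f x
  map_add' f g := by ext x; by_cases h : x ∈ b <;> simp [h]
  map_smul' r f := by ext x; by_cases h : x ∈ b <;> simp [h]

open Classical in
theorem restrictCompl_apply (b : Set X) (f : X → ℤ) (x : X) :
    restrictCompl b f x = if x ∈ b then 0 else f x := rfl

variable [Finite X] {G : HalfEdgeGraph X} {c : Set X}

theorem cls_sub {x : X} (hx : x ∈ G.star c) : (G.sub c).cls x = G.cls x := by
  ext y
  rw [mem_cls, mem_cls, sub_r]
  exact ⟨fun h => h.1, fun h => ⟨h, hx⟩⟩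

theorem cls_equot {x : X} (hx : x ∉ G.star c) : (G.equot c).cls x = G.cls x := by
  ext y
  rw [mem_cls, mem_cls, equot_r]
  exact ⟨fun h => h.1, fun h => ⟨h, hx⟩⟩

theorem IsEdgeSet.cls_vquot (hc : G.IsEdgeSet c) {x : X} (hx : x ∉ G.star c) :
    (G.vquot c).cls x = G.cls x := by
  ext y
  rw [mem_cls, mem_cls, vquot_r]
  constructor
  · rintro ⟨_, _, h | h⟩
    · exact h
    · exact absurd h.1 hx
  · intro h
    exact ⟨fun h' => hx (hc.subset_star h'),
      fun h' => hx ((star_sat h).2 (hc.subset_star h')), Or.inl h⟩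

theorem cls_vquot_legs {x : X} (hx : x ∈ G.legs c) :
    (G.vquot c).cls x = (G.legs c).toFinite.toFinset := by
  ext y
  rw [mem_cls, vquot_r, Set.Finite.mem_toFinset]
  constructor
  · rintro ⟨_, h1, h | h⟩
    · exact ⟨(star_sat h).1 hx.1, h1⟩
    · exact ⟨h.2, h1⟩
  · intro h
    exact ⟨hx.2, h.2, Or.inr ⟨hx.1, h.1⟩⟩

/-- The cycles of a subgraph are the cycles supported on it. -/
theorem IsEdgeSet.mem_homology_sub (hc : G.IsEdgeSet c) {f : X → ℤ} :
    f ∈ (G.sub c).homology ↔ f ∈ G.homology ∧ ∀ x ∉ c, f x = 0 := by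
  constructor
  · rintro ⟨h1, h2⟩
    have h0 : ∀ x ∉ c, f x = 0 := fun x hx => eq_zero_of_fixed h1 (by rw [hc.sub_i, if_neg hx])
    refine ⟨⟨fun x => ?_, fun x hx => ?_⟩, h0⟩
    · by_cases hx : x ∈ c
      · rw [← h1, hc.sub_i, if_pos hx]
      · rw [h0 x hx, h0 _ fun h => hx (hc.mem_iff.1 h), neg_zero]
    · by_cases hs : x ∈ G.star c
      · rw [← cls_sub hs]
        exact h2 x ⟨hx, hs⟩
      · refine Finset.sum_eq_zero fun y hy => h0 y fun hyc => hs ?_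
        rw [mem_cls] at hy
        exact (star_sat hy).2 (hc.subset_star hyc)
  · rintro ⟨⟨h1, h2⟩, h0⟩
    refine ⟨fun x => ?_, ?_⟩
    · rw [hc.sub_i]
      split_ifs with h
      · exact h1 x
      · rw [h0 x h, neg_zero]
    · rintro x ⟨hx, hx'⟩
      rw [cls_sub hx']
      exact h2 x hx

/-- A chain which is closed outside a connected subgraph can be made closed by adding a chain
supported on that subgraph. -/
theorem IsEdgeSet.exists_add_mem_homology (hc : G.IsEdgeSet c) (hs : (G.sub c).OnePI) {g : X → ℤ}
    (hg : ∀ x, g (G.i x) = - g x) (hg' : ∀ x, G.r x x → x ∉ G.star c → ∑ y ∈ G.cls x, g y = 0)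
    (hsum : ∑ y ∈ (G.star c).toFinite.toFinset, g y = 0) :
    ∃ f ∈ G.homology, ∀ x ∉ c, f x = g x := by
  classical
  -- The boundary defect of `g` on the vertices of `c` has total zero, so it is cancelled by a chain
  -- of the connected subgraph.
  obtain ⟨k, hk, hk'⟩ := exists_boundary hs.connected (G.star c).toFinite.toFinset
    (fun x hx => by
      rw [Set.Finite.mem_toFinset] at hx
      exact ⟨dom_of_star hx, hx⟩) (fun x => if x ∈ G.star c then - g x else 0) (by
    rw [Finset.sum_congr rfl (g := fun x => - g x), Finset.sum_neg_distrib, hsum, neg_zero]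
    intro x hx
    rw [Set.Finite.mem_toFinset] at hx
    rw [if_pos hx]) (by
    intro x hx
    rw [Set.Finite.mem_toFinset] at hx
    rw [if_neg hx])
  have h0 : ∀ x ∉ c, k x = 0 := fun x hx => eq_zero_of_fixed hk (by rw [hc.sub_i, if_neg hx])
  refine ⟨g + k, ⟨fun x => ?_, fun x hx => ?_⟩, fun x hx => by simp [h0 x hx]⟩
  · have : k (G.i x) = - k x := by
      by_cases hx : x ∈ c
      · rw [← hk, hc.sub_i, if_pos hx]
      · rw [h0 x hx, h0 _ fun h => hx (hc.mem_iff.1 h), neg_zero]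
    simp only [Pi.add_apply, hg, this]
    ring
  · simp only [Pi.add_apply, Finset.sum_add_distrib]
    by_cases hxs : x ∈ G.star c
    · have h1 := hk' x ⟨hx, hxs⟩
      rw [cls_sub hxs] at h1
      rw [h1, ← Finset.sum_add_distrib]
      refine Finset.sum_eq_zero fun y hy => ?_
      rw [mem_cls] at hy
      rw [if_pos ((star_sat hy).1 hxs)]
      ring
    · rw [hg' x hx hxs, zero_add]
      refine Finset.sum_eq_zero fun y hy => h0 y fun hyc => hxs ?_
      rw [mem_cls] at hy
      exact (star_sat hy).2 (hc.subset_star hyc)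

theorem sum_legs_eq_zero (hc : G.IsEdgeSet c) {f : X → ℤ} (hf : f ∈ G.homology) :
    ∑ y ∈ (G.legs c).toFinite.toFinset, f y = 0 := by
  rw [hc.sum_legs hf.1]
  exact sum_star_eq_zero fun x hx => hf.2 x (dom_of_star hx)

/-- The condition at the contracted vertex says that the flow through the legs of `c` sums to zero,
which holds for cycles of `G` and is exactly what allows a cycle of the quotient to be completed
inside `c`. -/
theorem map_homology_vquot (hc : G.IsEdgeSet c) (hs : (G.sub c).OnePI)
    (hl : (G.legs c).Nonempty) : G.homology.map (restrictCompl c) = (G.vquot c).homology := by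
  classical
  have hdom : ∀ x, (G.vquot c).r x x → x ∉ G.star c ∨ x ∈ G.legs c := by
    rintro x ⟨h, -, -⟩
    by_cases h' : x ∈ G.star c
    · exact Or.inr ⟨h', h⟩
    · exact Or.inl h'
  apply le_antisymm
  · rintro _ ⟨f, hf, rfl⟩
    refine ⟨fun x => ?_, fun x hx => ?_⟩
    · rw [hc.vquot_i, restrictCompl_apply, restrictCompl_apply]
      by_cases h : x ∈ c
      · simp [h]
      · have h' : G.i x ∉ c := fun h' => h (hc.mem_iff.1 h')
        simp [h, h', hf.1 x]
    · rcases hdom x hx with h | h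
      · rw [hc.cls_vquot h, ← hf.2 x]
        · refine Finset.sum_congr rfl fun y hy => ?_
          rw [mem_cls] at hy
          rw [restrictCompl_apply, if_neg fun h' => h ((star_sat hy).2 (hc.subset_star h'))]
        · obtain ⟨-, -, h1 | h1⟩ := hx
          · exact h1
          · exact absurd h1.1 h
      · rw [cls_vquot_legs h, ← sum_legs_eq_zero hc hf]
        refine Finset.sum_congr rfl fun y hy => ?_
        rw [Set.Finite.mem_toFinset] at hy
        rw [restrictCompl_apply, if_neg hy.2]
  · intro g hg
    have h0 : ∀ x ∈ c, g x = 0 := fun x hx => eq_zero_of_fixed hg.1 (by rw [hc.vquot_i, if_pos hx])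
    have hgi : ∀ x, g (G.i x) = - g x := fun x => by
      by_cases hx : x ∈ c
      · rw [h0 x hx, h0 _ (hc.mem x hx), neg_zero]
      · rw [← hg.1, hc.vquot_i, if_neg hx]
    obtain ⟨f, hf, hfg⟩ := hc.exists_add_mem_homology hs hgi (fun x hx hx' => by
      rw [← hc.cls_vquot hx']
      have : x ∉ c := fun h => hx' (hc.subset_star h)
      exact hg.2 x ⟨this, this, Or.inl hx⟩) (by
      obtain ⟨z, hz⟩ := hl
      rw [← hc.sum_legs hgi, ← cls_vquot_legs hz]
      exact hg.2 z ⟨hz.2, hz.2, Or.inr ⟨hz.1, hz.1⟩⟩)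
    refine ⟨f, hf, ?_⟩
    ext x
    rw [restrictCompl_apply]
    split_ifs with h
    · exact (h0 x h).symm
    · exact hfg x h

/-- The flow entering `c` at one leg leaves at the other, so a cycle of `G` is antisymmetric along
the new edge. Conversely a flow along the new edge can be routed through `c`. -/
theorem map_homology_equot (hc : G.IsEdgeSet c) (hs : (G.sub c).OnePI) {p q : X} (hpq : p ≠ q)
    (hl : G.legs c = {p, q}) (hp : G.i p ∉ G.star c) (hq : G.i q ∉ G.star c)
    (ho : G.outer c = {G.i p, G.i q}) :
    G.homology.map (restrictCompl (G.star c)) = (G.equot c).homology := by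
  classical
  have f' := equot_i_of_legs hpq ho
  have hleg : ∀ h : X → ℤ, ∑ y ∈ (G.legs c).toFinite.toFinset, h y = h p + h q := by
    intro h
    have : (G.legs c).toFinite.toFinset = {p, q} := by
      ext x
      rw [Set.Finite.mem_toFinset, hl]
      simp
    rw [this, Finset.sum_pair hpq]
  have hps : p ∈ G.legs c := by rw [hl]; simp
  have hqs : q ∈ G.legs c := by rw [hl]; simp
  have hout : ∀ y, y ∉ G.star c → G.i y ∈ G.star c → y = G.i p ∨ y = G.i q := fun y h1 h2 => by
    have : y ∈ G.outer c := ⟨h1, h2⟩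
    rwa [ho] at this
  have hstar : ∀ x ∈ G.star c, x ∈ c ∨ x = p ∨ x = q := by
    intro x hx
    by_cases hxc : x ∈ c
    · exact Or.inl hxc
    · have : x ∈ G.legs c := ⟨hx, hxc⟩
      rw [hl] at this
      exact Or.inr this
  have hip : (G.equot c).i (G.i p) = G.i q := by rw [f', if_neg hp, if_pos rfl]
  apply le_antisymm
  · rintro _ ⟨f, hf, rfl⟩
    have h1 := sum_legs_eq_zero hc hf
    rw [hleg] at h1
    have h2 := hf.1 p
    have h3 := hf.1 q
    refine ⟨fun x => ?_, fun x hx => ?_⟩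
    · rw [f', restrictCompl_apply, restrictCompl_apply]
      by_cases h : x ∈ G.star c
      · simp [h]
      · rw [if_neg h, if_neg h]
        by_cases h4 : x = G.i p
        · rw [if_pos h4, if_neg hq, h4]
          omega
        · by_cases h5 : x = G.i q
          · rw [if_neg h4, if_pos h5, if_neg hp, h5]
            omega
          · rw [if_neg h4, if_neg h5, if_neg fun h6 => (hout x h h6).elim h4 h5, hf.1]
    · rw [cls_equot hx.2, ← hf.2 x hx.1]
      refine Finset.sum_congr rfl fun y hy => ?_
      rw [mem_cls] at hy
      rw [restrictCompl_apply, if_neg fun h' => hx.2 ((star_sat hy).2 h')]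
  · intro g hg
    have h0 : ∀ x ∈ G.star c, g x = 0 := fun x hx =>
      eq_zero_of_fixed hg.1 (by rw [f', if_pos hx])
    have hgpq : g (G.i q) = - g (G.i p) := by rw [← hip, hg.1]
    -- The values at the legs, lost in the quotient, are forced by antisymmetry along the edges at
    -- `p` and `q`.
    let g' : X → ℤ := fun x => if x = p then - g (G.i p) else if x = q then - g (G.i q) else g x
    have hg'c : ∀ x ∈ c, g' x = 0 := by
      intro x hx
      have h1 : x ≠ p := fun h => hps.2 (h ▸ hx)
      have h2 : x ≠ q := fun h => hqs.2 (h ▸ hx)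
      simp only [g', h1, h2, if_false]
      exact h0 x (hc.subset_star hx)
    have hg's : ∀ x, x ∉ G.star c → g' x = g x := by
      intro x hx
      have h1 : x ≠ p := fun h => hx (h ▸ hps.1)
      have h2 : x ≠ q := fun h => hx (h ▸ hqs.1)
      simp only [g', h1, h2, if_false]
    have hg'p : g' p = - g (G.i p) := by simp [g']
    have hg'q : g' q = - g (G.i q) := by simp [g', hpq.symm]
    have hgi : ∀ x, g' (G.i x) = - g' x := by
      intro x
      by_cases hx : x ∈ G.star c
      · rcases hstar x hx with h | rfl | rfl
        · rw [hg'c x h, hg'c _ (hc.mem x h), neg_zero]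
        · rw [hg'p, hg's _ hp, neg_neg]
        · rw [hg'q, hg's _ hq, neg_neg]
      · by_cases hx' : G.i x ∈ G.star c
        · rcases hout x hx hx' with rfl | rfl
          · rw [G.i_i, hg'p, hg's _ hp]
          · rw [G.i_i, hg'q, hg's _ hq]
        · rw [hg's _ hx, hg's _ hx', ← hg.1, equot_i, if_neg hx, if_neg hx']
    obtain ⟨f, hf, hfg⟩ := hc.exists_add_mem_homology hs hgi (fun x hx hx' => by
      rw [← hg.2 x ⟨hx, hx'⟩, cls_equot hx']
      refine Finset.sum_congr rfl fun y hy => hg's y fun h => hx' ?_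
      rw [mem_cls] at hy
      exact (star_sat hy).2 h) (by
      rw [← hc.sum_legs hgi, hleg, hg'p, hg'q, hgpq]
      ring)
    refine ⟨f, hf, ?_⟩
    ext x
    rw [restrictCompl_apply]
    split_ifs with h
    · exact (h0 x h).symm
    · rw [hfg x fun h' => h (hc.subset_star h'), hg's x h]

/-- The number of loops of `G` is the sum of those of a subgraph and of the quotient. -/
theorem OnePI.finrank_homology (hG : G.OnePI) (hc : G.IsEdgeSet c) (hs : (G.sub c).OnePI)
    (hx : ∃ x, (G.quot c).i x ≠ x) : Module.finrank ℤ G.homology =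
      Module.finrank ℤ (G.quot c).homology + Module.finrank ℤ (G.sub c).homology := by
  have hne := hs.nonempty_of_sub hc
  -- In the self-energy case the kernel is still the cycles of `c`: a chain vanishing outside `star
  -- c` vanishes on both legs, since their partners lie outside.
  have key : G.homology.map (restrictCompl (G.block c)) = (G.quot c).homology ∧
      ∀ f ∈ G.homology, restrictCompl (G.block c) f = 0 ↔ f ∈ (G.sub c).homology := by
    by_cases h2 : (G.legs c).ncard = 2
    · obtain ⟨p, q, hpq, hl, hp, hq, ho⟩ := hG.exists_legs_of_quot hc hne h2 hx
      rw [quot_eq_equot h2, block, if_pos h2]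
      refine ⟨map_homology_equot hc hs hpq hl hp hq ho, fun f hf => ?_⟩
      rw [hc.mem_homology_sub, funext_iff]
      constructor
      · intro h
        have h' : ∀ x ∉ G.star c, f x = 0 := fun x hx => by
          have := h x
          rwa [restrictCompl_apply, if_neg hx] at this
        refine ⟨hf, fun x hx => ?_⟩
        by_cases hxs : x ∈ G.star c
        · have hxl : x ∈ G.legs c := ⟨hxs, hx⟩
          have h3 := hf.1 x
          rw [hl] at hxl
          rcases hxl with rfl | rfl
          · rw [h' _ hp] at h3
            omega
          · rw [h' _ hq] at h3
            omega
        · exact h' x hxs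
      · intro h x
        rw [restrictCompl_apply]
        split_ifs with hxs
        · rfl
        · exact h.2 x fun h' => hxs (hc.subset_star h')
    · rw [quot_eq_vquot h2, block, if_neg h2]
      refine ⟨map_homology_vquot hc hs (hG.legs_nonempty hc hne hx), fun f hf => ?_⟩
      rw [hc.mem_homology_sub, funext_iff]
      constructor
      · intro h
        refine ⟨hf, fun x hx => ?_⟩
        have := h x
        rwa [restrictCompl_apply, if_neg hx] at this
      · intro h x
        rw [restrictCompl_apply]
        split_ifs with hxs
        · rfl
        · exact h.2 x hxs
  have hle : (G.sub c).homology ≤ G.homology := fun f hf => (hc.mem_homology_sub.1 hf).1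
  -- Rank–nullity for the restriction map on the cycles of `G`.
  have h1 := Submodule.finrank_quotient_add_finrank
    (LinearMap.ker ((restrictCompl (G.block c)).domRestrict G.homology))
  rw [((restrictCompl (G.block c)).domRestrict G.homology).quotKerEquivRange.finrank_eq] at h1
  have h2 : LinearMap.ker ((restrictCompl (G.block c)).domRestrict G.homology) =
      (G.sub c).homology.comap G.homology.subtype := by
    ext ⟨f, hf⟩
    exact key.2 f hf
  rw [LinearMap.range_domRestrict, key.1, h2,
    (Submodule.comapSubtypeEquivOfLe hle).finrank_eq] at h1
  exact h1.symm

theorem OnePI.finrank_homology_ne_zero (hG : G.OnePI) : Module.finrank ℤ G.homology ≠ 0 := by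
  rw [ne_eq, Submodule.finrank_eq_zero]
  exact hG.homology_ne_bot

end HalfEdgeGraph

/-! ### Invariance of loop numbers and coefficients under isomorphism -/

namespace FeynmanGraph

variable {F : Type u} {Γ Γ' : FeynmanGraph F}

/-- The loop number of a graph identified with a graph on an ambient type. -/
theorem loopNumber_eq {X : Type w} [Finite X] {G : HalfEdgeGraph X} (j : Γ.H → X)
    (hj : Function.Injective j) (hdom : ∀ x, G.r x x → ∃ h, j h = x)
    (hr : ∀ h k, G.r (j h) (j k) ↔ Γ.vert h = Γ.vert k) (hi : ∀ h, G.i (j h) = j (Γ.inv h)) :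
    Γ.loopNumber = Module.finrank ℤ G.homology := by
  have hsum : ∀ (f : X → ℤ) h, ∑ y ∈ G.cls (j h), f y =
      ∑ k ∈ {k | Γ.vert k = Γ.vert h}.toFinite.toFinset, f (j k) := by
    intro f h
    have : G.cls (j h) = {k | Γ.vert k = Γ.vert h}.toFinite.toFinset.map ⟨j, hj⟩ := by
      ext y
      simp only [HalfEdgeGraph.mem_cls, Set.Finite.mem_toFinset, Set.mem_ofPred_eq, Finset.mem_map,
        Function.Embedding.coeFn_mk]
      constructor
      · intro hy
        obtain ⟨k, rfl⟩ := hdom y (G.r_right hy)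
        exact ⟨k, ((hr _ _).1 hy).symm, rfl⟩
      · rintro ⟨k, hk, rfl⟩
        exact (hr _ _).2 hk.symm
    rw [this, Finset.sum_map]
    rfl
  have hmem : ∀ f ∈ G.homology, LinearMap.funLeft ℤ ℤ j f ∈ Γ.homology := by
    rintro f ⟨h1, h2⟩
    refine ⟨fun h => ?_, fun v => ?_⟩
    · rw [LinearMap.funLeft_apply, LinearMap.funLeft_apply, ← hi, h1]
    · by_cases hv : ∃ h, Γ.vert h = v
      · obtain ⟨h, rfl⟩ := hv
        exact (hsum f h).symm.trans (h2 _ ((hr h h).2 rfl))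
      -- A vertex without half-edges imposes an empty condition, so `vert` need not be surjective
      -- here.
      · refine Finset.sum_eq_zero fun k hk => absurd ⟨k, ?_⟩ hv
        simpa using hk
  symm
  refine (LinearEquiv.ofBijective ((LinearMap.funLeft ℤ ℤ j).restrict hmem) ⟨?_, ?_⟩).finrank_eq
  · rintro ⟨f, hf⟩ ⟨g, hg⟩ h
    have h' : ∀ k, f (j k) = g (j k) := fun k => congrFun (congrArg Subtype.val h) k
    refine Subtype.ext (funext fun x => ?_)
    by_cases hx : G.r x x
    · obtain ⟨k, rfl⟩ := hdom x hx
      exact h' k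
    -- Off the domain the gluing is trivial, so antisymmetry forces cycles to vanish;
    -- correspondingly, cycles of `Γ` are extended by zero.
    · have hx' := G.i_off x hx
      change f x = g x
      rw [HalfEdgeGraph.eq_zero_of_fixed hf.1 hx', HalfEdgeGraph.eq_zero_of_fixed hg.1 hx']
  · rintro ⟨f, hf⟩
    have he : ∀ k, Function.extend j f 0 (j k) = f k := fun k => hj.extend_apply f 0 k
    refine ⟨⟨Function.extend j f 0, fun x => ?_, fun x hx => ?_⟩, ?_⟩
    · by_cases hx : ∃ k, j k = x
      · obtain ⟨k, rfl⟩ := hx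
        rw [hi, he, he, hf.1]
      · rw [G.i_off x fun h => hx (hdom x h), Function.extend_apply' _ _ _ hx]
        simp
    · obtain ⟨k, rfl⟩ := hdom x hx
      rw [hsum]
      simp only [he]
      exact hf.2 _
    · exact Subtype.ext (funext he)

theorem Iso.loopNumber_eq (h : Γ.Iso Γ') : Γ.loopNumber = Γ'.loopNumber := by
  obtain ⟨f, g, h1, h2, -⟩ := h
  rw [FeynmanGraph.loopNumber_eq (Γ := Γ') (G := HalfEdgeGraph.ofGraph Γ') id
    Function.injective_id (fun x _ => ⟨x, rfl⟩) (fun _ _ => Iff.rfl) (fun _ => rfl)]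
  refine FeynmanGraph.loopNumber_eq g g.injective (fun x _ => ⟨g.symm x, g.apply_symm_apply x⟩)
    (fun h k => ?_) h2
  change Γ'.vert (g h) = Γ'.vert (g k) ↔ _
  rw [h1, h1, f.injective.eq_iff]

theorem Sub.toGraph_inv_of_mem (γ : Γ.Sub) {h : Γ.H} (h' : Γ.vert h ∈ γ.verts)
    (hh : h ∈ γ.carrier) : (γ.toGraph.inv ⟨h, h'⟩).1 = Γ.inv h := by
  simp [Sub.toGraph, hh]

theorem Sub.toGraph_inv_of_notMem (γ : Γ.Sub) {h : Γ.H} (h' : Γ.vert h ∈ γ.verts)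
    (hh : h ∉ γ.carrier) : (γ.toGraph.inv ⟨h, h'⟩).1 = h := by
  simp [Sub.toGraph, hh]

theorem Sub.contractToVertex_vert_of_mem (γ : Γ.Sub) {h : Γ.H} (hh : h ∉ γ.carrier)
    (h' : Γ.vert h ∈ γ.verts) : γ.contractToVertex.vert ⟨h, hh⟩ = none := by
  simp [Sub.contractToVertex, h']

theorem Sub.contractToVertex_vert_of_notMem (γ : Γ.Sub) {h : Γ.H} (hh : h ∉ γ.carrier)
    (h' : Γ.vert h ∉ γ.verts) : γ.contractToVertex.vert ⟨h, hh⟩ = some ⟨Γ.vert h, h'⟩ := by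
  simp [Sub.contractToVertex, h']

section Transport

variable {γ : Γ.Sub} {γ' : Γ'.Sub} {f : Γ.V ≃ Γ'.V} {g : Γ.H ≃ Γ'.H}

theorem Sub.mem_verts_iff (h1 : ∀ h, Γ'.vert (g h) = f (Γ.vert h))
    (hc : ∀ h, g h ∈ γ'.carrier ↔ h ∈ γ.carrier) (v : Γ.V) : f v ∈ γ'.verts ↔ v ∈ γ.verts := by
  constructor
  · rintro ⟨k, hk, hk'⟩
    refine ⟨g.symm k, (hc _).1 (by rwa [g.apply_symm_apply]), f.injective ?_⟩
    rw [← h1, g.apply_symm_apply, hk']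
  · rintro ⟨k, hk, rfl⟩
    exact ⟨g k, (hc k).2 hk, h1 k⟩

theorem Sub.mem_legs_iff (h1 : ∀ h, Γ'.vert (g h) = f (Γ.vert h))
    (hc : ∀ h, g h ∈ γ'.carrier ↔ h ∈ γ.carrier) (h : Γ.H) : g h ∈ γ'.legs ↔ h ∈ γ.legs := by
  change Γ'.vert (g h) ∈ γ'.verts ∧ g h ∉ γ'.carrier ↔ Γ.vert h ∈ γ.verts ∧ h ∉ γ.carrier
  rw [h1, Sub.mem_verts_iff h1 hc, hc]

theorem Sub.ncard_legs_eq (h1 : ∀ h, Γ'.vert (g h) = f (Γ.vert h))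
    (hc : ∀ h, g h ∈ γ'.carrier ↔ h ∈ γ.carrier) : γ'.legs.ncard = γ.legs.ncard := by
  rw [← Set.ncard_image_of_injective γ.legs g.injective]
  congr 1
  ext k
  obtain ⟨h, rfl⟩ := g.surjective k
  rw [g.injective.mem_set_image, Sub.mem_legs_iff h1 hc]

theorem Sub.toGraph_iso (h1 : ∀ h, Γ'.vert (g h) = f (Γ.vert h))
    (h2 : ∀ h, Γ'.inv (g h) = g (Γ.inv h)) (h3 : ∀ h, Γ'.field (g h) = Γ.field h)
    (hc : ∀ h, g h ∈ γ'.carrier ↔ h ∈ γ.carrier) : γ.toGraph.Iso γ'.toGraph := by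
  refine ⟨f.subtypeEquiv fun v => (Sub.mem_verts_iff h1 hc v).symm,
    g.subtypeEquiv fun h => ?_, fun h => Subtype.ext (h1 h.1), fun h => Subtype.ext ?_,
    fun h => h3 h.1⟩
  · rw [h1, Sub.mem_verts_iff h1 hc]
  · obtain ⟨h, hs⟩ := h
    have hs' : Γ'.vert (g h) ∈ γ'.verts := by rwa [h1, Sub.mem_verts_iff h1 hc]
    by_cases hh : h ∈ γ.carrier
    · exact (Sub.toGraph_inv_of_mem γ' hs' ((hc h).2 hh)).trans
        ((h2 h).trans (congrArg g (Sub.toGraph_inv_of_mem γ hs hh).symm))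
    · exact (Sub.toGraph_inv_of_notMem γ' hs' fun h' => hh ((hc h).1 h')).trans
        (congrArg g (Sub.toGraph_inv_of_notMem γ hs hh).symm)

theorem Sub.contractToVertex_iso (h1 : ∀ h, Γ'.vert (g h) = f (Γ.vert h))
    (h2 : ∀ h, Γ'.inv (g h) = g (Γ.inv h)) (h3 : ∀ h, Γ'.field (g h) = Γ.field h)
    (hc : ∀ h, g h ∈ γ'.carrier ↔ h ∈ γ.carrier) :
    γ.contractToVertex.Iso γ'.contractToVertex := by
  have hv := Sub.mem_verts_iff h1 hc
  refine ⟨Equiv.optionCongr (f.subtypeEquiv fun v => not_congr (hv v).symm),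
    g.subtypeEquiv fun h => not_congr (hc h).symm, fun h => ?_, fun h => Subtype.ext (h2 h.1),
    fun h => h3 h.1⟩
  obtain ⟨h, hn⟩ := h
  have hn' : g h ∉ γ'.carrier := fun h' => hn ((hc h).1 h')
  by_cases hh : Γ.vert h ∈ γ.verts
  · have hh' : Γ'.vert (g h) ∈ γ'.verts := by rwa [h1, hv]
    rw [Sub.contractToVertex_vert_of_mem γ hn hh]
    exact Sub.contractToVertex_vert_of_mem γ' hn' hh'
  · have hh' : Γ'.vert (g h) ∉ γ'.verts := by rwa [h1, hv]
    rw [Sub.contractToVertex_vert_of_notMem γ hn hh]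
    exact (Sub.contractToVertex_vert_of_notMem γ' hn' hh').trans
      (congrArg some (Subtype.ext (h1 h)))

theorem Sub.contractToEdge_iso (h1 : ∀ h, Γ'.vert (g h) = f (Γ.vert h))
    (h2 : ∀ h, Γ'.inv (g h) = g (Γ.inv h)) (h3 : ∀ h, Γ'.field (g h) = Γ.field h)
    (hc : ∀ h, g h ∈ γ'.carrier ↔ h ∈ γ.carrier) (hγ : γ.legs.ncard = 2)
    (hγ' : γ'.legs.ncard = 2) : (γ.contractToEdge hγ).Iso (γ'.contractToEdge hγ') := by
  have hv := Sub.mem_verts_iff h1 hc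
  -- `otherLeg` is built from arbitrary choices, but its values on legs are unique and therefore
  -- preserved by isomorphisms.
  have hother : ∀ k ∈ γ.legs, γ'.otherLeg hγ' (g k) = g (γ.otherLeg hγ k) := by
    intro k hk
    obtain ⟨h4, h5, -, -⟩ := γ.otherLeg_spec hγ hk
    obtain ⟨-, -, -, h6⟩ := γ'.otherLeg_spec hγ' ((Sub.mem_legs_iff h1 hc k).2 hk)
    exact (h6 _ ((Sub.mem_legs_iff h1 hc _).2 h4) fun h => h5 (g.injective h)).symm
  refine ⟨f.subtypeEquiv fun v => not_congr (hv v).symm,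
    g.subtypeEquiv fun h => ?_, fun h => Subtype.ext (h1 h.1), fun h => Subtype.ext ?_,
    fun h => h3 h.1⟩
  · rw [h1, hv]
  · change γ'.bypass hγ' (g h.1) = g (γ.bypass hγ h.1)
    rw [Sub.bypass, Sub.bypass, h2, h1, hv]
    by_cases h4 : Γ.vert (Γ.inv h.1) ∈ γ.verts
    · have hleg : Γ.inv h.1 ∈ γ.legs := ⟨h4, γ.not_mem_inv fun hc => h.2 (γ.vert_mem hc)⟩
      rw [if_pos h4, if_pos h4, hother _ hleg, h2, g.injective.eq_iff]
      split_ifs <;> rfl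
    · rw [if_neg h4, if_neg h4]

theorem Sub.contract_iso (h1 : ∀ h, Γ'.vert (g h) = f (Γ.vert h))
    (h2 : ∀ h, Γ'.inv (g h) = g (Γ.inv h)) (h3 : ∀ h, Γ'.field (g h) = Γ.field h)
    (hc : ∀ h, g h ∈ γ'.carrier ↔ h ∈ γ.carrier) : γ.contract.Iso γ'.contract := by
  have hn := Sub.ncard_legs_eq h1 hc
  by_cases hγ : γ.legs.ncard = 2
  · have hγ' := hn.trans hγ
    rw [Sub.contract, dif_pos hγ, Sub.contract, dif_pos hγ']
    exact Sub.contractToEdge_iso h1 h2 h3 hc hγ hγ'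
  · have hγ' : ¬ γ'.legs.ncard = 2 := fun h => hγ (hn.symm.trans h)
    rw [Sub.contract, dif_neg hγ, Sub.contract, dif_neg hγ']
    exact Sub.contractToVertex_iso h1 h2 h3 hc

end Transport

/-- The graphs are arbitrary here and may have vertices without half-edges, so subgraphs and
quotients are transported along the isomorphism directly, not through realizations. -/
theorem sectionCoeff_congr {Γ₁ Γ₁' Γ₂ Γ₂' : FeynmanGraph F} (i₁ : Γ₁.Iso Γ₁') (i₂ : Γ₂.Iso Γ₂')
    (i : Γ.Iso Γ') : sectionCoeff Γ₁ Γ₂ Γ = sectionCoeff Γ₁' Γ₂' Γ' := by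
  obtain ⟨f, g, h1, h2, h3⟩ := i
  let e : Γ.Sub ≃ Γ'.Sub :=
    { toFun := fun γ => ⟨g.symm ⁻¹' γ.carrier, fun h hh => by
        have := γ.internal _ hh
        obtain ⟨k, rfl⟩ := g.surjective h
        rw [g.symm_apply_apply] at this
        rw [h2]
        exact fun h' => this (g.injective h'), fun h hh => by
        have := γ.inv_mem _ hh
        obtain ⟨k, rfl⟩ := g.surjective h
        rw [g.symm_apply_apply] at this
        rwa [Set.mem_preimage, h2, g.symm_apply_apply]⟩
      invFun := fun γ => ⟨g ⁻¹' γ.carrier, fun h hh h' => γ.internal _ hh (by rw [h2, h']),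
        fun h hh => by
          have := γ.inv_mem _ hh
          rwa [h2] at this⟩
      left_inv := fun γ => by ext; simp
      right_inv := fun γ => by ext; simp }
  refine Nat.card_congr (e.subtypeEquiv fun γ => ?_)
  have hc : ∀ h, g h ∈ (e γ).carrier ↔ h ∈ γ.carrier := fun h => by
    change g.symm (g h) ∈ γ.carrier ↔ _
    rw [g.symm_apply_apply]
  have k1 := Sub.toGraph_iso h1 h2 h3 hc
  have k2 := Sub.contract_iso h1 h2 h3 hc
  constructor
  · rintro ⟨h4, h5⟩
    exact ⟨(k1.symm.trans h4).trans i₂, (k2.symm.trans h5).trans i₁⟩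
  · rintro ⟨h4, h5⟩
    exact ⟨(k1.trans h4).trans i₂.symm, (k2.trans h5).trans i₁.symm⟩

end FeynmanGraph

/-- Double counting: pairs are sorted by the class `i` of the first component, and the number of
second components depends only on that class. -/
theorem Set.ncard_eq_sum_pairs {α β I : Type*} [Finite α] [Finite β] (S : Finset I)
    (Q : Set (α × β)) (A : I → Set α) (B : α → Set β) (n : I → ℕ)
    (hQ : ∀ x, x ∈ Q ↔ ∃ i ∈ S, x.1 ∈ A i ∧ x.2 ∈ B x.1)
    (hA : ∀ i j a, a ∈ A i → a ∈ A j → i = j) (hn : ∀ i ∈ S, ∀ a ∈ A i, (B a).ncard = n i) :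
    Q.ncard = ∑ i ∈ S, n i * (A i).ncard := by
  classical
  have : Fintype α := Fintype.ofFinite α
  have : Fintype β := Fintype.ofFinite β
  have hQ' : Q.toFinset = S.biUnion fun i => (A i).toFinset.biUnion fun a =>
      (B a).toFinset.map (Function.Embedding.sectR a β) := by
    ext ⟨a, b⟩
    rw [Set.mem_toFinset, hQ]
    simp only [Finset.mem_biUnion, Finset.mem_map, Set.mem_toFinset, Function.Embedding.sectR_apply,
      Prod.mk.injEq]
    constructor
    · rintro ⟨i, hi, ha, hb⟩
      exact ⟨i, hi, a, ha, b, hb, rfl, rfl⟩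
    · rintro ⟨i, hi, _, ha, _, hb, rfl, rfl⟩
      exact ⟨i, hi, ha, hb⟩
  rw [Set.ncard_eq_toFinset_card', hQ', Finset.card_biUnion]
  · refine Finset.sum_congr rfl fun i hi => ?_
    rw [Finset.card_biUnion]
    · rw [Finset.sum_congr rfl (g := fun _ => n i), Finset.sum_const, smul_eq_mul, mul_comm,
        Set.ncard_eq_toFinset_card']
      intro a ha
      rw [Finset.card_map, ← Set.ncard_eq_toFinset_card', hn i hi a (Set.mem_toFinset.1 ha)]
    · intro a _ a' _ haa'
      refine Finset.disjoint_left.2 ?_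
      simp only [Finset.mem_map, Set.mem_toFinset, Function.Embedding.sectR_apply]
      rintro _ ⟨b, -, rfl⟩ ⟨b', -, h⟩
      exact haa' (Prod.mk.inj h).1.symm
  · intro i _ j _ hij
    refine Finset.disjoint_left.2 ?_
    simp only [Finset.mem_biUnion, Finset.mem_map, Set.mem_toFinset,
      Function.Embedding.sectR_apply]
    rintro _ ⟨a, ha, b, -, rfl⟩ ⟨a', ha', b', -, h⟩
    obtain ⟨rfl, -⟩ := Prod.mk.inj h
    exact hij (hA i j _ ha ha')

/-! ### Isomorphism classes: finiteness, and sums of coefficients as counts of pairs -/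

namespace OnePIClass

open HalfEdgeGraph

variable {F : Type u} {T : FieldTheory F}

theorem onePI (C : OnePIClass T) : C.graph.OnePI := (Quotient.out C).2.2

theorem isGraphOf (C : OnePIClass T) : C.graph.IsGraphOf T := (Quotient.out C).2.1

theorem eq_of_iso {C C' : OnePIClass T} (h : C.graph.Iso C'.graph) : C = C' := by
  rw [← Quotient.out_eq C, ← Quotient.out_eq C']
  exact Quotient.sound h

theorem exists_graph_iso {Γ : FeynmanGraph F} (h : Γ.IsGraphOf T ∧ Γ.OnePI) :
    ∃ C : OnePIClass T, C.graph.Iso Γ :=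
  ⟨Quotient.mk _ ⟨Γ, h⟩, Quotient.mk_out (s := OnePIGraph.setoid T) ⟨Γ, h⟩⟩

theorem isOnePIOf {X : Type w} [Finite X] {fld : X → F} {G : HalfEdgeGraph X} {C : OnePIClass T}
    (h : Realizes fld C.graph G) : G.IsOnePIOf fld T :=
  h.isOnePIOf_iff.2 ⟨C.isGraphOf, C.onePI⟩

theorem exists_realizes {X : Type} [Finite X] {fld : X → F} {G : HalfEdgeGraph X}
    (h : G.IsOnePIOf fld T) : ∃ C : OnePIClass T, Realizes fld C.graph G := by
  have h1 := realizes_toGraph fld G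
  obtain ⟨C, hC⟩ := exists_graph_iso (h1.isOnePIOf_iff.1 h)
  exact ⟨C, h1.of_iso hC.symm⟩

theorem eq_of_realizes {X : Type w} {fld : X → F} {G : HalfEdgeGraph X} {C C' : OnePIClass T}
    (h : Realizes fld C.graph G) (h' : Realizes fld C'.graph G) : C = C' :=
  eq_of_iso (h.iso h')

theorem coeff_eq {X : Type w} {fld : X → F} {G : HalfEdgeGraph X} {C : OnePIClass T}
    (h : Realizes fld C.graph G) (C₁ C₂ : OnePIClass T) : coeff C₁ C₂ C =
      {c | G.IsEdgeSet c ∧ Realizes fld C₂.graph (G.sub c) ∧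
        Realizes fld C₁.graph (G.quot c)}.ncard :=
  h.sectionCoeff_eq C.onePI C₁.onePI C₂.onePI

theorem realizes_self (C : OnePIClass T) : Realizes C.graph.field C.graph (ofGraph C.graph) :=
  realizes_ofGraph C.onePI.vert_surjective

theorem exists_of_coeff_ne_zero {C₁ C₂ C : OnePIClass T} (h : coeff C₁ C₂ C ≠ 0) :
    ∃ c, (ofGraph C.graph).IsEdgeSet c ∧
      Realizes C.graph.field C₂.graph ((ofGraph C.graph).sub c) ∧
      Realizes C.graph.field C₁.graph ((ofGraph C.graph).quot c) := by
  rw [coeff_eq C.realizes_self] at h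
  exact Set.nonempty_of_ncard_ne_zero h

theorem loopNumber_eq {X : Type w} [Finite X] {fld : X → F} {G : HalfEdgeGraph X}
    {C : OnePIClass T} (h : Realizes fld C.graph G) :
    C.loopNumber = Module.finrank ℤ G.homology := by
  obtain ⟨R⟩ := h
  exact FeynmanGraph.loopNumber_eq R.toFun R.inj R.exists_eq R.r_iff R.i_eq

theorem loopNumber_ne_zero (C : OnePIClass T) : C.loopNumber ≠ 0 := by
  rw [loopNumber_eq C.realizes_self]
  exact (isOnePIOf C.realizes_self).onePI.finrank_homology_ne_zero

theorem loopNumber_add {C₁ C₂ C : OnePIClass T} (h : coeff C₁ C₂ C ≠ 0) :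
    C.loopNumber = C₁.loopNumber + C₂.loopNumber := by
  obtain ⟨c, hc, h2, h1⟩ := exists_of_coeff_ne_zero h
  rw [loopNumber_eq C.realizes_self, loopNumber_eq h1, loopNumber_eq h2]
  exact (isOnePIOf C.realizes_self).onePI.finrank_homology hc (isOnePIOf h2).onePI
    (isOnePIOf h1).onePI.exists_edge

/-- A graph can be realized on any type containing its set of half-edges. -/
theorem exists_realizes_on {X : Type w} {Γ : FeynmanGraph F} (hs : Function.Surjective Γ.vert)
    (j : Γ.H ↪ X) (a : F) : ∃ (fld : X → F) (G : HalfEdgeGraph X),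
      Realizes fld Γ G ∧ ∀ x, fld x = a ∨ ∃ h, fld x = Γ.field h := by
  have hi : ∀ h, Function.extend j (fun h => j (Γ.inv h)) id (j h) = j (Γ.inv h) := fun h =>
    j.injective.extend_apply _ _ h
  refine ⟨Function.extend j Γ.field fun _ => a, ⟨fun x y => ∃ h k, j h = x ∧ j k = y ∧ Γ.vert h = Γ.vert k,
    Function.extend j (fun h => j (Γ.inv h)) id, ?_, ?_, ?_, ?_⟩, ⟨⟨j, j.injective, ?_, ?_, hi,
      fun h => j.injective.extend_apply _ _ h, hs⟩⟩, fun x => ?_⟩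
  · rintro x y ⟨h, k, rfl, rfl, h1⟩
    exact ⟨k, h, rfl, rfl, h1.symm⟩
  · rintro x y z ⟨h, k, rfl, rfl, h1⟩ ⟨k', l, hk, rfl, h2⟩
    obtain rfl := j.injective hk
    exact ⟨h, l, rfl, rfl, h1.trans h2⟩
  · intro x
    by_cases hx : ∃ h, j h = x
    · obtain ⟨h, rfl⟩ := hx
      rw [hi, hi, Γ.inv_inv]
    · rw [Function.extend_apply' _ _ _ hx, id, Function.extend_apply' _ _ _ hx, id]
  · intro x hx
    refine Function.extend_apply' _ _ _ ?_
    rintro ⟨h, rfl⟩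
    exact hx ⟨h, h, rfl, rfl, rfl⟩
  · rintro x ⟨h, -, rfl, -⟩
    exact ⟨h, rfl⟩
  · intro h k
    constructor
    · rintro ⟨h', k', h1, h2, h3⟩
      rwa [j.injective h1, j.injective h2] at h3
    · exact fun h' => ⟨h, k, rfl, rfl, h'⟩
  · by_cases hx : ∃ h, j h = x
    · obtain ⟨h, rfl⟩ := hx
      exact Or.inr ⟨h, j.injective.extend_apply _ _ h⟩
    · exact Or.inl (Function.extend_apply' _ _ _ hx)

theorem finite_halfEdgeGraph (X : Type w) [Finite X] : Finite (HalfEdgeGraph X) :=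
  Finite.of_injective (fun G : HalfEdgeGraph X => (G.r, G.i)) fun _ _ h =>
    HalfEdgeGraph.ext (Prod.mk.inj h).1 (Prod.mk.inj h).2

/-- There are finitely many classes with a bounded number of half-edges and fields in a finite
set. -/
theorem finite_setOf_card_le (N : ℕ) (S : Set F) (hS : S.Finite) :
    {C : OnePIClass T | Nat.card C.graph.H ≤ N ∧ ∀ h, C.graph.field h ∈ S}.Finite := by
  have := finite_halfEdgeGraph (Fin N)
  -- A class is determined by any realization of it on `Fin N`, and with fields in a finite set
  -- there are finitely many of those.
  have hcode : ∀ C : OnePIClass T, Nat.card C.graph.H ≤ N ∧ (∀ h, C.graph.field h ∈ S) →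
      ∃ p : HalfEdgeGraph (Fin N) × (Fin N → F), (∀ x, p.2 x ∈ S) ∧
        Realizes p.2 C.graph p.1 := by
    rintro C ⟨hN, hC⟩
    obtain ⟨h₀, -⟩ := C.onePI.2.1
    have : Fintype C.graph.H := Fintype.ofFinite _
    obtain ⟨j⟩ : Nonempty (C.graph.H ↪ Fin N) := by
      rw [Function.Embedding.nonempty_iff_card_le, Fintype.card_fin, ← Nat.card_eq_fintype_card]
      exact hN
    -- Unused positions of `Fin N` get the field of some half-edge of `C`, which lies in `S`; one
    -- exists because a 1PI graph has an edge.
    obtain ⟨fld, G, hG, hfld⟩ := exists_realizes_on C.onePI.vert_surjective j (C.graph.field h₀)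
    refine ⟨(G, fld), fun x => ?_, hG⟩
    rcases hfld x with h | ⟨h, hh⟩
    · change fld x ∈ S
      exact h ▸ hC h₀
    · change fld x ∈ S
      exact hh ▸ hC h
  choose p hp hp' using hcode
  have hfin : Finite {q : HalfEdgeGraph (Fin N) × (Fin N → F) | ∀ x, q.2 x ∈ S} :=
    ((Set.finite_univ.prod (Set.Finite.pi' fun _ : Fin N => hS)).subset
      fun q hq => ⟨trivial, hq⟩).to_subtype
  refine Set.finite_coe_iff.1 (Finite.of_injective (β := {q : HalfEdgeGraph (Fin N) × (Fin N → F) |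
    ∀ x, q.2 x ∈ S}) (fun C => ⟨p C.1 C.2, hp C.1 C.2⟩) ?_)
  rintro ⟨C, hC⟩ ⟨C', hC'⟩ h
  have h1 := hp' C hC
  have h2 := hp' C' hC'
  have h' : p C hC = p C' hC' := congrArg Subtype.val h
  rw [← h'] at h2
  exact Subtype.ext (eq_of_realizes h1 h2)

/-- Each half-edge of `C` is at a vertex of the subgraph or survives in the quotient, so it comes
from `C₂` or `C₁`. This bounds the number of half-edges and the fields that occur, even when `F` is
infinite. -/
theorem finite_coeff_ne_zero (C₁ C₂ : OnePIClass T) :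
    {C : OnePIClass T | coeff C₁ C₂ C ≠ 0}.Finite := by
  refine (finite_setOf_card_le (Nat.card C₁.graph.H + Nat.card C₂.graph.H)
    (Set.range C₁.graph.field ∪ Set.range C₂.graph.field)
    ((Set.finite_range _).union (Set.finite_range _))).subset ?_
  intro C hC
  obtain ⟨c, hc, ⟨R₂⟩, ⟨R₁⟩⟩ := exists_of_coeff_ne_zero hC
  have hsurj : ∀ h : C.graph.H, ∃ k : C₁.graph.H ⊕ C₂.graph.H,
      Sum.elim R₁.toFun R₂.toFun k = h := by
    intro h
    have hr : (ofGraph C.graph).r h h := rfl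
    by_cases hs : h ∈ (ofGraph C.graph).star c
    · obtain ⟨k, hk⟩ := R₂.exists_eq h ⟨hr, hs⟩
      exact ⟨Sum.inr k, hk⟩
    · have : ((ofGraph C.graph).quot c).r h h := by
        by_cases h2 : ((ofGraph C.graph).legs c).ncard = 2
        · rw [quot_eq_equot h2]
          exact ⟨hr, hs⟩
        · rw [quot_eq_vquot h2]
          have hn : h ∉ c := fun h' => hs (hc.subset_star h')
          exact ⟨hn, hn, Or.inl hr⟩
      obtain ⟨k, hk⟩ := R₁.exists_eq h this
      exact ⟨Sum.inl k, hk⟩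
  constructor
  · rw [← Nat.card_sum]
    exact Nat.card_le_card_of_surjective _ hsurj
  · intro h
    obtain ⟨k | k, rfl⟩ := hsurj h
    · exact Or.inl ⟨k, (R₁.fld_eq k).symm⟩
    · exact Or.inr ⟨k, (R₂.fld_eq k).symm⟩

/-- Choosing `C'` amounts to naming the class of the quotient by the first subgraph. The number of
second subgraphs can be computed in that quotient itself, since it realizes `C'`. -/
theorem sum_coeff_mul_left (C₁ C₂ C₃ C : OnePIClass T) (S : Finset (OnePIClass T))
    (hS : ∀ C', coeff C₁ C₂ C' ≠ 0 → C' ∈ S) : ∑ C' ∈ S, coeff C₁ C₂ C' * coeff C' C₃ C =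
      (quotPairs C.graph.field T (ofGraph C.graph) (Realizes C.graph.field C₁.graph)
        (Realizes C.graph.field C₂.graph) (Realizes C.graph.field C₃.graph)).ncard := by
  set G := ofGraph C.graph
  set fld := C.graph.field
  rw [Set.ncard_eq_sum_pairs S _
    (fun C' => {c | G.IsEdgeSet c ∧ Realizes fld C₃.graph (G.sub c) ∧
      Realizes fld C'.graph (G.quot c)})
    (fun c => {c' | (G.quot c).IsEdgeSet c' ∧ Realizes fld C₂.graph ((G.quot c).sub c') ∧
      Realizes fld C₁.graph ((G.quot c).quot c')}) (fun C' => coeff C₁ C₂ C')]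
  · exact Finset.sum_congr rfl fun C' _ => by rw [coeff_eq C.realizes_self C' C₃]
  · rintro ⟨c, c'⟩
    constructor
    · rintro ⟨hc, h3, hq, hc', h2, h1⟩
      obtain ⟨C', hC'⟩ := exists_realizes hq
      refine ⟨C', hS C' ?_, ⟨hc, h3, hC'⟩, hc', h2, h1⟩
      rw [coeff_eq hC']
      exact Set.ncard_ne_zero_of_mem (a := c') ⟨hc', h2, h1⟩
    · rintro ⟨C', -, ⟨hc, h3, hC'⟩, hc', h2, h1⟩
      exact ⟨hc, h3, isOnePIOf hC', hc', h2, h1⟩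
  · exact fun C' C'' c h h' => eq_of_realizes h.2.2 h'.2.2
  · rintro C' - c ⟨-, -, h⟩
    exact (coeff_eq h C₁ C₂).symm

/-- Here `C'` is the class of the larger subgraph, in which the smaller one is chosen. -/
theorem sum_coeff_mul_right (C₁ C₂ C₃ C : OnePIClass T) (S : Finset (OnePIClass T))
    (hS : ∀ C', coeff C₂ C₃ C' ≠ 0 → C' ∈ S) : ∑ C' ∈ S, coeff C₂ C₃ C' * coeff C₁ C' C =
      (subPairs C.graph.field T (ofGraph C.graph) (Realizes C.graph.field C₁.graph)
        (Realizes C.graph.field C₂.graph) (Realizes C.graph.field C₃.graph)).ncard := by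
  set G := ofGraph C.graph
  set fld := C.graph.field
  rw [Set.ncard_eq_sum_pairs S _
    (fun C' => {c | G.IsEdgeSet c ∧ Realizes fld C'.graph (G.sub c) ∧
      Realizes fld C₁.graph (G.quot c)})
    (fun c => {c' | (G.sub c).IsEdgeSet c' ∧ Realizes fld C₃.graph ((G.sub c).sub c') ∧
      Realizes fld C₂.graph ((G.sub c).quot c')}) (fun C' => coeff C₂ C₃ C')]
  · exact Finset.sum_congr rfl fun C' _ => by rw [coeff_eq C.realizes_self C₁ C']
  · rintro ⟨c, c'⟩
    constructor
    · rintro ⟨hc, hs, h1, hc', h3, h2⟩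
      obtain ⟨C', hC'⟩ := exists_realizes hs
      refine ⟨C', hS C' ?_, ⟨hc, hC', h1⟩, hc', h3, h2⟩
      rw [coeff_eq hC']
      exact Set.ncard_ne_zero_of_mem (a := c') ⟨hc', h3, h2⟩
    · rintro ⟨C', -, ⟨hc, hC', h1⟩, hc', h3, h2⟩
      exact ⟨hc, isOnePIOf hC', h1, hc', h3, h2⟩
  · exact fun C' C'' c h h' => eq_of_realizes h.2.1 h'.2.1
  · rintro C' - c ⟨-, h, -⟩
    exact (coeff_eq h C₂ C₃).symm

end OnePIClass

/-! ### The pre-Lie product, the Lie bracket and the grading -/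

namespace GraphSpace

open OnePIClass

variable (K : Type w) [Field K] {F : Type u} (T : FieldTheory F)

theorem insertion_single_apply (C₁ C₂ C : OnePIClass T) :
    insertion K T (Finsupp.single C₁ 1) (Finsupp.single C₂ 1) C = (coeff C₁ C₂ C : K) := by
  classical
  have h : insertion K T (Finsupp.single C₁ 1) (Finsupp.single C₂ 1) =
      ∑ᶠ C : OnePIClass T, (Finsupp.single C (coeff C₁ C₂ C : K) : GraphSpace K T) := by
    simp [insertion]
  have hfin := finite_coeff_ne_zero C₁ C₂
  -- Finiteness of the support makes the `finsum` a genuine sum instead of its default value 0.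
  rw [h, finsum_eq_sum_of_support_subset (s := hfin.toFinset), Finsupp.finsetSum_apply]
  · simp only [Finsupp.single_apply]
    rw [Finset.sum_ite_eq']
    split_ifs with h
    · rfl
    · have : coeff C₁ C₂ C = 0 := by simpa using h
      simp [this]
  · intro C hC
    rw [Set.Finite.coe_toFinset]
    intro h0
    exact hC (by simp [h0])

theorem insertion_single (C₁ C₂ : OnePIClass T) :
    insertion K T (Finsupp.single C₁ 1) (Finsupp.single C₂ 1) =
      ∑ C ∈ (finite_coeff_ne_zero C₁ C₂).toFinset,
        (coeff C₁ C₂ C : K) • (Finsupp.single C 1 : GraphSpace K T) := by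
  classical
  ext C
  rw [insertion_single_apply, Finsupp.finsetSum_apply]
  simp only [Finsupp.smul_apply, Finsupp.single_apply, smul_eq_mul, mul_ite, mul_one, mul_zero]
  rw [Finset.sum_ite_eq']
  split_ifs with h
  · rfl
  · have : coeff C₁ C₂ C = 0 := by simpa using h
    simp [this]

/-- Compared coefficient by coefficient, the identity is the equality of counts
`HalfEdgeGraph.ncard_pre_lie`. -/
theorem pre_lie_single (C₁ C₂ C₃ : OnePIClass T) :
    insertion K T (insertion K T (Finsupp.single C₁ 1) (Finsupp.single C₂ 1)) (Finsupp.single C₃ 1)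
        - insertion K T (Finsupp.single C₁ 1)
          (insertion K T (Finsupp.single C₂ 1) (Finsupp.single C₃ 1))
      = insertion K T (insertion K T (Finsupp.single C₁ 1) (Finsupp.single C₃ 1))
          (Finsupp.single C₂ 1)
        - insertion K T (Finsupp.single C₁ 1)
          (insertion K T (Finsupp.single C₃ 1) (Finsupp.single C₂ 1)) := by
  have hl : ∀ C₁ C₂ C₃ C : OnePIClass T, insertion K T (insertion K T (Finsupp.single C₁ 1)
      (Finsupp.single C₂ 1)) (Finsupp.single C₃ 1) C =
      ((HalfEdgeGraph.quotPairs C.graph.field T (HalfEdgeGraph.ofGraph C.graph)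
        (HalfEdgeGraph.Realizes C.graph.field C₁.graph)
        (HalfEdgeGraph.Realizes C.graph.field C₂.graph)
        (HalfEdgeGraph.Realizes C.graph.field C₃.graph)).ncard : K) := by
    intro C₁ C₂ C₃ C
    rw [insertion_single, map_sum, LinearMap.sum_apply, Finsupp.finsetSum_apply,
      ← sum_coeff_mul_left C₁ C₂ C₃ C (finite_coeff_ne_zero C₁ C₂).toFinset
        (fun C' h => by simpa using h), Nat.cast_sum]
    refine Finset.sum_congr rfl fun C' _ => ?_
    rw [map_smul, LinearMap.smul_apply, Finsupp.smul_apply, insertion_single_apply, Nat.cast_mul,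
      smul_eq_mul]
  have hr : ∀ C₁ C₂ C₃ C : OnePIClass T, insertion K T (Finsupp.single C₁ 1)
      (insertion K T (Finsupp.single C₂ 1) (Finsupp.single C₃ 1)) C =
      ((HalfEdgeGraph.subPairs C.graph.field T (HalfEdgeGraph.ofGraph C.graph)
        (HalfEdgeGraph.Realizes C.graph.field C₁.graph)
        (HalfEdgeGraph.Realizes C.graph.field C₂.graph)
        (HalfEdgeGraph.Realizes C.graph.field C₃.graph)).ncard : K) := by
    intro C₁ C₂ C₃ C
    rw [insertion_single K T C₂ C₃, map_sum, Finsupp.finsetSum_apply,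
      ← sum_coeff_mul_right C₁ C₂ C₃ C (finite_coeff_ne_zero C₂ C₃).toFinset
        (fun C' h => by simpa using h), Nat.cast_sum]
    refine Finset.sum_congr rfl fun C' _ => ?_
    rw [map_smul, Finsupp.smul_apply, insertion_single_apply, Nat.cast_mul, smul_eq_mul]
  ext C
  rw [Finsupp.sub_apply, Finsupp.sub_apply, hl, hl, hr, hr, sub_eq_sub_iff_add_eq_add, ← Nat.cast_add,
    ← Nat.cast_add]
  exact congrArg Nat.cast <| HalfEdgeGraph.ncard_pre_lie (isOnePIOf C.realizes_self)
    (fun _ => isOnePIOf (C := C₁)) (fun _ => isOnePIOf (C := C₂)) (fun _ => isOnePIOf (C := C₃))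

theorem pre_lie (x y z : GraphSpace K T) :
    insertion K T (insertion K T x y) z - insertion K T x (insertion K T y z)
      = insertion K T (insertion K T x z) y - insertion K T x (insertion K T z y) := by
  have hone : ∀ (C : OnePIClass T) (a : K),
      (Finsupp.single C a : GraphSpace K T) = a • Finsupp.single C 1 := fun C a => by simp
  induction x using Finsupp.induction_linear with
  | zero => simp
  | add x x' hx hx' =>
    simp only [map_add, LinearMap.add_apply, add_sub_add_comm, hx, hx']
  | single C₁ a =>
    induction y using Finsupp.induction_linear with
    | zero => simp
    | add y y' hy hy' =>
      simp only [map_add, LinearMap.add_apply, add_sub_add_comm, hy, hy']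
    | single C₂ b =>
      induction z using Finsupp.induction_linear with
      | zero => simp
      | add z z' hz hz' =>
        simp only [map_add, LinearMap.add_apply, add_sub_add_comm, hz, hz']
      | single C₃ d =>
        rw [hone C₁, hone C₂, hone C₃]
        simp only [map_smul, LinearMap.smul_apply]
        linear_combination (norm := module) (a * b * d) • pre_lie_single K T C₁ C₂ C₃

theorem bracket_apply (x y : GraphSpace K T) :
    bracket K T x y = insertion K T x y - insertion K T y x := rfl

/-- The Jacobi sum is minus the sum of the pre-Lie identities for the three cyclic permutations of
x, y, z. -/
theorem jacobi (x y z : GraphSpace K T) :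
    bracket K T x (bracket K T y z) + bracket K T y (bracket K T z x)
      + bracket K T z (bracket K T x y) = 0 := by
  have h1 := sub_eq_zero.2 (pre_lie K T x y z)
  have h2 := sub_eq_zero.2 (pre_lie K T y z x)
  have h3 := sub_eq_zero.2 (pre_lie K T z x y)
  simp only [bracket_apply, map_sub]
  -- The right-hand zero is split into three, each then replaced by one instance of the pre-Lie
  -- identity.
  rw [← neg_eq_zero, ← add_zero (0 : GraphSpace K T), ← add_zero (0 + 0 : GraphSpace K T)]
  nth_rw 1 [← h1]
  nth_rw 1 [← h2]
  nth_rw 1 [← h3]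
  abel

theorem isInternal_degreePart : DirectSum.IsInternal (degreePart K T) := by
  rw [DirectSum.isInternal_submodule_iff_iSupIndep_and_iSup_eq_top]
  constructor
  · intro n
    have h : ⨆ j, ⨆ (_ : j ≠ n), degreePart K T j ≤
        Finsupp.supported K K {C : OnePIClass T | C.loopNumber ≠ n} :=
      iSup₂_le fun j hj => Finsupp.supported_mono fun C (hC : C.loopNumber = j) => hC.trans_ne hj
    have hd : Disjoint {C : OnePIClass T | C.loopNumber = n}
        {C : OnePIClass T | C.loopNumber ≠ n} :=
      Set.disjoint_left.2 fun C hC hC' => hC' hC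
    exact (Finsupp.disjoint_supported_supported hd).mono_right h
  · have h : ⨆ j, degreePart K T j =
        Finsupp.supported K K (⋃ j, {C : OnePIClass T | C.loopNumber = j}) :=
      (Finsupp.supported_iUnion fun j => {C : OnePIClass T | C.loopNumber = j}).symm
    rw [h, ← Finsupp.supported_univ]
    congr 1
    exact Set.eq_univ_of_forall fun C => Set.mem_iUnion.2 ⟨C.loopNumber, rfl⟩

theorem degreePart_zero : degreePart K T 0 = ⊥ := by
  have : {C : OnePIClass T | C.loopNumber = 0} = ∅ :=
    Set.eq_empty_of_forall_notMem fun C hC => C.loopNumber_ne_zero hC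
  rw [degreePart, this, Finsupp.supported_empty]

theorem insertion_mem_degreePart {m n : ℕ} {x y : GraphSpace K T} (hx : x ∈ degreePart K T m)
    (hy : y ∈ degreePart K T n) : insertion K T x y ∈ degreePart K T (m + n) := by
  have h := Submodule.apply_mem_map₂ (insertion K T) hx hy
  rw [degreePart, degreePart, Finsupp.supported_eq_span_single, Finsupp.supported_eq_span_single,
    Submodule.map₂_span_span] at h
  refine Submodule.span_le.2 ?_ h
  rintro _ ⟨_, ⟨C₁, h1, rfl⟩, _, ⟨C₂, h2, rfl⟩, rfl⟩
  rw [SetLike.mem_coe, degreePart, Finsupp.mem_supported']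
  intro C hC
  rw [insertion_single_apply]
  by_contra h0
  have h0' : coeff C₁ C₂ C ≠ 0 := fun h => h0 (by rw [h, Nat.cast_zero])
  refine hC ?_
  rw [Set.mem_ofPred_eq] at h1 h2 ⊢
  rw [loopNumber_add h0', h1, h2]

theorem bracket_mem_degreePart {m n : ℕ} {x y : GraphSpace K T} (hx : x ∈ degreePart K T m)
    (hy : y ∈ degreePart K T n) : bracket K T x y ∈ degreePart K T (m + n) :=
  Submodule.sub_mem _ (insertion_mem_degreePart K T hx hy)
    (add_comm m n ▸ insertion_mem_degreePart K T hy hx)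

end GraphSpace

theorem theorem2p1 (K : Type w) [Field K] [CharZero K] {F : Type u} (T : FieldTheory F) :
    -- loop numbers and coefficients depend only on isomorphism classes, and the sums are finite
    (∀ Γ Γ' : FeynmanGraph F, Γ.Iso Γ' → Γ.loopNumber = Γ'.loopNumber) ∧
    (∀ Γ₁ Γ₁' Γ₂ Γ₂' Γ Γ' : FeynmanGraph F, Γ₁.Iso Γ₁' → Γ₂.Iso Γ₂' → Γ.Iso Γ' →
      FeynmanGraph.sectionCoeff Γ₁ Γ₂ Γ = FeynmanGraph.sectionCoeff Γ₁' Γ₂' Γ') ∧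
    (∀ Γ₁ Γ₂ : OnePIClass T, {Γ : OnePIClass T | OnePIClass.coeff Γ₁ Γ₂ Γ ≠ 0}.Finite) ∧
    -- the insertion product is right pre-Lie
    (∀ x y z : GraphSpace K T,
      GraphSpace.insertion K T (GraphSpace.insertion K T x y) z
          - GraphSpace.insertion K T x (GraphSpace.insertion K T y z)
        = GraphSpace.insertion K T (GraphSpace.insertion K T x z) y
          - GraphSpace.insertion K T x (GraphSpace.insertion K T z y)) ∧
    -- its antisymmetrization is a Lie bracket
    (∀ x : GraphSpace K T, GraphSpace.bracket K T x x = 0) ∧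
    (∀ x y z : GraphSpace K T,
      GraphSpace.bracket K T x (GraphSpace.bracket K T y z)
        + GraphSpace.bracket K T y (GraphSpace.bracket K T z x)
        + GraphSpace.bracket K T z (GraphSpace.bracket K T x y) = 0) ∧
    -- both are graded by the loop number, which is at least one on every 1PI graph
    DirectSum.IsInternal (GraphSpace.degreePart K T) ∧
    GraphSpace.degreePart K T 0 = ⊥ ∧
    (∀ (m n : ℕ) (x y : GraphSpace K T),
      x ∈ GraphSpace.degreePart K T m → y ∈ GraphSpace.degreePart K T n →
        GraphSpace.insertion K T x y ∈ GraphSpace.degreePart K T (m + n) ∧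
        GraphSpace.bracket K T x y ∈ GraphSpace.degreePart K T (m + n)) := by
  refine ⟨fun Γ Γ' h => h.loopNumber_eq, fun _ _ _ _ _ _ h₁ h₂ h =>
    FeynmanGraph.sectionCoeff_congr h₁ h₂ h, OnePIClass.finite_coeff_ne_zero,
    GraphSpace.pre_lie K T, fun x => sub_self _, GraphSpace.jacobi K T,
    GraphSpace.isInternal_degreePart K T, GraphSpace.degreePart_zero K T,
    fun m n x y hx hy => ⟨GraphSpace.insertion_mem_degreePart K T hx hy,
      GraphSpace.bracket_mem_degreePart K T hx hy⟩⟩
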